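/- Let $\mathcal C$ be a small category and let $U\mathcal C$ be the category of simplicial presheaves $F\colon \mathcal C^{op}\to s\mathrm{Set}$ with the Bousfield–Kan (projective) model structure: a map $F\to G$ is a weak equivalence (resp. fibration) if every $F(X)\to G(X)$ is a weak equivalence (resp. Kan fibration) of simplicial sets, and it is a cofibration if it has the left lifting property with respect to all maps that are both fibrations and weak equivalences. For $A\in\mathcal C$ let $rA\in U\mathcal C$ be the discrete simplicial presheaf $Z\mapsto \mathcal C(Z,A)$, and for $F\in U\mathcal C$ and a simplicial set $K$ let $F\otimes K$ be the simplicial presheaf $X\mapsto F(X)\times K$. For $F\in U\mathcal C$ let $(\mathcal C\times\Delta\downarrow F)$ be the overcategory of the functor $\mathcal C\times\Delta\to U\mathcal C$, $(A,[n])\mapsto rA\otimes\Delta^n$; its objects are the data $[(A,[n]),\ rA\otimes\Delta^n\to F]$. Let $$\mathcal QF=\operatorname{hocolim}(\mathcal C\times\Delta\downarrow F)$$ be the Bousfield–Kan homotopy colimit of the canonical diagram $I=(\mathcal C\times\Delta\downarrow F)\to U\mathcal C$, $[(A,[n]),\ rA\otimes\Delta^n\to F]\mapsto rA\otimes\Delta^n$,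 where for a diagram $D\colon I\to U\mathcal C$ $$\operatorname{hocolim} D=\operatorname{coeq}\Bigl[\coprod_{i\to j} D_i\otimes N\bigl((j\downarrow I)^{op}\bigr)\rightrightarrows\coprod_{i} D_i\otimes N\bigl((i\downarrow I)^{op}\bigr)\Bigr].$$ This defines a functor $\mathcal Q\colon U\mathcal C\to U\mathcal C$. The projections $D_i\otimes N((i\downarrow I)^{op})\to D_i$ induce a map from the homotopy colimit to the colimit of the diagram, and composing with the map from the colimit to $F$ given by the structure maps $rA\otimes\Delta^n\to F$ gives a natural map $\mathcal QF\to F$. Then for every $F\in U\mathcal C$ the object $\mathcal QF$ is cofibrant in $U\mathcal C$, and the natural map $\mathcal QF\to F$ is a weak equivalence in $U\mathcal C$. -/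

import Mathlib

open CategoryTheory Limits Opposite MonoidalCategory Simplicial HomotopicalAlgebra

universe u

namespace UniversalHomotopy

noncomputable section

/-! ### Weak equivalences of simplicial sets -/

/-- The set `[X, K]` of simplicial homotopy classes of maps `X ⟶ K`: the quotient of the set of
maps by the equivalence relation generated by simplicial homotopies `X ⊗ Δ[1] ⟶ K`. -/
def HomotopyClasses (X K : SSet.{u}) : Type u :=
  Quot (fun f g : X ⟶ K ↦ Nonempty (SSet.Homotopy f g))

lemma homotopy_precomp {X Y K : SSet.{u}} (f : X ⟶ Y) {g g' : Y ⟶ K}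
    (h : Nonempty (SSet.Homotopy g g')) : Nonempty (SSet.Homotopy (f ≫ g) (f ≫ g')) :=
  h.map fun H ↦
    { h := f ▷ _ ≫ H.h
      h₀ := (SSet.ι₀_comp_assoc f H.h).trans (congrArg (f ≫ ·) H.h₀)
      h₁ := (SSet.ι₁_comp_assoc f H.h).trans (congrArg (f ≫ ·) H.h₁)
      rel := by
        ext n x
        exact x.1.2.elim }

/-- Precomposition with `f : X ⟶ Y`, as a map `[Y, K] → [X, K]`. -/
def HomotopyClasses.precomp {X Y : SSet.{u}} (f : X ⟶ Y) (K : SSet.{u}) :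
    HomotopyClasses Y K → HomotopyClasses X K :=
  Quot.map (fun g ↦ f ≫ g) (fun _ _ h ↦ homotopy_precomp f h)

/-- The weak (homotopy) equivalences of simplicial sets: the maps `f : X ⟶ Y` such that
`[Y, K] → [X, K]` is bijective for every Kan complex `K`. -/
def sSetWeakEquivalences : MorphismProperty SSet.{u} := fun _ _ f ↦
  ∀ (K : SSet.{u}) [SSet.KanComplex K], Function.Bijective (HomotopyClasses.precomp f K)

/-! ### The model category `U C` of simplicial presheaves -/

/-- The category of simplicial presheaves on `C`. -/
abbrev U (C : Type u) [SmallCategory C] := Cᵒᵖ ⥤ SSet.{u}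

variable {C : Type u} [SmallCategory C]

/-- Weak equivalences are objectwise. -/
instance : CategoryWithWeakEquivalences (U C) where
  weakEquivalences := fun _ _ f ↦ ∀ X : Cᵒᵖ, sSetWeakEquivalences (f.app X)

/-- Fibrations are objectwise Kan fibrations. -/
instance : CategoryWithFibrations (U C) where
  fibrations := fun _ _ f ↦ ∀ X : Cᵒᵖ, SSet.modelCategoryQuillen.J.rlp (f.app X)

/-- Cofibrations are the maps with the left lifting property with respect to the maps which are
both fibrations and weak equivalences. -/
instance : CategoryWithCofibrations (U C) where
  cofibrations := (trivialFibrations (U C)).llp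

/-! ### The functor `(A, [n]) ↦ rA ⊗ Δ[n]` -/

/-- The simplicial tensor on `U C`, as a functor of `K` and `F`: `(F ⊗ K)(X) = F(X) × K`. -/
def tensor : SSet.{u} ⥤ U C ⥤ U C :=
  (curriedTensor SSet.{u}).flip ⋙ Functor.whiskeringRight Cᵒᵖ SSet.{u} SSet.{u}

/-- The embedding `r : C ⥤ U C` sending `A` to the discrete simplicial presheaf represented
by `A`. -/
def r : C ⥤ U C :=
  yoneda ⋙ (Functor.whiskeringRight Cᵒᵖ (Type u) SSet.{u}).obj (SimplicialObject.const (Type u))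

/-- The functor `C × Δ ⥤ U C`, `(A, [n]) ↦ rA ⊗ Δ[n]`. -/
def repTensorSimplex : C × SimplexCategory ⥤ U C :=
  r.prod SSet.stdSimplex.{u} ⋙ Functor.uncurry.obj tensor.flip

/-! ### Bousfield-Kan homotopy colimits in `U C` -/

section hocolim

variable {I J : Type u} [SmallCategory I] [SmallCategory J]

variable (I) in
/-- The functor `i ↦ N((i ↓ I)ᵒᵖ)`. -/
def hocolimWeight : Iᵒᵖ ⥤ SSet.{u} :=
  Under.mapFunctor I ⋙ Cat.opFunctor ⋙ nerveFunctor

/-- The bifunctor `(i, j) ↦ D j ⊗ N((i ↓ I)ᵒᵖ)`. -/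
def hocolimBifunctor (D : I ⥤ U C) : Iᵒᵖ ⥤ I ⥤ U C :=
  hocolimWeight I ⋙ tensor ⋙ (Functor.whiskeringLeft I (U C) (U C)).obj D

/-- The Bousfield-Kan homotopy colimit of `D`, that is the coequalizer of
`∐_{i ⟶ j} D i ⊗ N((j ↓ I)ᵒᵖ) ⇉ ∐_i D i ⊗ N((i ↓ I)ᵒᵖ)`. -/
def hocolim (D : I ⥤ U C) : U C := coend (hocolimBifunctor D)

section universalProperty

variable (D : I ⥤ U C)

/-- The canonical map `D i ⊗ N((i ↓ I)ᵒᵖ) ⟶ hocolim D`. -/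
def hocolim.ι (i : I) :
    (tensor.obj ((hocolimWeight I).obj (op i))).obj (D.obj i) ⟶ hocolim D :=
  coend.ι (hocolimBifunctor D) i

lemma hocolim.condition {i j : I} (f : i ⟶ j) :
    (tensor.map ((hocolimWeight I).map f.op)).app (D.obj i) ≫ hocolim.ι D i =
      (tensor.obj ((hocolimWeight I).obj (op j))).map (D.map f) ≫ hocolim.ι D j :=
  coend.condition (hocolimBifunctor D) f

variable {D}

lemma hocolim.hom_ext {T : U C} {f g : hocolim D ⟶ T}
    (h : ∀ i, hocolim.ι D i ≫ f = hocolim.ι D i ≫ g) : f = g :=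
  coend.hom_ext (F := hocolimBifunctor D) h

variable {T : U C}
  (φ : ∀ i, (tensor.obj ((hocolimWeight I).obj (op i))).obj (D.obj i) ⟶ T)
  (hφ : ∀ ⦃i j : I⦄ (f : i ⟶ j),
    (tensor.map ((hocolimWeight I).map f.op)).app (D.obj i) ≫ φ i =
      (tensor.obj ((hocolimWeight I).obj (op j))).map (D.map f) ≫ φ j)

/-- The universal property of the homotopy colimit as a coend. -/
def hocolim.desc : hocolim D ⟶ T :=
  coend.desc (F := hocolimBifunctor D) φ hφ

lemma hocolim.ι_desc (i : I) : hocolim.ι D i ≫ hocolim.desc φ hφ = φ i :=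
  coend.ι_desc (F := hocolimBifunctor D) φ hφ i

end universalProperty

/-- The projection `F ⊗ K ⟶ F`. -/
def tensorFst (F : U C) (K : SSet.{u}) : (tensor.obj K).obj F ⟶ F where
  app X := SemiCartesianMonoidalCategory.fst (F.obj X) K
  naturality X Y f := by simp [tensor]

lemma tensorFst_naturality {F G : U C} (f : F ⟶ G) (K : SSet.{u}) :
    (tensor.obj K).map f ≫ tensorFst G K = tensorFst F K ≫ f := by
  ext X : 2
  simp [tensor, tensorFst]

lemma tensor_map_tensorFst (F : U C) {K L : SSet.{u}} (k : K ⟶ L) :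
    (tensor.map k).app F ≫ tensorFst F L = tensorFst F K := by
  ext X : 2
  simp [tensor, tensorFst]

/-- The natural map from the homotopy colimit to the colimit, induced by the projections
`D i ⊗ N((i ↓ I)ᵒᵖ) ⟶ D i`. -/
def hocolimToColimit (D : I ⥤ U C) : hocolim D ⟶ colimit D :=
  hocolim.desc (fun i ↦ tensorFst (D.obj i) ((hocolimWeight I).obj (op i)) ≫ colimit.ι D i)
    (fun i j f ↦ by
      rw [reassoc_of% tensor_map_tensorFst, reassoc_of% tensorFst_naturality, colimit.w])

lemma ι_hocolimToColimit (D : I ⥤ U C) (i : I) :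
    hocolim.ι D i ≫ hocolimToColimit D = tensorFst (D.obj i) _ ≫ colimit.ι D i :=
  hocolim.ι_desc _ _ i

/-- The map `N((i ↓ I)ᵒᵖ) ⟶ N((G i ↓ J)ᵒᵖ)` induced by `G : I ⥤ J`. -/
def hocolimWeightMap (G : I ⥤ J) (i : I) :
    (hocolimWeight I).obj (op i) ⟶ (hocolimWeight J).obj (op (G.obj i)) :=
  nerveMap (Under.post (X := i) G).op

lemma hocolimWeightMap_naturality (G : I ⥤ J) {i j : I} (f : i ⟶ j) :
    (hocolimWeight I).map f.op ≫ hocolimWeightMap G i =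
      hocolimWeightMap G j ≫ (hocolimWeight J).map (G.map f).op := by
  have h : Under.map f ⋙ Under.post (X := i) G =
      Under.post (X := j) G ⋙ Under.map (G.map f) := by
    have h₀ (X : Under j) : (Under.map f ⋙ Under.post (X := i) G).obj X =
        (Under.post (X := j) G ⋙ Under.map (G.map f)).obj X :=
      congrArg Under.mk (G.map_comp f X.hom)
    refine CategoryTheory.Functor.ext h₀ (fun X Y g ↦ ?_)
    ext
    rw [Under.comp_right, Under.comp_right, Under.eqToHom_right, Under.eqToHom_right]
    exact ((Category.id_comp _).trans (Category.comp_id _)).symm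
  exact congrArg (fun (H : Under j ⥤ Under (G.obj i)) ↦ nerveMap H.op) h

/-- The canonical map `hocolim (D ∘ G) ⟶ hocolim D` induced by a functor `G : I ⥤ J` of indexing
categories. -/
def hocolimPre (G : I ⥤ J) (D : J ⥤ U C) : hocolim (G ⋙ D) ⟶ hocolim D :=
  hocolim.desc
    (fun i ↦ (tensor.map (hocolimWeightMap G i)).app (D.obj (G.obj i)) ≫
      hocolim.ι D (G.obj i))
    (fun i j f ↦ by
      have h := congrArg (fun φ ↦ (tensor.map φ).app (D.obj (G.obj i)))
        (hocolimWeightMap_naturality G f)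
      simp only [Functor.map_comp, NatTrans.comp_app] at h
      dsimp only [Functor.comp_obj, Functor.comp_map]
      rw [reassoc_of% h, hocolim.condition, NatTrans.naturality_assoc])

lemma ι_hocolimPre (G : I ⥤ J) (D : J ⥤ U C) (i : I) :
    hocolim.ι (G ⋙ D) i ≫ hocolimPre G D =
      (tensor.map (hocolimWeightMap G i)).app (D.obj (G.obj i)) ≫ hocolim.ι D (G.obj i) :=
  hocolim.ι_desc _ _ i

lemma hocolimPre_id (D : I ⥤ U C) : hocolimPre (𝟭 I) D = 𝟙 (hocolim D) := by
  refine hocolim.hom_ext (fun i ↦ (ι_hocolimPre (𝟭 I) D i).trans ?_)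
  have h : hocolimWeightMap (𝟭 I) i = 𝟙 _ := rfl
  rw [h, CategoryTheory.Functor.map_id, NatTrans.id_app]
  exact (Category.id_comp _).trans (Category.comp_id _).symm

lemma hocolimPre_comp {K : Type u} [SmallCategory K] (G : I ⥤ J) (H : J ⥤ K) (D : K ⥤ U C) :
    hocolimPre (G ⋙ H) D = hocolimPre G (H ⋙ D) ≫ hocolimPre H D := by
  refine hocolim.hom_ext (fun i ↦ (ι_hocolimPre (G ⋙ H) D i).trans ?_)
  have h : hocolimWeightMap (G ⋙ H) i =
    hocolimWeightMap G i ≫ hocolimWeightMap H (G.obj i) := rfl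
  rw [h, Functor.map_comp, NatTrans.comp_app]
  refine (Category.assoc _ _ _).trans ?_
  refine Eq.trans (Eq.trans ?_ (Category.assoc _ _ _).symm)
    ((congrArg (· ≫ hocolimPre H D) (ι_hocolimPre G (H ⋙ D) i).symm).trans (Category.assoc _ _ _))
  exact congrArg _ (ι_hocolimPre H D (G.obj i)).symm

lemma hocolimPre_congr {G G' : I ⥤ J} (h : G = G') (D : J ⥤ U C) :
    hocolimPre G D = eqToHom (by rw [h]) ≫ hocolimPre G' D := by
  subst h
  exact (Category.id_comp _).symm

lemma hocolimPre_toColimit (G : I ⥤ J) (D : J ⥤ U C) :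
    hocolimPre G D ≫ hocolimToColimit D = hocolimToColimit (G ⋙ D) ≫ colimit.pre D G := by
  refine hocolim.hom_ext (fun i ↦ ?_)
  rw [reassoc_of% ι_hocolimPre, ι_hocolimToColimit, reassoc_of% ι_hocolimToColimit,
    colimit.ι_pre, reassoc_of% tensor_map_tensorFst]
  rfl

end hocolim

/-! ### The canonical homotopy colimit -/

/-- The canonical diagram `(C × Δ ↓ F) ⥤ U C`, `[(A, [n]), rA ⊗ Δ[n] ⟶ F] ↦ rA ⊗ Δ[n]`. -/
def canonicalDiagram (F : U C) : CostructuredArrow (repTensorSimplex (C := C)) F ⥤ U C :=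
  CostructuredArrow.proj repTensorSimplex F ⋙ repTensorSimplex

/-- The canonical cocone on `canonicalDiagram F` with point `F`. -/
def canonicalCocone (F : U C) : Cocone (canonicalDiagram F) where
  pt := F
  ι :=
    { app := fun i ↦ i.hom
      naturality := fun _ _ f ↦ (CostructuredArrow.w f).trans (Category.comp_id _).symm }

/-- The functor `𝒬 : U C ⥤ U C`, `𝒬 F = hocolim (C × Δ ↓ F)`. -/
def Q : U C ⥤ U C where
  obj F := hocolim (canonicalDiagram F)
  map {F G} f := hocolimPre (CostructuredArrow.map f) (canonicalDiagram G)
  map_id F := by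
    have h : CostructuredArrow.map (𝟙 F) = 𝟭 (CostructuredArrow (repTensorSimplex (C := C)) F) :=
      CategoryTheory.Functor.ext (fun _ ↦ CostructuredArrow.map_id) (fun X Y f ↦ by ext <;> simp)
    exact (hocolimPre_congr h _).trans ((Category.id_comp _).trans (hocolimPre_id _))
  map_comp {F G H} f g := by
    have h : CostructuredArrow.map (S := repTensorSimplex (C := C)) (f ≫ g) =
        CostructuredArrow.map f ⋙ CostructuredArrow.map g :=
      CategoryTheory.Functor.ext (fun _ ↦ CostructuredArrow.map_comp)
        (fun X Y f ↦ by ext <;> simp)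
    exact (hocolimPre_congr h _).trans ((Category.id_comp _).trans (hocolimPre_comp _ _ _))

/-- The natural map `𝒬 F ⟶ F`: the map from the homotopy colimit of the canonical diagram to its
colimit, followed by the map from the colimit to `F`. -/
def Qε : Q (C := C) ⟶ 𝟭 (U C) where
  app F := hocolimToColimit (canonicalDiagram F) ≫
    colimit.desc (canonicalDiagram F) (canonicalCocone F)
  naturality F G f := by
    have h := hocolimPre_toColimit (CostructuredArrow.map f) (canonicalDiagram G)
    refine Eq.trans ((reassoc_of% h) _) (Eq.trans ?_ (Category.assoc _ _ _).symm)
    refine congrArg (hocolimToColimit (canonicalDiagram F) ≫ ·) ?_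
    refine colimit.hom_ext (F := canonicalDiagram F) (fun i ↦ ?_)
    refine (colimit.ι_pre_assoc (canonicalDiagram G) (CostructuredArrow.map f) i _).trans ?_
    refine (colimit.ι_desc (canonicalCocone G) _).trans ?_
    exact (colimit.ι_desc_assoc (canonicalCocone F) i f).symm


end

end UniversalHomotopy

namespace UniversalHomotopy

open SSet.modelCategoryQuillen
open SSet (ι₀ ι₁ anodyneExtensions KanComplex)

/-! Cofibrancy. Write I for the indexing category. A map from `Q.obj F` to B is, by the coend
formula and Yoneda, a natural transformation from the weight i ↦ N((i ↓ I)ᵒᵖ) to the diagram i ↦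
B(A)^{Δ[n]}, where i lies over (A, [n]). An m-simplex of the weight at i is a chain of length m in
Iᵒᵖ together with an arbitrary map from i to its last vertex, so the weight is levelwise a coproduct
of representables. It therefore lifts along pointwise trivial fibrations
(`exists_lift_hocolimWeight`), and cotensoring with Δ[n] preserves these. Hence
`exists_lift_hocolim`, which gives the lift of any map out of `Q.obj F`.

This uses trivial fibrations in the sense of lifting against all ∂Δ[n] ⟶ Δ[n], whereas weak
equivalences are defined by homotopy classes of maps into Kan complexes. The bridge is
`rlp_of_fibration_of_weakEquivalence`: a Kan fibration which is a weak equivalence has that lifting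
property. Between Kan complexes the classical argument applies: a homotopy inverse is straightened
to a section with a fibrewise homotopy. Over a general base B, choose an anodyne map from B to a Kan
complex and extend the fibration p along it. Factor p as a monomorphism followed by a trivial
fibration. The monomorphism is a weak equivalence, hence lifts against the extended fibration, and p
becomes a retract of a trivial fibration. That Kan fibrations extend along anodyne maps is proved
for horns and propagated through the cellular operations (`anodyneExtensions_le_extendsFibrations`).
It follows that monic weak equivalences are anodyne.

Weak equivalence. At X, an m-simplex of the homotopy colimit is a chain in Iᵒᵖ with an m-simplex of
rA ⊗ Δ[n] at its last vertex, that is, maps X ⟶ A and [m] ⟶ [n]. The map X ⟶ A turns the chain into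
a chain of objects of I under X, so `Q.obj F` at X is the simplicial replacement of a diagram of
standard simplices over that category. Sending such an object to the simplex of F(X) it determines
is, up to natural transformations preserving dimension, inverse to sending a simplex to the map rX ⊗
Δ[n] ⟶ F that it classifies. What remains is `weakEquivalence_barπ`: the simplicial replacement of
the diagram of simplices of any Y is weakly equivalent to Y.

For Y = Δ[n] this holds because the top simplex gives a contraction. The replacement functor is a
left adjoint preserving monomorphisms, so the general case follows by cell induction
(`weakEquivalence_of_stdSimplex`). The induction is run on lifting properties of the inclusion into
the mapping cylinder. -/

instance mono_whiskerLeft (X : SSet.{u}) {A B : SSet.{u}} (i : A ⟶ B) [Mono i] :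
    Mono (X ◁ i) where
  right_cancellation f g h := by
    apply CartesianMonoidalCategory.hom_ext
    · simpa using h =≫ CartesianMonoidalCategory.fst _ _
    · simpa [← cancel_mono i] using h =≫ CartesianMonoidalCategory.snd _ _

instance mono_whiskerRight (X : SSet.{u}) {A B : SSet.{u}} (i : A ⟶ B) [Mono i] :
    Mono (i ▷ X) where
  right_cancellation f g h := by
    apply CartesianMonoidalCategory.hom_ext
    · simpa [← cancel_mono i] using h =≫ CartesianMonoidalCategory.fst _ _
    · simpa using h =≫ CartesianMonoidalCategory.snd _ _

/-! ### Lifting against pushout-products. -/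

section lifting

variable {A B A' B' Z W : SSet.{u}} {i : A ⟶ B} {j : A' ⟶ B'} {p : Z ⟶ W}

/-- This unpacks lifting against the pushout-product of `i` and `j`: a map out of the pushout is a
pair `a`, `b` agreeing on `A ⊗ A'`. -/
lemma exists_lift_of_pushoutObjObj
    (h : ∀ sq : (curriedTensor SSet.{u}).PushoutObjObj i j, HasLiftingProperty sq.ι p)
    (a : B ⊗ A' ⟶ Z) (b : A ⊗ B' ⟶ Z) (w : B ⊗ B' ⟶ W)
    (hab : i ▷ A' ≫ a = A ◁ j ≫ b) (haw : a ≫ p = B ◁ j ≫ w) (hbw : b ≫ p = i ▷ B' ≫ w) :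
    ∃ g : B ⊗ B' ⟶ Z, B ◁ j ≫ g = a ∧ i ▷ B' ≫ g = b ∧ g ≫ p = w := by
  let sq := Functor.PushoutObjObj.ofHasPushout (curriedTensor SSet.{u}) i j
  have := h sq
  have comm : CommSq (sq.isPushout.desc a b hab) sq.ι p w := ⟨by
    apply sq.hom_ext
    · rw [sq.isPushout.inl_desc_assoc, sq.inl_ι_assoc]; exact haw
    · rw [sq.isPushout.inr_desc_assoc, sq.inr_ι_assoc]; exact hbw⟩
  refine ⟨comm.lift, ?_, ?_, comm.fac_right⟩
  · have := sq.inl ≫= comm.fac_left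
    rwa [sq.inl_ι_assoc, sq.isPushout.inl_desc] at this
  · have := sq.inr ≫= comm.fac_left
    rwa [sq.inr_ι_assoc, sq.isPushout.inr_desc] at this

lemma exists_lift_of_anodyne_left (hi : anodyneExtensions i) [Mono j] [hp : Fibration p]
    (a : B ⊗ A' ⟶ Z) (b : A ⊗ B' ⟶ Z) (w : B ⊗ B' ⟶ W)
    (hab : i ▷ A' ≫ a = A ◁ j ≫ b) (haw : a ≫ p = B ◁ j ≫ w) (hbw : b ≫ p = i ▷ B' ≫ w) :
    ∃ g : B ⊗ B' ⟶ Z, B ◁ j ≫ g = a ∧ i ▷ B' ≫ g = b ∧ g ≫ p = w :=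
  exists_lift_of_pushoutObjObj
    (fun sq ↦ SSet.anodyneExtensions_pushoutObjObjι' sq hi _ hp.mem) a b w hab haw hbw

lemma exists_lift_of_anodyne_right [Mono i] (hj : anodyneExtensions j) [hp : Fibration p]
    (a : B ⊗ A' ⟶ Z) (b : A ⊗ B' ⟶ Z) (w : B ⊗ B' ⟶ W)
    (hab : i ▷ A' ≫ a = A ◁ j ≫ b) (haw : a ≫ p = B ◁ j ≫ w) (hbw : b ≫ p = i ▷ B' ≫ w) :
    ∃ g : B ⊗ B' ⟶ Z, B ◁ j ≫ g = a ∧ i ▷ B' ≫ g = b ∧ g ≫ p = w :=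
  exists_lift_of_pushoutObjObj
    (fun sq ↦ SSet.anodyneExtensions_pushoutObjObjι sq hj _ hp.mem) a b w hab haw hbw

end lifting

/-! ### Homotopy extension and lifting along the interval. -/

section interval

/-- The face opposite the vertex `e` of Δ[1] is the other vertex, which is all of the horn with
index `e.rev`; a horn of dimension one has a single face, so compatibility is vacuous. -/
lemma anodyneExtensions_δ (e : Fin 2) :
    anodyneExtensions (SSet.stdSimplex.δ e : (Δ[0] : SSet.{u}) ⟶ Δ[1]) := by
  intro Z W p hp
  have : Fibration p := ⟨hp⟩
  refine ⟨fun {a b} sq ↦ ?_⟩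
  obtain ⟨φ, h₁, h₂⟩ := SSet.horn.IsCompatible.exists_lift (i := e.rev) (n := 0)
    (f := fun _ _ ↦ a) (by simp) p b (fun j hj ↦ by
      obtain rfl : j = e := by fin_cases e <;> fin_cases j <;> simp_all
      exact sq.w)
  exact ⟨⟨⟨φ, h₁ e (by fin_cases e <;> decide), h₂⟩⟩⟩

/-- Indices are swapped: the face opposite vertex 1 is vertex 0, so `δ 1` corresponds to `ι₀`, and
`δ 0` to `ι₁`. -/
lemma whiskerLeft_δ_one (B : SSet.{u}) :
    B ◁ (SSet.stdSimplex.δ (1 : Fin 2) : (Δ[0] : SSet.{u}) ⟶ Δ[1]) =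
      CartesianMonoidalCategory.fst _ _ ≫ ι₀ := by
  apply CartesianMonoidalCategory.hom_ext
  · simp
  · rw [SSet.stdSimplex.δ_one_eq_const]
    rfl

lemma whiskerLeft_δ_zero (B : SSet.{u}) :
    B ◁ (SSet.stdSimplex.δ (0 : Fin 2) : (Δ[0] : SSet.{u}) ⟶ Δ[1]) =
      CartesianMonoidalCategory.fst _ _ ≫ ι₁ := by
  apply CartesianMonoidalCategory.hom_ext
  · simp
  · rw [SSet.stdSimplex.δ_zero_eq_const]
    rfl

/-- The section `B ⟶ B ⊗ Δ[0]` of the projection. -/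
noncomputable def toTensorPoint (B : SSet.{u}) : B ⟶ B ⊗ Δ[0] :=
  CartesianMonoidalCategory.lift (𝟙 _) (SSet.stdSimplex.isTerminalObj₀.from _)

@[simp]
lemma toTensorPoint_fst (B : SSet.{u}) :
    toTensorPoint B ≫ CartesianMonoidalCategory.fst _ _ = 𝟙 B := by
  simp [toTensorPoint]

@[simp]
lemma toTensorPoint_fst_assoc (B : SSet.{u}) {Z : SSet.{u}} (f : B ⟶ Z) :
    toTensorPoint B ≫ CartesianMonoidalCategory.fst _ _ ≫ f = f := by
  simp [toTensorPoint]

variable {A B Z W : SSet.{u}} (i : A ⟶ B) [Mono i] (p : Z ⟶ W) [Fibration p]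

/-- The homotopy extension lifting property, from the end `0`. -/
lemma exists_homotopy_lift₀ (H : A ⊗ Δ[1] ⟶ Z) (f : B ⟶ Z) (w : B ⊗ Δ[1] ⟶ W)
    (h : i ≫ f = ι₀ ≫ H) (hf : f ≫ p = ι₀ ≫ w) (hH : H ≫ p = i ▷ _ ≫ w) :
    ∃ G : B ⊗ Δ[1] ⟶ Z, ι₀ ≫ G = f ∧ i ▷ _ ≫ G = H ∧ G ≫ p = w := by
  obtain ⟨G, h₁, h₂, h₃⟩ := exists_lift_of_anodyne_right (i := i) (p := p)
    (anodyneExtensions_δ 1) (CartesianMonoidalCategory.fst _ _ ≫ f) H w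
    (by rw [whiskerLeft_δ_one, Category.assoc, ← h]; simp)
    (by rw [whiskerLeft_δ_one, Category.assoc, Category.assoc, hf]) hH
  refine ⟨G, ?_, h₂, h₃⟩
  simpa [whiskerLeft_δ_one] using toTensorPoint B ≫= h₁

/-- The homotopy extension lifting property, from the end `1`. -/
lemma exists_homotopy_lift₁ (H : A ⊗ Δ[1] ⟶ Z) (f : B ⟶ Z) (w : B ⊗ Δ[1] ⟶ W)
    (h : i ≫ f = ι₁ ≫ H) (hf : f ≫ p = ι₁ ≫ w) (hH : H ≫ p = i ▷ _ ≫ w) :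
    ∃ G : B ⊗ Δ[1] ⟶ Z, ι₁ ≫ G = f ∧ i ▷ _ ≫ G = H ∧ G ≫ p = w := by
  obtain ⟨G, h₁, h₂, h₃⟩ := exists_lift_of_anodyne_right (i := i) (p := p)
    (anodyneExtensions_δ 0) (CartesianMonoidalCategory.fst _ _ ≫ f) H w
    (by rw [whiskerLeft_δ_zero, Category.assoc, ← h]; simp)
    (by rw [whiskerLeft_δ_zero, Category.assoc, Category.assoc, hf]) hH
  refine ⟨G, ?_, h₂, h₃⟩
  simpa [whiskerLeft_δ_zero] using toTensorPoint B ≫= h₁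

end interval

/-! ### Homotopies with prescribed ends. -/

section boundary

/-- A simplex of Δ[1] lies in the boundary exactly when it is not surjective onto {0, 1}, hence when
it is constant. This is why maps out of `X ⊗ ∂Δ[1]` may be defined by testing the value at 0 only.
-/
lemma boundary_one_apply_eq {m : SimplexCategoryᵒᵖ} (t : (∂Δ[1] : SSet.{u}).obj m)
    (a b : Fin (m.unop.len + 1)) :
    SSet.stdSimplex.asOrderHom t.1 a = SSet.stdSimplex.asOrderHom t.1 b := by
  by_contra h
  refine t.2 ?_
  intro k
  by_contra hk
  push Not at hk
  have ha := hk a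
  have hb := hk b
  generalize SSet.stdSimplex.asOrderHom t.1 a = x at *
  generalize SSet.stdSimplex.asOrderHom t.1 b = y at *
  fin_cases k <;> fin_cases x <;> fin_cases y <;> simp_all

open Classical in
/-- The map `X ⊗ ∂Δ[1] ⟶ Y` which is `f` over `0` and `g` over `1`. -/
noncomputable def boundaryDesc {X Y : SSet.{u}} (f g : X ⟶ Y) : X ⊗ (∂Δ[1] : SSet.{u}) ⟶ Y where
  app m := ↾fun x ↦
    if (SSet.stdSimplex.asOrderHom x.2.1) 0 = 0 then f.app m x.1 else g.app m x.1
  naturality m m' θ := by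
    ext x
    have : SSet.stdSimplex.asOrderHom ((X ⊗ (∂Δ[1] : SSet.{u})).map θ x).2.1 0 =
        SSet.stdSimplex.asOrderHom x.2.1 0 :=
      boundary_one_apply_eq x.2 (θ.unop.toOrderHom 0) 0
    change (if SSet.stdSimplex.asOrderHom ((X ⊗ (∂Δ[1] : SSet.{u})).map θ x).2.1 0 = 0 then
      f.app m' (X.map θ x.1) else g.app m' (X.map θ x.1)) =
      Y.map θ (if SSet.stdSimplex.asOrderHom x.2.1 0 = 0 then f.app m x.1 else g.app m x.1)
    rw [this]
    split_ifs
    · exact NatTrans.naturality_apply f θ x.1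
    · exact NatTrans.naturality_apply g θ x.1

open Classical in
lemma boundaryDesc_app {X Y : SSet.{u}} (f g : X ⟶ Y) {m : SimplexCategoryᵒᵖ} (x : X.obj m)
    (t : (∂Δ[1] : SSet.{u}).obj m) :
    (boundaryDesc f g).app m (x, t) =
      if (SSet.stdSimplex.asOrderHom t.1) 0 = 0 then f.app m x else g.app m x := rfl

lemma comp_boundaryDesc {X Y Z : SSet.{u}} (i : X ⟶ Y) (f g : Y ⟶ Z) :
    i ▷ _ ≫ boundaryDesc f g = boundaryDesc (i ≫ f) (i ≫ g) := rfl

lemma boundaryDesc_comp {X Y Z : SSet.{u}} (f g : X ⟶ Y) (p : Y ⟶ Z) :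
    boundaryDesc f g ≫ p = boundaryDesc (f ≫ p) (g ≫ p) := by
  ext m x
  exact apply_ite (p.app m) _ _ _

lemma boundary_comp_eq {X Y : SSet.{u}} (H : X ⊗ Δ[1] ⟶ Y) :
    X ◁ ∂Δ[1].ι ≫ H = boundaryDesc (ι₀ ≫ H) (ι₁ ≫ H) := by
  ext m ⟨x, t⟩
  change H.app m (x, t.1) = if (SSet.stdSimplex.asOrderHom t.1) 0 = 0 then
    H.app m (ι₀.app m x) else H.app m (ι₁.app m x)
  split_ifs with h
  · congr 1
    refine Prod.ext rfl (SSet.stdSimplex.objEquiv.injective ?_)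
    ext k : 3
    exact (boundary_one_apply_eq t k 0).trans h
  · congr 1
    refine Prod.ext rfl (SSet.stdSimplex.objEquiv.injective ?_)
    ext k : 3
    refine (boundary_one_apply_eq t k 0).trans ?_
    generalize SSet.stdSimplex.asOrderHom t.1 0 = x at h ⊢
    fin_cases x <;> simp_all
    rfl

lemma vertex_mem_boundary_one (e : Fin 2) :
    (SSet.stdSimplex.obj₀Equiv.{u}.symm e : (Δ[1] : SSet.{u}) _⦋0⦌) ∈
      (∂Δ[1] : (Δ[1] : SSet.{u}).Subcomplex).obj (op ⦋0⦌) := by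
  rw [SSet.boundary_obj_eq_univ 0 1]
  trivial

/-- The inclusion of `X` into `X ⊗ ∂Δ[1]` over a vertex. -/
noncomputable def toTensorBoundary (X : SSet.{u}) (e : Fin 2) : X ⟶ X ⊗ (∂Δ[1] : SSet.{u}) :=
  CartesianMonoidalCategory.lift (𝟙 X) (SSet.const ⟨_, vertex_mem_boundary_one e⟩)

lemma toTensorBoundary_zero_desc {X Y : SSet.{u}} (f g : X ⟶ Y) :
    toTensorBoundary X 0 ≫ boundaryDesc f g = f := by
  ext m x
  refine (boundaryDesc_app f g x ((toTensorBoundary X 0).app m x).2).trans (if_pos ?_)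
  rfl

lemma toTensorBoundary_one_desc {X Y : SSet.{u}} (f g : X ⟶ Y) :
    toTensorBoundary X 1 ≫ boundaryDesc f g = g := by
  ext m x
  refine (boundaryDesc_app f g x ((toTensorBoundary X 1).app m x).2).trans (if_neg ?_)
  exact one_ne_zero (α := Fin 2)

/-- Converts between the boundary condition needed for pushout-product lifting and the two end
conditions of a homotopy. -/
lemma boundary_comp_eq_iff {X Y : SSet.{u}} (H : X ⊗ Δ[1] ⟶ Y) (f g : X ⟶ Y) :
    X ◁ ∂Δ[1].ι ≫ H = boundaryDesc f g ↔ ι₀ ≫ H = f ∧ ι₁ ≫ H = g := by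
  refine ⟨fun h ↦ ⟨?_, ?_⟩, by rintro ⟨rfl, rfl⟩; exact boundary_comp_eq H⟩
  · exact (toTensorBoundary X 0 ≫= h).trans (toTensorBoundary_zero_desc f g)
  · exact (toTensorBoundary X 1 ≫= h).trans (toTensorBoundary_one_desc f g)

/-- Homotopies can be extended and lifted along anodyne extensions, with prescribed ends. -/
lemma exists_homotopy_lift_of_anodyne {A B Z W : SSet.{u}} {i : A ⟶ B} (hi : anodyneExtensions i)
    (p : Z ⟶ W) [Fibration p] (f g : B ⟶ Z) (H : A ⊗ Δ[1] ⟶ Z) (w : B ⊗ Δ[1] ⟶ W)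
    (h₀ : ι₀ ≫ H = i ≫ f) (h₁ : ι₁ ≫ H = i ≫ g) (hf : ι₀ ≫ w = f ≫ p) (hg : ι₁ ≫ w = g ≫ p)
    (hH : H ≫ p = i ▷ _ ≫ w) :
    ∃ G : B ⊗ Δ[1] ⟶ Z, ι₀ ≫ G = f ∧ ι₁ ≫ G = g ∧ i ▷ _ ≫ G = H ∧ G ≫ p = w := by
  obtain ⟨G, h, hHG, hwG⟩ := exists_lift_of_anodyne_left (j := ∂Δ[1].ι) (p := p) hi
    (boundaryDesc f g) H w
    (by rw [comp_boundaryDesc, eq_comm, boundary_comp_eq_iff]; exact ⟨h₀, h₁⟩)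
    (by rw [boundaryDesc_comp, eq_comm, boundary_comp_eq_iff]; exact ⟨hf, hg⟩) hH
  rw [boundary_comp_eq_iff] at h
  exact ⟨G, h.1, h.2, hHG, hwG⟩

/-- Lifts of homotopies with prescribed ends against trivial fibrations. -/
lemma exists_homotopy_lift_of_rlp {X Z W : SSet.{u}} (p : Z ⟶ W) (hp : I.rlp p) (f g : X ⟶ Z)
    (w : X ⊗ Δ[1] ⟶ W) (hf : ι₀ ≫ w = f ≫ p) (hg : ι₁ ≫ w = g ≫ p) :
    ∃ G : X ⊗ Δ[1] ⟶ Z, ι₀ ≫ G = f ∧ ι₁ ≫ G = g ∧ G ≫ p = w := by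
  rw [← SSet.rlp_monomorphisms] at hp
  have : HasLiftingProperty (X ◁ ∂Δ[1].ι) p := hp _ (MorphismProperty.monomorphisms.infer_property _)
  have sq : CommSq (boundaryDesc f g) (X ◁ ∂Δ[1].ι) p w := ⟨by
    rw [boundaryDesc_comp, eq_comm, boundary_comp_eq_iff]; exact ⟨hf, hg⟩⟩
  have h := sq.fac_left
  rw [boundary_comp_eq_iff] at h
  exact ⟨sq.lift, h.1, h.2, sq.fac_right⟩

end boundary

/-! ### Homotopy of maps into a Kan complex is an equivalence relation. -/

section homotopy

/-- Two maps are (directly) homotopic if there is a simplicial homotopy between them. -/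
def Htpy {X Y : SSet.{u}} (f g : X ⟶ Y) : Prop :=
  ∃ H : X ⊗ Δ[1] ⟶ Y, ι₀ ≫ H = f ∧ ι₁ ≫ H = g

lemma nonempty_homotopy_iff {X Y : SSet.{u}} (f g : X ⟶ Y) :
    Nonempty (SSet.Homotopy f g) ↔ Htpy f g :=
  ⟨fun ⟨H⟩ ↦ ⟨H.h, H.h₀, H.h₁⟩, fun ⟨H, h₀, h₁⟩ ↦
    ⟨{ h := H, h₀ := h₀, h₁ := h₁
       rel := by
        ext n x
        exact x.1.2.elim }⟩⟩

lemma Htpy.refl {X Y : SSet.{u}} (f : X ⟶ Y) : Htpy f f :=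
  ⟨CartesianMonoidalCategory.fst _ _ ≫ f, by simp, by simp⟩

lemma Htpy.precomp {X Y Z : SSet.{u}} {f g : Y ⟶ Z} (h : Htpy f g) (i : X ⟶ Y) :
    Htpy (i ≫ f) (i ≫ g) := by
  obtain ⟨H, rfl, rfl⟩ := h
  exact ⟨i ▷ _ ≫ H, by simp, by simp⟩

lemma Htpy.postcomp {X Y Z : SSet.{u}} {f g : X ⟶ Y} (h : Htpy f g) (p : Y ⟶ Z) :
    Htpy (f ≫ p) (g ≫ p) := by
  obtain ⟨H, rfl, rfl⟩ := h
  exact ⟨H ≫ p, by simp, by simp⟩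

lemma ι₀_whiskerLeft_δ_zero (X : SSet.{u}) :
    ι₀ ≫ X ◁ (SSet.stdSimplex.δ (0 : Fin 3) : (Δ[1] : SSet.{u}) ⟶ Δ[2]) =
      ι₁ ≫ X ◁ SSet.stdSimplex.δ (2 : Fin 3) := by
  apply CartesianMonoidalCategory.hom_ext
  · simp
  · ext m x
    apply SSet.stdSimplex.objEquiv.injective
    ext k
    rfl

lemma ι₁_whiskerLeft_δ_zero (X : SSet.{u}) :
    ι₁ ≫ X ◁ (SSet.stdSimplex.δ (0 : Fin 3) : (Δ[1] : SSet.{u}) ⟶ Δ[2]) =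
      ι₁ ≫ X ◁ SSet.stdSimplex.δ (1 : Fin 3) := by
  apply CartesianMonoidalCategory.hom_ext
  · simp
  · ext m x
    apply SSet.stdSimplex.objEquiv.injective
    ext k
    rfl

/-- Filling of the horns `X ⊗ Λ[2, 0]` in a Kan fibration. -/
lemma exists_triangle {X Z W : SSet.{u}} (p : Z ⟶ W) [Fibration p] (H₁ H₂ : X ⊗ Δ[1] ⟶ Z)
    (h : ι₀ ≫ H₁ = ι₀ ≫ H₂) (w : X ⊗ Δ[2] ⟶ W)
    (hw₁ : X ◁ SSet.stdSimplex.δ (2 : Fin 3) ≫ w = H₁ ≫ p)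
    (hw₂ : X ◁ SSet.stdSimplex.δ (1 : Fin 3) ≫ w = H₂ ≫ p) :
    ∃ H : X ⊗ Δ[1] ⟶ Z, ι₀ ≫ H = ι₁ ≫ H₁ ∧ ι₁ ≫ H = ι₁ ≫ H₂ ∧
      H ≫ p = X ◁ SSet.stdSimplex.δ (0 : Fin 3) ≫ w := by
  -- By currying, the horn lives in the mapping space from `X` to `Z`. `H₁` is the edge 01 (face 2),
  -- `H₂` is the edge 02 (face 1), and the missing face 0 is the homotopy sought.
  let f (j : Fin 3) (hj : j ≠ 0) : (Δ[1] : SSet.{u}) ⟶ (ihom X).obj Z :=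
    MonoidalClosed.curry (if j = 1 then H₂ else H₁)
  obtain ⟨φ, h₁, h₂⟩ := SSet.horn.IsCompatible.exists_lift (i := (0 : Fin 3)) (f := f) (by
    simp only [SSet.horn.isCompatible_iff]
    intro j k hj hk hjk
    obtain rfl : j = 1 := by grind
    obtain rfl : k = 2 := by grind
    simp only [f, ↓reduceIte, ← MonoidalClosed.curry_natural_left]
    congr 1
    change X ◁ SSet.stdSimplex.δ (1 : Fin 2) ≫ H₂ = X ◁ SSet.stdSimplex.δ (1 : Fin 2) ≫ H₁
    rw [whiskerLeft_δ_one, Category.assoc, Category.assoc, h])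
    ((ihom X).map p) (MonoidalClosed.curry w) (by
    intro j hj
    dsimp [f]
    rw [← MonoidalClosed.curry_natural_right, ← MonoidalClosed.curry_natural_left]
    congr 1
    obtain rfl | rfl : j = 1 ∨ j = 2 := by grind
    · exact hw₂.symm
    · exact hw₁.symm)
  have h₁' (j : Fin 3) (hj : j ≠ 0) : X ◁ SSet.stdSimplex.δ j ≫ MonoidalClosed.uncurry φ =
      (if j = 1 then H₂ else H₁) := by
    rw [← MonoidalClosed.uncurry_natural_left, h₁ j hj, MonoidalClosed.uncurry_curry]
  have h₂' : MonoidalClosed.uncurry φ ≫ p = w := by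
    rw [← MonoidalClosed.uncurry_natural_right, h₂, MonoidalClosed.uncurry_curry]
  have e₁ := h₁' 1 (by simp)
  have e₂ := h₁' 2 (by simp)
  simp only [↓reduceIte, Fin.reduceEq] at e₁ e₂
  refine ⟨X ◁ SSet.stdSimplex.δ 0 ≫ MonoidalClosed.uncurry φ, ?_, ?_, ?_⟩
  · rw [← e₂]
    exact congrArg (· ≫ MonoidalClosed.uncurry φ) (ι₀_whiskerLeft_δ_zero X)
  · rw [← e₁]
    exact congrArg (· ≫ MonoidalClosed.uncurry φ) (ι₁_whiskerLeft_δ_zero X)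
  · rw [Category.assoc, h₂']

variable {X K : SSet.{u}} [KanComplex K]

/-- The base of the triangle is the terminal object, so only the horn matters. With reflexivity,
this one filling gives both symmetry and transitivity. -/
lemma Htpy.of_left {f g h : X ⟶ K} (hg : Htpy f g) (hh : Htpy f h) : Htpy g h := by
  obtain ⟨H₁, rfl, rfl⟩ := hg
  obtain ⟨H₂, h₂, rfl⟩ := hh
  obtain ⟨H, h₀, h₁, -⟩ := exists_triangle (terminal.from K) H₁ H₂ h₂.symm (terminal.from _)
    (by subsingleton) (by subsingleton)
  exact ⟨H, h₀, h₁⟩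

lemma Htpy.symm {f g : X ⟶ K} (h : Htpy f g) : Htpy g f := h.of_left (.refl f)

lemma Htpy.trans {f g h : X ⟶ K} (hf : Htpy f g) (hg : Htpy g h) : Htpy f h :=
  hf.symm.of_left hg

lemma homotopyClasses_mk_eq_iff (f g : X ⟶ K) :
    (Quot.mk _ f : HomotopyClasses X K) = Quot.mk _ g ↔ Htpy f g := by
  refine ⟨fun h ↦ ?_, fun h ↦ Quot.sound ((nonempty_homotopy_iff f g).2 h)⟩
  replace h := Quot.eqvGen_exact h
  induction h with
  | rel _ _ h => exact (nonempty_homotopy_iff _ _).1 h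
  | refl => exact .refl _
  | symm _ _ _ h => exact h.symm
  | trans _ _ _ _ _ h₁ h₂ => exact h₁.trans h₂

end homotopy

/-! ### Weak equivalences of simplicial sets. -/

section weakEquivalences

lemma sSetWeakEquivalences_iff {X Y : SSet.{u}} (f : X ⟶ Y) :
    sSetWeakEquivalences f ↔ ∀ (K : SSet.{u}) [KanComplex K],
      (∀ a : X ⟶ K, ∃ b : Y ⟶ K, Htpy (f ≫ b) a) ∧
      (∀ b b' : Y ⟶ K, Htpy (f ≫ b) (f ≫ b') → Htpy b b') := by
  refine forall_congr' fun K ↦ forall_congr' fun hK ↦ ?_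
  rw [Function.Bijective, and_comm]
  refine and_congr ⟨fun h a ↦ ?_, ?_⟩ ⟨fun h b b' hb ↦ ?_, ?_⟩
  · obtain ⟨⟨b⟩, hb⟩ := h (Quot.mk _ a)
    exact ⟨b, (homotopyClasses_mk_eq_iff _ _).1 hb⟩
  · rintro h ⟨a⟩
    obtain ⟨b, hb⟩ := h a
    exact ⟨Quot.mk _ b, (homotopyClasses_mk_eq_iff _ _).2 hb⟩
  · exact (homotopyClasses_mk_eq_iff _ _).1 (h ((homotopyClasses_mk_eq_iff _ _).2 hb))
  · rintro h ⟨b⟩ ⟨b'⟩ hb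
    exact (homotopyClasses_mk_eq_iff _ _).2 (h _ _ ((homotopyClasses_mk_eq_iff _ _).1 hb))

lemma precomp_comp {X Y Z : SSet.{u}} (f : X ⟶ Y) (g : Y ⟶ Z) (K : SSet.{u}) :
    HomotopyClasses.precomp (f ≫ g) K =
      HomotopyClasses.precomp f K ∘ HomotopyClasses.precomp g K := by
  ext ⟨a⟩
  exact congrArg (Quot.mk _) (Category.assoc f g a)

instance : (sSetWeakEquivalences.{u}).HasTwoOutOfThreeProperty where
  comp_mem f g hf hg K _ := by
    rw [precomp_comp]
    exact (hf K).comp (hg K)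
  of_postcomp f g hg hfg K _ := by
    have := hfg K
    rw [precomp_comp] at this
    exact (Function.Bijective.of_comp_iff _ (hg K)).1 this
  of_precomp f g hf hfg K _ := by
    have := hfg K
    rw [precomp_comp] at this
    exact (Function.Bijective.of_comp_iff' (hf K) _).1 this

/-- Homotopy need not be symmetric in `X` or `Y`, so either direction is allowed. After composition
with a map to a Kan complex the direction no longer matters. -/
lemma sSetWeakEquivalences_of_homotopyEquiv {X Y : SSet.{u}} (f : X ⟶ Y) (g : Y ⟶ X)
    (h₁ : Htpy (f ≫ g) (𝟙 X) ∨ Htpy (𝟙 X) (f ≫ g)) (h₂ : Htpy (g ≫ f) (𝟙 Y) ∨ Htpy (𝟙 Y) (g ≫ f)) :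
    sSetWeakEquivalences f := by
  have key {A K : SSet.{u}} [KanComplex K] {a a' : A ⟶ A} (h : Htpy a a' ∨ Htpy a' a)
      (b : A ⟶ K) : Htpy (a ≫ b) (a' ≫ b) :=
    h.elim (fun h ↦ h.postcomp b) (fun h ↦ (h.postcomp b).symm)
  rw [sSetWeakEquivalences_iff]
  refine fun K _ ↦ ⟨fun a ↦ ⟨g ≫ a, ?_⟩, fun b b' h ↦ ?_⟩
  · simpa using key h₁ a
  · have e := key h₂ b
    have e' := key h₂ b'
    simp only [Category.assoc, Category.id_comp] at e e'
    exact (e.symm.trans (h.precomp g)).trans e'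

/-- Surjectivity on homotopy classes is the extension of maps to a Kan complex along `f`.
Injectivity is the extension of homotopies with both ends prescribed. -/
lemma sSetWeakEquivalences_of_anodyne {X Y : SSet.{u}} {f : X ⟶ Y}
    (hf : anodyneExtensions f) : sSetWeakEquivalences f := by
  rw [sSetWeakEquivalences_iff]
  refine fun K _ ↦ ⟨fun a ↦ ?_, fun b b' ⟨H, h₀, h₁⟩ ↦ ?_⟩
  · have := hf (terminal.from K) (by
      rw [← HomotopicalAlgebra.fibration_iff]; infer_instance)
    have sq : CommSq a f (terminal.from K) (terminal.from Y) := ⟨by simp⟩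
    exact ⟨sq.lift, by rw [sq.fac_left]; exact .refl a⟩
  · obtain ⟨G, h₀, h₁, -⟩ := exists_homotopy_lift_of_anodyne hf (terminal.from K) b b' H
      (terminal.from _) h₀ h₁ (by subsingleton) (by subsingleton) (by subsingleton)
    exact ⟨G, h₀, h₁⟩

/-- A trivial fibration has a section which is a fibrewise homotopy inverse. -/
lemma exists_section_of_rlp {Z W : SSet.{u}} (p : Z ⟶ W) (hp : I.rlp p) :
    ∃ (s : W ⟶ Z) (H : Z ⊗ Δ[1] ⟶ Z), s ≫ p = 𝟙 W ∧ ι₀ ≫ H = p ≫ s ∧ ι₁ ≫ H = 𝟙 Z ∧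
      H ≫ p = CartesianMonoidalCategory.fst _ _ ≫ p := by
  have hp' := hp
  rw [← SSet.rlp_monomorphisms] at hp'
  have : HasLiftingProperty (initial.to W) p :=
    hp' _ (MorphismProperty.monomorphisms.infer_property _)
  have sq : CommSq (initial.to Z) (initial.to W) p (𝟙 W) := ⟨by subsingleton⟩
  obtain ⟨H, h₀, h₁, h⟩ := exists_homotopy_lift_of_rlp p hp (p ≫ sq.lift) (𝟙 Z)
    (CartesianMonoidalCategory.fst _ _ ≫ p) (by simp) (by simp)
  exact ⟨sq.lift, H, sq.fac_right, h₀, h₁, h⟩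

lemma sSetWeakEquivalences_of_rlp {Z W : SSet.{u}} (p : Z ⟶ W) (hp : I.rlp p) :
    sSetWeakEquivalences p := by
  obtain ⟨s, H, hs, h₀, h₁, -⟩ := exists_section_of_rlp p hp
  exact sSetWeakEquivalences_of_homotopyEquiv p s (.inl ⟨H, h₀, h₁⟩) (.inl (by
    rw [hs]; exact .refl _))

end weakEquivalences

/-! ### Factorizations and the retract argument. -/

section factorization

section

attribute [local instance] Cardinal.fact_isRegular_aleph0 Cardinal.orderBotAleph0OrdToType

instance : MorphismProperty.IsSmall.{u} (I.{u}) :=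
  MorphismProperty.isSmall_ofHoms ..

/-- The sources of the generating inclusions are the boundaries, which are finitely presentable, so
countable compositions suffice. -/
instance : I.{u}.IsCardinalForSmallObjectArgument Cardinal.aleph0.{u} where
  preservesColimit {A B X Y} i hi f hf := by
    have : IsFinitelyPresentable.{u} A := by
      obtain ⟨n⟩ := hi
      infer_instance
    infer_instance

instance : MorphismProperty.HasSmallObjectArgument.{u} (I.{u}) :=
  ⟨.aleph0, inferInstance, inferInstance, inferInstance⟩

end

lemma I_rlp_le_J_rlp : I.{u}.rlp ≤ J.rlp := by
  rw [← SSet.rlp_monomorphisms]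
  exact MorphismProperty.antitone_rlp J_le_monomorphisms

lemma fibration_of_rlp {Z W : SSet.{u}} {p : Z ⟶ W} (hp : I.rlp p) : Fibration p :=
  (SSet.modelCategoryQuillen.fibration_iff p).2 (I_rlp_le_J_rlp _ hp)

lemma hasLiftingProperty_of_rlp {A B Z W : SSet.{u}} (i : A ⟶ B) [Mono i] {p : Z ⟶ W}
    (hp : I.rlp p) : HasLiftingProperty i p := by
  rw [← SSet.rlp_monomorphisms] at hp
  exact hp _ (MorphismProperty.monomorphisms.infer_property _)

lemma exists_factorization_anodyne_fibration {X Y : SSet.{u}} (f : X ⟶ Y) :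
    ∃ (Z : SSet.{u}) (i : X ⟶ Z) (p : Z ⟶ Y), anodyneExtensions i ∧ Fibration p ∧ i ≫ p = f := by
  let h := MorphismProperty.factorizationData J.{u}.rlp.llp J.rlp f
  exact ⟨h.Z, h.i, h.p, h.hi, (SSet.modelCategoryQuillen.fibration_iff _).2 h.hp, h.fac⟩

lemma exists_factorization_mono_rlp {X Y : SSet.{u}} (f : X ⟶ Y) :
    ∃ (Z : SSet.{u}) (i : X ⟶ Z) (p : Z ⟶ Y), Mono i ∧ I.rlp p ∧ i ≫ p = f := by
  let h := MorphismProperty.factorizationData I.{u}.rlp.llp I.rlp f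
  refine ⟨h.Z, h.i, h.p, ?_, h.hp, h.fac⟩
  -- By the small object argument the left class consists of retracts of relative cell complexes on
  -- boundary inclusions, and monomorphisms are closed under all these operations.
  have : I.{u}.rlp.llp ≤ MorphismProperty.monomorphisms _ := by
    rw [MorphismProperty.llp_rlp_of_hasSmallObjectArgument]
    simp only [MorphismProperty.retracts_le_iff, MorphismProperty.transfiniteCompositions_le_iff,
      MorphismProperty.pushouts_le_iff]
    exact MorphismProperty.coproducts_le_iff.2 I_le_monomorphisms
  exact this _ h.hi

/-- Factor `f` as a monomorphism followed by a trivial fibration; the latter is a Kan fibration, so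
`f` lifts against it and is a retract of the monomorphism. -/
lemma mono_of_anodyne {X Y : SSet.{u}} {f : X ⟶ Y} (hf : anodyneExtensions f) : Mono f := by
  obtain ⟨Z, i, p, _, hp, rfl⟩ := exists_factorization_mono_rlp f
  have := hf p (I_rlp_le_J_rlp _ hp)
  exact MorphismProperty.of_retract (P := MorphismProperty.monomorphisms _)
    (RetractArrow.ofLeftLiftingProperty rfl) (MorphismProperty.monomorphisms.infer_property i)

end factorization

/-! ### Trivial fibrations between Kan complexes. -/

section

/-- A fibrewise homotopy equivalence onto the base is a trivial fibration. -/
lemma rlp_of_fibrewise_contraction {Z W : SSet.{u}} (p : Z ⟶ W) [Fibration p] (s : W ⟶ Z)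
    (hs : s ≫ p = 𝟙 W) (H : Z ⊗ Δ[1] ⟶ Z) (h₀ : ι₀ ≫ H = p ≫ s) (h₁ : ι₁ ≫ H = 𝟙 Z)
    (hH : H ≫ p = CartesianMonoidalCategory.fst _ _ ≫ p) : I.rlp p := by
  rw [← SSet.rlp_monomorphisms]
  intro A X i hi
  have : Mono i := hi
  refine ⟨fun {a x} sq ↦ ?_⟩
  -- The map `x ≫ s` is a lift of `x` but restricts on `A` to `a ≫ p ≫ s` instead of `a`. The
  -- fibrewise homotopy `H` joins the two on `A`; extending it over `X` while keeping the image in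
  -- `W` fixed and taking the end 1 corrects the lift.
  obtain ⟨G, e₀, e, e'⟩ := exists_homotopy_lift₀ i p (a ▷ _ ≫ H) (x ≫ s)
    (CartesianMonoidalCategory.fst _ _ ≫ x)
    (by rw [SSet.ι₀_comp_assoc, h₀, reassoc_of% sq.w]) (by simp [hs])
    (by simp [hH, sq.w])
  refine ⟨⟨⟨ι₁ ≫ G, ?_, ?_⟩⟩⟩
  · rw [← SSet.ι₁_comp_assoc, e, SSet.ι₁_comp_assoc, h₁, Category.comp_id]
  · rw [Category.assoc, e', SSet.ι₁_fst_assoc]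

lemma exists_homotopy_lift {X Z W : SSet.{u}} (p : Z ⟶ W) [hp : Fibration p] (f : X ⟶ Z)
    (w : X ⊗ Δ[1] ⟶ W) (hf : f ≫ p = ι₀ ≫ w) :
    ∃ G : X ⊗ Δ[1] ⟶ Z, ι₀ ≫ G = f ∧ G ≫ p = w := by
  have := (anodyneExtensions_δ 1).whiskerLeft X _ hp.mem
  have sq : CommSq (CartesianMonoidalCategory.fst _ _ ≫ f) (X ◁ SSet.stdSimplex.δ (1 : Fin 2))
    p w := ⟨by rw [whiskerLeft_δ_one, Category.assoc, Category.assoc, hf]⟩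
  obtain ⟨l, hl, hl'⟩ : ∃ l, X ◁ SSet.stdSimplex.δ (1 : Fin 2) ≫ l =
      CartesianMonoidalCategory.fst _ _ ≫ f ∧ l ≫ p = w := ⟨sq.lift, sq.fac_left, sq.fac_right⟩
  have h := toTensorPoint X ≫= hl
  rw [whiskerLeft_δ_one, Category.assoc, toTensorPoint_fst_assoc, toTensorPoint_fst_assoc] at h
  exact ⟨l, h, hl'⟩

lemma whiskerLeft_σ_one (X : SSet.{u}) :
    X ◁ SSet.stdSimplex.δ (0 : Fin 3) ≫ X ◁ SSet.stdSimplex.σ (1 : Fin 2) =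
      CartesianMonoidalCategory.fst X (Δ[1] : SSet.{u}) ≫ ι₁ := by
  have : SSet.stdSimplex.{u}.δ (0 : Fin 3) ≫ SSet.stdSimplex.σ (1 : Fin 2) =
      SSet.stdSimplex.σ (0 : Fin 1) ≫ SSet.stdSimplex.δ (0 : Fin 2) :=
    CosimplicialObject.δ_comp_σ_of_le SSet.stdSimplex (i := (0 : Fin 2)) (j := (0 : Fin 1)) le_rfl
  rw [← MonoidalCategory.whiskerLeft_comp, this, MonoidalCategory.whiskerLeft_comp,
    whiskerLeft_δ_zero]
  rfl

/-- A Kan fibration between Kan complexes which is a homotopy equivalence is a trivial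
fibration. -/
lemma rlp_of_homotopyEquiv {Z W : SSet.{u}} [KanComplex Z] [KanComplex W] (p : Z ⟶ W)
    [Fibration p] (s : W ⟶ Z) (h : Htpy (p ≫ s) (𝟙 Z)) (h' : Htpy (s ≫ p) (𝟙 W)) :
    I.rlp p := by
  -- The homotopy from `s ≫ p` to the identity lifts to a homotopy starting at `s`; its other end is
  -- a strict section.
  obtain ⟨s', hss', hs'⟩ : ∃ s' : W ⟶ Z, Htpy s s' ∧ s' ≫ p = 𝟙 W := by
    obtain ⟨K, hK, hK'⟩ := h'
    obtain ⟨G, rfl, hG'⟩ := exists_homotopy_lift p s K hK.symm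
    exact ⟨ι₁ ≫ G, ⟨G, rfl, rfl⟩, by rw [Category.assoc, hG', hK']⟩
  obtain ⟨G, h₀, h₁⟩ : Htpy (p ≫ s') (𝟙 Z) := (hss'.precomp p).of_left h
  -- `G` runs from `p ≫ s'` to the identity but may move along `W`. Both `G ≫ p ≫ s'` and `G` lie
  -- over the same homotopy `G ≫ p`, so they form a horn over a degenerate triangle whose remaining
  -- face is constant. The filled face is a fibrewise homotopy.
  obtain ⟨H, e₀, e₁, e⟩ := exists_triangle p (G ≫ p ≫ s') G
    (by rw [reassoc_of% h₀, reassoc_of% hs', h₀]) (Z ◁ SSet.stdSimplex.σ (1 : Fin 2) ≫ G ≫ p)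
    (by
      rw [← MonoidalCategory.whiskerLeft_comp_assoc]
      have := CosimplicialObject.δ_comp_σ_succ SSet.stdSimplex.{u} (i := (1 : Fin 2))
      erw [this]
      simp [hs'])
    (by
      rw [← MonoidalCategory.whiskerLeft_comp_assoc]
      have := CosimplicialObject.δ_comp_σ_self SSet.stdSimplex.{u} (i := (1 : Fin 2))
      erw [this]
      simp)
  refine rlp_of_fibrewise_contraction p s' hs' H ?_ (e₁.trans h₁) ?_
  · rw [e₀, reassoc_of% h₁]
  · rw [e, reassoc_of% whiskerLeft_σ_one, reassoc_of% h₁]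

lemma exists_homotopyInverse {Z W : SSet.{u}} [KanComplex Z] [KanComplex W] (p : Z ⟶ W)
    (hp : sSetWeakEquivalences p) : ∃ s : W ⟶ Z, Htpy (p ≫ s) (𝟙 Z) ∧ Htpy (s ≫ p) (𝟙 W) := by
  rw [sSetWeakEquivalences_iff] at hp
  obtain ⟨s, hs⟩ := (hp Z).1 (𝟙 Z)
  refine ⟨s, hs, (hp W).2 _ _ ?_⟩
  simpa using hs.postcomp p

lemma rlp_of_weakEquivalence_of_kanComplex {Z W : SSet.{u}} [KanComplex Z] [KanComplex W]
    (p : Z ⟶ W) [Fibration p] (hp : sSetWeakEquivalences p) : I.rlp p := by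
  obtain ⟨s, h, h'⟩ := exists_homotopyInverse p hp
  exact rlp_of_homotopyEquiv p s h h'

end

/-! ### Mapping spaces, and monic weak equivalences into Kan complexes. -/

section mappingSpaces

lemma htpy_curry_iff {L X K : SSet.{u}} (f g : L ⊗ X ⟶ K) :
    Htpy (MonoidalClosed.curry f) (MonoidalClosed.curry g) ↔ Htpy f g := by
  constructor
  · rintro ⟨H, h₀, h₁⟩
    refine ⟨(α_ _ _ _).hom ≫ MonoidalClosed.uncurry H, ?_, ?_⟩
    · rw [← MonoidalClosed.uncurry_curry f, ← h₀, MonoidalClosed.uncurry_natural_left]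
      rfl
    · rw [← MonoidalClosed.uncurry_curry g, ← h₁, MonoidalClosed.uncurry_natural_left]
      rfl
  · rintro ⟨H, rfl, rfl⟩
    refine ⟨MonoidalClosed.curry ((α_ _ _ _).inv ≫ H), ?_, ?_⟩ <;>
      rw [← MonoidalClosed.curry_natural_left] <;> rfl

lemma sSetWeakEquivalences_of_isIso {X Y : SSet.{u}} (f : X ⟶ Y) [IsIso f] :
    sSetWeakEquivalences f :=
  sSetWeakEquivalences_of_anodyne (SSet.anodyneExtensions.of_isIso f)

/-- Homotopy classes of maps from `L ⊗ X` to `K` are those from `X` to the mapping space from `L` to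
`K`, which is again a Kan complex. -/
lemma sSetWeakEquivalences_whiskerLeft (L : SSet.{u}) {A X : SSet.{u}} {j : A ⟶ X}
    (hj : sSetWeakEquivalences j) : sSetWeakEquivalences (L ◁ j) := by
  rw [sSetWeakEquivalences_iff] at hj ⊢
  intro K _
  refine ⟨fun a ↦ ?_, fun b b' h ↦ ?_⟩
  · obtain ⟨b, hb⟩ := (hj ((ihom L).obj K)).1 (MonoidalClosed.curry a)
    refine ⟨MonoidalClosed.uncurry b, ?_⟩
    rwa [← htpy_curry_iff, MonoidalClosed.curry_natural_left, MonoidalClosed.curry_uncurry]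
  · rw [← htpy_curry_iff] at h ⊢
    refine (hj ((ihom L).obj K)).2 _ _ ?_
    rwa [MonoidalClosed.curry_natural_left, MonoidalClosed.curry_natural_left] at h

lemma sSetWeakEquivalences_whiskerRight (L : SSet.{u}) {A X : SSet.{u}} {j : A ⟶ X}
    (hj : sSetWeakEquivalences j) : sSetWeakEquivalences (j ▷ L) := by
  have : j ▷ L = (β_ A L).hom ≫ L ◁ j ≫ (β_ X L).inv := by simp
  rw [this]
  exact MorphismProperty.comp_mem _ _ _ (sSetWeakEquivalences_of_isIso _)
    (MorphismProperty.comp_mem _ _ _ (sSetWeakEquivalences_whiskerLeft L hj)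
      (sSetWeakEquivalences_of_isIso _))

/-- Restriction along `j` is a Kan fibration between Kan complexes, so a homotopy inverse is enough.
Since `j ▷ K^A` is a weak equivalence, the evaluation map on `A ⊗ K^A` extends up to homotopy to `X
⊗ K^A`; the curried extension is the inverse. -/
lemma rlp_pre_app {A X : SSet.{u}} (j : A ⟶ X) [Mono j] (hj : sSetWeakEquivalences j)
    (K : SSet.{u}) [KanComplex K] : I.rlp ((MonoidalClosed.pre j).app K) := by
  obtain ⟨b, hb⟩ := ((sSetWeakEquivalences_iff _).1
    (sSetWeakEquivalences_whiskerRight ((ihom A).obj K) hj) K).1 (MonoidalClosed.uncurry (𝟙 _))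
  refine rlp_of_homotopyEquiv _ (MonoidalClosed.curry b) ?_ ?_
  · rw [← MonoidalClosed.curry_natural_left,
      ← MonoidalClosed.curry_uncurry (𝟙 ((ihom X).obj K)), htpy_curry_iff]
    refine ((sSetWeakEquivalences_iff _).1
      (sSetWeakEquivalences_whiskerRight ((ihom X).obj K) hj) K).2 _ _ ?_
    have := hb.precomp (A ◁ (MonoidalClosed.pre j).app K)
    rw [whisker_exchange_assoc] at this
    convert this using 1
    rw [← MonoidalClosed.uncurry_natural_left, Category.comp_id, MonoidalClosed.uncurry_pre,
      MonoidalClosed.uncurry_id_eq_ev]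
  · rw [MonoidalClosed.curry_pre_app, ← MonoidalClosed.curry_uncurry (𝟙 ((ihom A).obj K)),
      htpy_curry_iff]
    exact hb

/-- The map from Z^X to the pullback of Z^A and W^X over W^A is a Kan fibration between Kan
complexes. Its composite with the projection to Z^A and that projection are both trivial fibrations,
so two-out-of-three makes it one too. Lifting a point along it is lifting `j` against `p`. -/
lemma hasLiftingProperty_of_kanComplex {A X Z W : SSet.{u}} (j : A ⟶ X) [Mono j]
    (hj : sSetWeakEquivalences j) (p : Z ⟶ W) [Fibration p] [KanComplex W] :
    HasLiftingProperty j p := by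
  have : KanComplex Z := isFibrant_of_fibration p
  let sq := Functor.PullbackObjObj.ofHasPullback MonoidalClosed.internalHom j p
  have h₁ : I.rlp sq.fst :=
    MorphismProperty.of_isPullback sq.isPullback.flip (rlp_pre_app j hj W)
  have h₂ : I.rlp (sq.π ≫ sq.fst) := by
    rw [sq.π_fst]
    exact rlp_pre_app j hj Z
  have : Fibration sq.fst := fibration_of_rlp h₁
  have : Fibration sq.π := SSet.fibration_pullbackObjObjπ sq
  have : KanComplex sq.pt := by
    have : KanComplex ((MonoidalClosed.internalHom.obj (op A)).obj Z) :=
      inferInstanceAs (KanComplex ((ihom A).obj Z))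
    exact isFibrant_of_fibration sq.fst
  have : KanComplex ((MonoidalClosed.internalHom.obj (op X)).obj Z) :=
    inferInstanceAs (KanComplex ((ihom X).obj Z))
  have h₃ : I.rlp sq.π := rlp_of_weakEquivalence_of_kanComplex _
    (MorphismProperty.of_postcomp _ _ _ (sSetWeakEquivalences_of_rlp _ h₁)
      (sSetWeakEquivalences_of_rlp _ h₂))
  have h₄ : HasLiftingProperty (initial.to (𝟙_ SSet.{u})) sq.π := hasLiftingProperty_of_rlp _ h₃
  rw [← MonoidalClosed.internalHomAdjunction₂.hasLiftingProperty_iff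
    (.ofIsInitialRight (curriedTensor _) j (initial.to (𝟙_ SSet.{u})) initialIsInitial)] at h₄
  exact (HasLiftingProperty.iff_of_arrow_iso_left
    (Arrow.isoMk (ρ_ A) (ρ_ X) (rightUnitor_naturality j).symm) p).1 h₄

lemma anodyneExtensions_of_kanComplex {A X : SSet.{u}} (j : A ⟶ X) [Mono j]
    (hj : sSetWeakEquivalences j) [KanComplex X] : anodyneExtensions j := by
  obtain ⟨Z, i, p, hi, _, rfl⟩ := exists_factorization_anodyne_fibration j
  have := hasLiftingProperty_of_kanComplex (i ≫ p) hj p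
  exact MorphismProperty.of_retract (RetractArrow.ofLeftLiftingProperty rfl) hi

end mappingSpaces

/-! ### Kan fibrations over a deformation retract. -/

section deformation

variable {Y P Y₀ P₀ : SSet.{u}} {i : Y ⟶ P} [Mono i] {i₀ : Y₀ ⟶ P₀}
  {y : Y₀ ⟶ Y} {π : P₀ ⟶ P} {Φ : P ⊗ Δ[1] ⟶ P} {Ψ : Y ⊗ Δ[1] ⟶ Y} {cP : P ⟶ P₀} {cY : Y ⟶ Y₀}

/-- At the end 0 the deformations factor through `P₀` and `Y₀`, where the lifting problem is solved
by `i₀`. Since the deformations of `Y` and `P` are compatible, homotopy extension carries that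
solution to the end 1, where it solves the original problem. -/
lemma anodyneExtensions_of_deformation₀ (hi₀ : anodyneExtensions i₀) (h : i₀ ≫ π = y ≫ i)
    (hΦΨ : i ▷ _ ≫ Φ = Ψ ≫ i) (hc : cY ≫ i₀ = i ≫ cP) (hΦ₀ : ι₀ ≫ Φ = cP ≫ π)
    (hΨ₀ : ι₀ ≫ Ψ = cY ≫ y) (hΦ₁ : ι₁ ≫ Φ = 𝟙 P) (hΨ₁ : ι₁ ≫ Ψ = 𝟙 Y) :
    anodyneExtensions i := by
  intro Z W p hp
  have : Fibration p := ⟨hp⟩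
  have := hi₀ p hp
  refine ⟨fun {u v} sq ↦ ?_⟩
  have sq₀ : CommSq (y ≫ u) i₀ p (π ≫ v) := ⟨by rw [reassoc_of% h, Category.assoc, sq.w]⟩
  obtain ⟨G, -, e, e'⟩ := exists_homotopy_lift₀ i p (Ψ ≫ u) (cP ≫ sq₀.lift) (Φ ≫ v)
    (by rw [reassoc_of% hΨ₀, ← reassoc_of% hc, sq₀.fac_left])
    (by rw [Category.assoc, sq₀.fac_right, reassoc_of% hΦ₀])
    (by rw [reassoc_of% hΦΨ, Category.assoc, sq.w])
  refine ⟨⟨⟨ι₁ ≫ G, ?_, ?_⟩⟩⟩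
  · rw [← SSet.ι₁_comp_assoc, e, reassoc_of% hΨ₁]
  · rw [Category.assoc, e', reassoc_of% hΦ₁]

lemma anodyneExtensions_of_deformation₁ (hi₀ : anodyneExtensions i₀) (h : i₀ ≫ π = y ≫ i)
    (hΦΨ : i ▷ _ ≫ Φ = Ψ ≫ i) (hc : cY ≫ i₀ = i ≫ cP) (hΦ₀ : ι₁ ≫ Φ = cP ≫ π)
    (hΨ₀ : ι₁ ≫ Ψ = cY ≫ y) (hΦ₁ : ι₀ ≫ Φ = 𝟙 P) (hΨ₁ : ι₀ ≫ Ψ = 𝟙 Y) :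
    anodyneExtensions i := by
  intro Z W p hp
  have : Fibration p := ⟨hp⟩
  have := hi₀ p hp
  refine ⟨fun {u v} sq ↦ ?_⟩
  have sq₀ : CommSq (y ≫ u) i₀ p (π ≫ v) := ⟨by rw [reassoc_of% h, Category.assoc, sq.w]⟩
  obtain ⟨G, -, e, e'⟩ := exists_homotopy_lift₁ i p (Ψ ≫ u) (cP ≫ sq₀.lift) (Φ ≫ v)
    (by rw [reassoc_of% hΨ₀, ← reassoc_of% hc, sq₀.fac_left])
    (by rw [Category.assoc, sq₀.fac_right, reassoc_of% hΦ₀])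
    (by rw [reassoc_of% hΦΨ, Category.assoc, sq.w])
  refine ⟨⟨⟨ι₀ ≫ G, ?_, ?_⟩⟩⟩
  · rw [← SSet.ι₀_comp_assoc, e, reassoc_of% hΨ₁]
  · rw [Category.assoc, e', reassoc_of% hΦ₁]

end deformation

lemma exists_homotopy_lift_of_ι₁ {X Z W : SSet.{u}} (p : Z ⟶ W) [hp : Fibration p] (f : X ⟶ Z)
    (w : X ⊗ Δ[1] ⟶ W) (hf : f ≫ p = ι₁ ≫ w) :
    ∃ G : X ⊗ Δ[1] ⟶ Z, ι₁ ≫ G = f ∧ G ≫ p = w := by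
  have := (anodyneExtensions_δ 0).whiskerLeft X _ hp.mem
  have sq : CommSq (CartesianMonoidalCategory.fst _ _ ≫ f) (X ◁ SSet.stdSimplex.δ (0 : Fin 2))
    p w := ⟨by rw [whiskerLeft_δ_zero, Category.assoc, Category.assoc, hf]⟩
  obtain ⟨l, hl, hl'⟩ : ∃ l, X ◁ SSet.stdSimplex.δ (0 : Fin 2) ≫ l =
      CartesianMonoidalCategory.fst _ _ ≫ f ∧ l ≫ p = w := ⟨sq.lift, sq.fac_left, sq.fac_right⟩
  have h := toTensorPoint X ≫= hl
  rw [whiskerLeft_δ_zero, Category.assoc, toTensorPoint_fst_assoc, toTensorPoint_fst_assoc] at h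
  exact ⟨l, h, hl'⟩

lemma mono_fst_of_isPullback {P X Y Z : SSet.{u}} {fst : P ⟶ X} {snd : P ⟶ Y} {f : X ⟶ Z}
    {g : Y ⟶ Z} (sq : IsPullback fst snd f g) [Mono g] : Mono fst :=
  MorphismProperty.of_isPullback (P := MorphismProperty.monomorphisms _) sq.flip
    (MorphismProperty.monomorphisms.infer_property g)

/-- A one step strong deformation retraction of `A` onto `A₀`, in either direction. -/
def ContractsOnto {A₀ A : SSet.{u}} (a : A₀ ⟶ A) : Prop :=
  ∃ (c : A ⟶ A₀) (h : A ⊗ Δ[1] ⟶ A), a ▷ _ ≫ h = CartesianMonoidalCategory.fst _ _ ≫ a ∧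
    ((ι₀ ≫ h = c ≫ a ∧ ι₁ ≫ h = 𝟙 A) ∨ (ι₁ ≫ h = c ≫ a ∧ ι₀ ≫ h = 𝟙 A))

section contraction

variable {A₀ A : SSet.{u}} {a : A₀ ⟶ A} [Mono a]

/-- The restriction of a Kan fibration to a deformation retract of the base. -/
lemma anodyneExtensions_of_contractsOnto (ha : ContractsOnto a) {Z Z₀ : SSet.{u}} {π : Z₀ ⟶ Z} {p₀ : Z₀ ⟶ A₀}
    {p : Z ⟶ A} (sq : IsPullback π p₀ p a) [Fibration p] : anodyneExtensions π := by
  obtain ⟨c, h, hconst, ⟨h₀, h₁⟩ | ⟨h₁, h₀⟩⟩ := ha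
  · have : Mono π := mono_fst_of_isPullback sq
    -- The contraction of the base lifts to `Z`, constantly on `Z₀` and ending at the identity, so
    -- `Z` deforms onto `Z₀` relative to `Z₀`.
    obtain ⟨Φ, e, e', e''⟩ := exists_homotopy_lift₁ π p
      (CartesianMonoidalCategory.fst _ _ ≫ π) (𝟙 Z) (p ▷ _ ≫ h) (by simp)
      (by simp [SSet.ι₁_comp_assoc, h₁])
      (by
        rw [← comp_whiskerRight_assoc, sq.w, comp_whiskerRight_assoc, hconst]
        simp [sq.w])
    refine anodyneExtensions_of_deformation₀ (i₀ := 𝟙 _) (y := 𝟙 _) (π := π) (Φ := Φ)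
      (Ψ := CartesianMonoidalCategory.fst _ _) (cP := sq.lift (ι₀ ≫ Φ) (p ≫ c) (by
        rw [Category.assoc, e'', SSet.ι₀_comp_assoc, h₀, Category.assoc])) (cY := 𝟙 _)
        (SSet.anodyneExtensions.of_isIso _) (by simp) e' ?_ (by simp) (by simp) e (by simp)
    apply sq.hom_ext
    · simp [← SSet.ι₀_comp_assoc, e']
    · rw [← cancel_mono a]
      have := ι₀ ≫= hconst
      rw [SSet.ι₀_comp_assoc, h₀] at this
      simp [reassoc_of% sq.w, this]
  · have : Mono π := mono_fst_of_isPullback sq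
    obtain ⟨Φ, e, e', e''⟩ := exists_homotopy_lift₀ π p
      (CartesianMonoidalCategory.fst _ _ ≫ π) (𝟙 Z) (p ▷ _ ≫ h) (by simp)
      (by simp [SSet.ι₀_comp_assoc, h₀])
      (by
        rw [← comp_whiskerRight_assoc, sq.w, comp_whiskerRight_assoc, hconst]
        simp [sq.w])
    refine anodyneExtensions_of_deformation₁ (i₀ := 𝟙 _) (y := 𝟙 _) (π := π) (Φ := Φ)
      (Ψ := CartesianMonoidalCategory.fst _ _) (cP := sq.lift (ι₁ ≫ Φ) (p ≫ c) (by
        rw [Category.assoc, e'', SSet.ι₁_comp_assoc, h₁, Category.assoc])) (cY := 𝟙 _)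
        (SSet.anodyneExtensions.of_isIso _) (by simp) e' ?_ (by simp) (by simp) e (by simp)
    apply sq.hom_ext
    · simp [← SSet.ι₁_comp_assoc, e']
    · rw [← cancel_mono a]
      have := ι₁ ≫= hconst
      rw [SSet.ι₁_comp_assoc, h₁] at this
      simp [reassoc_of% sq.w, this]

/-- Lift the contraction of `A` first to `Y`, then extend it along `i` to a lift on `P`. The two
deformations are compatible and end in the restrictions over `A₀`, so the case of `i₀` implies that
of `i`. -/
lemma anodyneExtensions_of_restriction (ha : ContractsOnto a) {Y P Y₀ P₀ : SSet.{u}} {y : Y₀ ⟶ Y} {q₀ : Y₀ ⟶ A₀}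
    {q : Y ⟶ A} (sqY : IsPullback y q₀ q a) {π : P₀ ⟶ P} {p₀ : P₀ ⟶ A₀} {p : P ⟶ A}
    (sqP : IsPullback π p₀ p a) [Fibration q] [Fibration p] (i : Y ⟶ P) [Mono i] (hi : i ≫ p = q)
    (i₀ : Y₀ ⟶ P₀) (hy : i₀ ≫ π = y ≫ i) (hi₀ : anodyneExtensions i₀) :
    anodyneExtensions i := by
  have hq₀ : i₀ ≫ p₀ = q₀ := by
    rw [← cancel_mono a, Category.assoc, ← sqP.w, reassoc_of% hy, hi, sqY.w]
  obtain ⟨c, h, hconst, ⟨h₀, h₁⟩ | ⟨h₁, h₀⟩⟩ := ha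
  · obtain ⟨Ψ, e, e'⟩ := exists_homotopy_lift_of_ι₁ q (𝟙 Y) (q ▷ _ ≫ h)
      (by simp [SSet.ι₁_comp_assoc, h₁])
    obtain ⟨Φ, f, f', f''⟩ := exists_homotopy_lift₁ i p (Ψ ≫ i) (𝟙 P) (p ▷ _ ≫ h)
      (by rw [reassoc_of% e, Category.comp_id]) (by simp [SSet.ι₁_comp_assoc, h₁])
      (by rw [Category.assoc, hi, e', ← comp_whiskerRight_assoc, hi])
    refine anodyneExtensions_of_deformation₀ (i₀ := i₀) (y := y) (π := π) (Φ := Φ)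
      (Ψ := Ψ) (cP := sqP.lift (ι₀ ≫ Φ) (p ≫ c) (by
        rw [Category.assoc, f'', SSet.ι₀_comp_assoc, h₀, Category.assoc]))
      (cY := sqY.lift (ι₀ ≫ Ψ) (q ≫ c) (by
        rw [Category.assoc, e', SSet.ι₀_comp_assoc, h₀, Category.assoc]))
      hi₀ hy f' ?_ (by simp) (by simp) f e
    apply sqP.hom_ext
    · simp [hy, ← SSet.ι₀_comp_assoc, f']
    · simp [hq₀, reassoc_of% hi]
  · obtain ⟨Ψ, e, e'⟩ := exists_homotopy_lift q (𝟙 Y) (q ▷ _ ≫ h)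
      (by simp [SSet.ι₀_comp_assoc, h₀])
    obtain ⟨Φ, f, f', f''⟩ := exists_homotopy_lift₀ i p (Ψ ≫ i) (𝟙 P) (p ▷ _ ≫ h)
      (by rw [reassoc_of% e, Category.comp_id]) (by simp [SSet.ι₀_comp_assoc, h₀])
      (by rw [Category.assoc, hi, e', ← comp_whiskerRight_assoc, hi])
    refine anodyneExtensions_of_deformation₁ (i₀ := i₀) (y := y) (π := π) (Φ := Φ)
      (Ψ := Ψ) (cP := sqP.lift (ι₁ ≫ Φ) (p ≫ c) (by
        rw [Category.assoc, f'', SSet.ι₁_comp_assoc, h₁, Category.assoc]))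
      (cY := sqY.lift (ι₁ ≫ Ψ) (q ≫ c) (by
        rw [Category.assoc, e', SSet.ι₁_comp_assoc, h₁, Category.assoc]))
      hi₀ hy f' ?_ (by simp) (by simp) f e
    apply sqP.hom_ext
    · simp [hy, ← SSet.ι₁_comp_assoc, f']
    · simp [hq₀, reassoc_of% hi]

end contraction

lemma congr_tensor_app {X Y Z : SSet.{u}} {f g : X ⊗ Y ⟶ Z} (h : f = g) {m : SimplexCategoryᵒᵖ}
    (x : X.obj m) (y : Y.obj m) : f.app m (x, y) = g.app m (x, y) := by
  rw [h]

lemma naturality_tensor_apply {X Y Z : SSet.{u}} (f : X ⊗ Y ⟶ Z) {m m' : SimplexCategoryᵒᵖ}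
    (φ : m ⟶ m') (x : X.obj m) (y : Y.obj m) :
    f.app m' (X.map φ x, Y.map φ y) = Z.map φ (f.app m (x, y)) :=
  ConcreteCategory.congr_hom (f.naturality φ) (id (α := X.obj m × Y.obj m) (x, y))

lemma isPullback_iff_app {P X Y Z : SSet.{u}} (fst : P ⟶ X) (snd : P ⟶ Y) (f : X ⟶ Z)
    (g : Y ⟶ Z) : IsPullback fst snd f g ↔ fst ≫ f = snd ≫ g ∧ ∀ m,
      (∀ z z', fst.app m z = fst.app m z' → snd.app m z = snd.app m z' → z = z') ∧
      ∀ x y, f.app m x = g.app m y → ∃ z, fst.app m z = x ∧ snd.app m z = y := by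
  constructor
  · intro sq
    refine ⟨sq.w, fun m ↦ ?_⟩
    have := (Types.isPullback_iff _ _ _ _).1 (sq.app m)
    exact ⟨fun z z' h h' ↦ this.2.1 z z' ⟨h, h'⟩, this.2.2⟩
  · rintro ⟨w, h⟩
    refine IsPullback.of_forall_isPullback_app fun m ↦ (Types.isPullback_iff _ _ _ _).2
      ⟨NatTrans.congr_app w m, fun z z' h' ↦ (h m).1 z z' h'.1 h'.2, (h m).2⟩

lemma fibration_of_isPullback {P X Y Z : SSet.{u}} {fst : P ⟶ X} {snd : P ⟶ Y} {f : X ⟶ Z}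
    {g : Y ⟶ Z} (sq : IsPullback fst snd f g) [hf : Fibration f] : Fibration snd :=
  ⟨MorphismProperty.of_isPullback (P := J.rlp) sq hf.mem⟩

/-! ### Contraction of horns and simplices onto a vertex, and comparison with the fibre. -/

section starShaped

variable {n : ℕ} (A : (Δ[n] : SSet.{u}).Subcomplex) (k : Fin (n + 1))

/-- A subcomplex of `Δ[n]` is star-shaped at `k` if it contains the join of its simplices with
the vertex `k`. -/
def IsStarShaped : Prop :=
  (∀ m, SSet.stdSimplex.const n k m ∈ A.obj m) ∧
  ∀ ⦃m m' : SimplexCategoryᵒᵖ⦄ (s : (Δ[n] : SSet.{u}).obj m) (t : (Δ[n] : SSet.{u}).obj m'),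
    s ∈ A.obj m → Set.range (SSet.stdSimplex.asOrderHom t) ⊆
      insert k (Set.range (SSet.stdSimplex.asOrderHom s)) → t ∈ A.obj m'

lemma isStarShaped_top : IsStarShaped (⊤ : (Δ[n] : SSet.{u}).Subcomplex) k :=
  ⟨fun _ ↦ trivial, fun _ _ _ _ _ _ ↦ trivial⟩

/-- A simplex lies in the horn exactly when its vertices together with `k` do not exhaust all
vertices, and this condition is unaffected by adding `k`. -/
lemma isStarShaped_horn (k : Fin (n + 2)) : IsStarShaped (SSet.horn.{u} (n + 1) k) k := by
  refine ⟨fun m ↦ ?_, fun m m' s t hs ht ↦ ?_⟩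
  · rw [SSet.mem_horn_iff]
    intro h
    obtain ⟨j, hj⟩ := exists_ne k
    have := h.ge (Set.mem_univ j)
    obtain ⟨x, rfl⟩ | h := this
    · exact hj rfl
    · exact hj h
  · rw [SSet.mem_horn_iff] at hs ⊢
    refine fun h ↦ hs (Set.eq_univ_of_univ_subset (h.ge.trans ?_))
    simp only [Set.union_singleton]
    exact Set.insert_subset (Set.mem_insert _ _) ht

/-- The simplices of a subcomplex of `Δ[n]` all of whose vertices are at least `k`. -/
def upperPart : (Δ[n] : SSet.{u}).Subcomplex where
  obj m := {s | s ∈ A.obj m ∧ ∀ x, k ≤ SSet.stdSimplex.asOrderHom s x}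
  map θ _ hs := ⟨A.map θ hs.1, fun x ↦ hs.2 (θ.unop.toOrderHom x)⟩

lemma upperPart_le : upperPart A k ≤ A := fun _ _ hs ↦ hs.1

variable {A k} (hA : IsStarShaped A k)

/-- The inclusion of the vertex `k`. -/
noncomputable def upperPartVertex : Δ[0] ⟶ (upperPart A k : SSet.{u}) where
  app m := ↾fun _ ↦ ⟨SSet.stdSimplex.const n k m, hA.1 m, fun _ ↦ le_rfl⟩

instance : Mono (upperPartVertex hA) := SSet.stdSimplex.isTerminalObj₀.mono_from _

/-- On the upper part `k` is a lower bound for all vertices, so one monotone homotopy goes from the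
constant map at `k` to the identity. For the whole complex no single direction works, hence the
two-step contraction. -/
lemma contractsOnto_upperPartVertex : ContractsOnto (upperPartVertex hA) := by
  refine ⟨SSet.stdSimplex.isTerminalObj₀.from _,
    { app m := ↾fun x ↦ ⟨SSet.stdSimplex.objMk
        ⟨fun j ↦ if SSet.stdSimplex.asOrderHom x.2 j = 0 then k else
          SSet.stdSimplex.asOrderHom x.1.1 j, ?_⟩, hA.2 x.1.1 _ x.1.2.1 ?_, ?_⟩
      naturality := ?_ }, ?_, .inl ⟨?_, ?_⟩⟩
  · intro a b hab
    have h₁ := (SSet.stdSimplex.asOrderHom x.2).monotone hab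
    have h₂ := (SSet.stdSimplex.asOrderHom x.1.1).monotone hab
    have h₃ := x.1.2.2 b
    dsimp only
    split_ifs with h h' h'
    · exact le_rfl
    · exact h₃
    · rw [h'] at h₁
      exact absurd (le_antisymm h₁ (Fin.zero_le _)) h
    · exact h₂
  · rintro _ ⟨j, rfl⟩
    change ite _ _ _ ∈ _
    split_ifs
    · exact Set.mem_insert _ _
    · exact Set.mem_insert_of_mem _ ⟨j, rfl⟩
  · intro j
    change k ≤ ite _ _ _
    split_ifs
    · exact le_rfl
    · exact x.1.2.2 j
  · intros
    rfl
  · ext m x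
    refine Subtype.ext (SSet.stdSimplex.objEquiv.injective ?_)
    ext j : 3
    exact ite_self _
  · rfl
  · ext m x
    refine Subtype.ext (SSet.stdSimplex.objEquiv.injective ?_)
    ext j : 3
    exact if_neg (t := k) (one_ne_zero (α := Fin 2))

/-- The retraction replaces each vertex `j` by `max k j`, and the homotopy runs from the identity to
it. The new vertices are old ones or `k`, so star-shapedness keeps everything inside `A`. -/
lemma contractsOnto_upperPart (hA : IsStarShaped A k) :
    ContractsOnto (SSet.Subcomplex.homOfLE (upperPart_le A k)) := by
  refine ⟨{ app m := ↾fun x ↦ ⟨SSet.stdSimplex.objMk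
        ⟨fun j ↦ max k (SSet.stdSimplex.asOrderHom x.1 j), ?_⟩,
          hA.2 x.1 _ x.2 ?_, fun _ ↦ le_max_left _ _⟩, naturality := ?_ },
    { app m := ↾fun x ↦ ⟨SSet.stdSimplex.objMk
        ⟨fun j ↦ if SSet.stdSimplex.asOrderHom x.2 j = 0 then SSet.stdSimplex.asOrderHom x.1.1 j else
          max k (SSet.stdSimplex.asOrderHom x.1.1 j), ?_⟩, hA.2 x.1.1 _ x.1.2 ?_⟩
      naturality := ?_ }, ?_, .inr ⟨?_, ?_⟩⟩
  · intro a b hab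
    exact max_le_max le_rfl ((SSet.stdSimplex.asOrderHom x.1).monotone hab)
  · rintro _ ⟨j, rfl⟩
    obtain h | h := max_choice k (SSet.stdSimplex.asOrderHom x.1 j)
    · exact Set.mem_insert_iff.2 (.inl h)
    · exact Set.mem_insert_iff.2 (.inr ⟨j, h.symm⟩)
  · intros
    rfl
  · intro a b hab
    have h₁ := (SSet.stdSimplex.asOrderHom x.2).monotone hab
    have h₂ := (SSet.stdSimplex.asOrderHom x.1.1).monotone hab
    dsimp only
    split_ifs with h h' h'
    · exact h₂
    · exact h₂.trans (le_max_right _ _)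
    · rw [h'] at h₁
      exact absurd (le_antisymm h₁ (Fin.zero_le _)) h
    · exact max_le_max le_rfl h₂
  · rintro _ ⟨j, rfl⟩
    change ite _ _ _ ∈ _
    split_ifs
    · exact Set.mem_insert_of_mem _ ⟨j, rfl⟩
    obtain h | h := max_choice k (SSet.stdSimplex.asOrderHom x.1.1 j)
    · exact Set.mem_insert_iff.2 (.inl h)
    · exact Set.mem_insert_iff.2 (.inr ⟨j, h.symm⟩)
  · intros
    rfl
  · ext m x
    refine Subtype.ext (SSet.stdSimplex.objEquiv.injective ?_)
    ext j : 3
    have : max k (SSet.stdSimplex.asOrderHom x.1.1 j) = SSet.stdSimplex.asOrderHom x.1.1 j :=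
      max_eq_right (x.1.2.2 j)
    change ite _ _ (max k (SSet.stdSimplex.asOrderHom x.1.1 j)) = _
    rw [this]
    exact ite_self _
  · ext m x
    refine Subtype.ext (SSet.stdSimplex.objEquiv.injective ?_)
    ext j : 3
    exact if_neg (t := SSet.stdSimplex.asOrderHom x.1 j) (one_ne_zero (α := Fin 2))
  · ext m x
    refine Subtype.ext (SSet.stdSimplex.objEquiv.injective ?_)
    ext j : 3
    exact if_pos (e := max k (SSet.stdSimplex.asOrderHom x.1 j)) (rfl : (0 : Fin 2) = 0)

/-- The inclusion of the vertex `k` in a star-shaped subcomplex. -/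
noncomputable def starVertex : Δ[0] ⟶ (A : SSet.{u}) :=
  upperPartVertex hA ≫ SSet.Subcomplex.homOfLE (upperPart_le A k)

instance : Mono (starVertex hA) := mono_comp _ _

lemma anodyneExtensions_fibre {Z Z₀ : SSet.{u}} {π : Z₀ ⟶ Z} {p₀ : Z₀ ⟶ Δ[0]}
    {p : Z ⟶ A} (sq : IsPullback π p₀ p (starVertex hA)) [Fibration p] : anodyneExtensions π := by
  have sq₁ := IsPullback.of_hasPullback p (SSet.Subcomplex.homOfLE (upperPart_le A k))
  have := fibration_of_isPullback sq₁
  have := MorphismProperty.comp_mem _ _ _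
    (anodyneExtensions_of_contractsOnto (contractsOnto_upperPartVertex hA)
      (IsPullback.of_right' sq sq₁))
    (anodyneExtensions_of_contractsOnto (contractsOnto_upperPart hA) sq₁)
  simpa using this

lemma anodyneExtensions_of_fibre {Y P Y₀ P₀ : SSet.{u}} {y : Y₀ ⟶ Y} {q₀ : Y₀ ⟶ Δ[0]}
    {q : Y ⟶ A} (sqY : IsPullback y q₀ q (starVertex hA)) {π : P₀ ⟶ P} {p₀ : P₀ ⟶ Δ[0]}
    {p : P ⟶ A} (sqP : IsPullback π p₀ p (starVertex hA)) [Fibration q] [Fibration p]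
    (i : Y ⟶ P) [Mono i] (hi : i ≫ p = q) (i₀ : Y₀ ⟶ P₀) (hy : i₀ ≫ π = y ≫ i)
    (hi₀ : anodyneExtensions i₀) : anodyneExtensions i := by
  have sqY₁ := IsPullback.of_hasPullback q (SSet.Subcomplex.homOfLE (upperPart_le A k))
  have := fibration_of_isPullback sqY₁
  have sqP₁ := IsPullback.of_hasPullback p (SSet.Subcomplex.homOfLE (upperPart_le A k))
  have := fibration_of_isPullback sqP₁
  have := mono_fst_of_isPullback sqY₁
  let i₁ := sqP₁.lift (pullback.fst _ _ ≫ i) (pullback.snd _ _) (by rw [Category.assoc, hi, sqY₁.w])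
  have hi₁ : i₁ ≫ pullback.fst _ _ = pullback.fst _ _ ≫ i := sqP₁.lift_fst _ _ _
  have : Mono i₁ := by
    have : Mono (i₁ ≫ pullback.fst _ _) := by rw [hi₁]; infer_instance
    exact mono_of_mono i₁ (pullback.fst _ _)
  refine anodyneExtensions_of_restriction (contractsOnto_upperPart hA) sqY₁ sqP₁ i hi i₁ hi₁ ?_
  refine anodyneExtensions_of_restriction (contractsOnto_upperPartVertex hA)
    (IsPullback.of_right' sqY sqY₁) (IsPullback.of_right' sqP sqP₁) i₁ (sqP₁.lift_snd _ _ _)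
    i₀ ?_ hi₀
  have hq₀ : i₀ ≫ p₀ = q₀ := SSet.stdSimplex.isTerminalObj₀.hom_ext _ _
  apply sqP₁.hom_ext
  · simp [hi₁, hy]
  · simp [i₁, reassoc_of% hq₀]

end starShaped

/-! ### Extending a Kan fibration from a horn to the simplex. -/

section hornExtension

variable {n : ℕ} (k : Fin (n + 2))

/-- The whole simplex is star-shaped at `k`, and its vertex `k` is the vertex of the horn. -/
lemma anodyneExtensions_fibre_stdSimplex {Z Z₀ : SSet.{u}} {π : Z₀ ⟶ Z} {p₀ : Z₀ ⟶ Δ[0]}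
    {p : Z ⟶ Δ[n + 1]}
    (sq : IsPullback π p₀ p (starVertex (isStarShaped_horn k) ≫ Λ[n + 1, k].ι)) [Fibration p] :
    anodyneExtensions π := by
  have sq₁ := IsPullback.of_hasPullback p (⊤ : (Δ[n + 1] : SSet.{u}).Subcomplex).ι
  have : IsIso (⊤ : (Δ[n + 1] : SSet.{u}).Subcomplex).ι :=
    inferInstanceAs (IsIso (SSet.Subcomplex.topIso _).hom)
  have := fibration_of_isPullback sq₁
  have h : starVertex (isStarShaped_horn k) ≫ Λ[n + 1, k].ι =
      starVertex (isStarShaped_top k) ≫ (⊤ : (Δ[n + 1] : SSet.{u}).Subcomplex).ι := rfl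
  rw [h] at sq
  have := MorphismProperty.comp_mem _ _ _
    (anodyneExtensions_fibre (isStarShaped_top k) (IsPullback.of_right' sq sq₁))
    (SSet.anodyneExtensions.of_isIso (pullback.fst p (⊤ : (Δ[n + 1] : SSet.{u}).Subcomplex).ι))
  simpa using this

/-- A Kan fibration over a horn is fibrewise a deformation retract of the restriction of a
Kan fibration over the simplex. -/
lemma exists_anodyne_of_horn {Y : SSet.{u}} (q : Y ⟶ Λ[n + 1, k]) [Fibration q] :
    ∃ (P P' : SSet.{u}) (p : P ⟶ Λ[n + 1, k]) (p' : P' ⟶ Δ[n + 1]) (b : P ⟶ P') (i : Y ⟶ P),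
      Fibration p' ∧ IsPullback b p p' Λ[n + 1, k].ι ∧ anodyneExtensions i ∧ i ≫ p = q := by
  obtain ⟨P', i', p', hi', _, fac⟩ := exists_factorization_anodyne_fibration (q ≫ Λ[n + 1, k].ι)
  have sq := IsPullback.of_hasPullback p' Λ[n + 1, k].ι
  have := fibration_of_isPullback sq
  let i := sq.lift i' q fac
  have hi : i ≫ _ = i' := sq.lift_fst _ _ _
  have hiq : i ≫ _ = q := sq.lift_snd _ _ _
  have := mono_of_anodyne hi'
  have : Mono i := by
    have : Mono (i ≫ pullback.fst _ _) := by rw [hi]; infer_instance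
    exact mono_of_mono i (pullback.fst _ _)
  refine ⟨_, _, _, p', _, i, inferInstance, sq, ?_, hiq⟩
  have sqY := IsPullback.of_hasPullback q (starVertex (isStarShaped_horn k))
  have sqP := IsPullback.of_hasPullback (pullback.snd p' Λ[n + 1, k].ι)
    (starVertex (isStarShaped_horn k))
  have := mono_fst_of_isPullback sqY
  let i₀ := sqP.lift (pullback.fst _ _ ≫ i) (pullback.snd _ _) (by rw [Category.assoc, hiq, sqY.w])
  have hi₀ : i₀ ≫ pullback.fst _ _ = pullback.fst _ _ ≫ i := sqP.lift_fst _ _ _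
  have : Mono i₀ := by
    have : Mono (i₀ ≫ pullback.fst _ _) := by rw [hi₀]; infer_instance
    exact mono_of_mono i₀ (pullback.fst _ _)
  refine anodyneExtensions_of_fibre (isStarShaped_horn k) sqY sqP i hiq i₀ hi₀ ?_
  -- The fibre over the vertex `k` includes by anodyne maps into `P'` and into `Y`, while `Y ⟶ P'`
  -- is anodyne by construction. Two-out-of-three makes the map of fibres a weak equivalence; it is
  -- monic with Kan target, hence anodyne, and this propagates from the fibre to `i`.
  have hP := anodyneExtensions_fibre_stdSimplex k (sqP.paste_horiz sq)
  have hY := anodyneExtensions_fibre (isStarShaped_horn k) sqY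
  have : KanComplex (pullback (pullback.snd p' Λ[n + 1, k].ι)
      (starVertex (isStarShaped_horn k))) := by
    have := fibration_of_isPullback sqP
    exact (isFibrant_iff_of_isTerminal _ SSet.stdSimplex.isTerminalObj₀.{u}).2 this
  refine anodyneExtensions_of_kanComplex i₀ (MorphismProperty.of_postcomp _ _ _
    (sSetWeakEquivalences_of_anodyne hP) ?_)
  rw [reassoc_of% hi₀, hi]
  exact sSetWeakEquivalences_of_anodyne (MorphismProperty.comp_mem _ _ _ hY hi')

section

variable {Y P P' : SSet.{u}} (b : P ⟶ P') (i : Y ⟶ P)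

/-- The simplices of `P'` all of whose faces in `P` belong to `Y`. -/
def extensionSubcomplex : P'.Subcomplex where
  obj m := {s | ∀ (l : SimplexCategoryᵒᵖ) (θ : m ⟶ l) (z : P.obj l),
    b.app l z = P'.map θ s → z ∈ Set.range (i.app l)}
  map {m m'} φ s hs l θ z hz := hs l (φ ≫ θ) z (by rw [hz, Functor.map_comp_apply])

lemma mem_extensionSubcomplex_of_mem [Mono b] {m : SimplexCategoryᵒᵖ} (y : Y.obj m) :
    b.app m (i.app m y) ∈ (extensionSubcomplex b i).obj m := by
  intro l θ z hz
  refine ⟨Y.map θ y, ?_⟩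
  have hb := (mono_iff_injective (b.app l)).1 inferInstance
  apply hb
  rw [hz, ← NatTrans.naturality_apply, ← NatTrans.naturality_apply]

open Classical in
/-- A homotopy on `P` relative to `Y` extends by a constant homotopy. -/
noncomputable def extensionHomotopy [Mono b] (R : P ⊗ Δ[1] ⟶ P)
    (hR : i ▷ _ ≫ R = CartesianMonoidalCategory.fst _ _ ≫ i) :
    ((SSet.Subcomplex.range b ⊔ extensionSubcomplex b i : P'.Subcomplex) : SSet.{u}) ⊗ Δ[1] ⟶
      P' where
  app m := ↾fun x ↦ if h : ∃ z, b.app m z = x.1.1 then b.app m (R.app m (h.choose, x.2)) else x.1.1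
  naturality m m' φ := by
    ext x
    have hb := (mono_iff_injective (b.app m')).1 inferInstance
    change (if h : ∃ z, b.app m' z = P'.map φ x.1.1 then
      b.app m' (R.app m' (h.choose, (Δ[1] : SSet.{u}).map φ x.2)) else P'.map φ x.1.1) =
      P'.map φ (if h : ∃ z, b.app m z = x.1.1 then b.app m (R.app m (h.choose, x.2)) else x.1.1)
    by_cases h : ∃ z, b.app m z = x.1.1
    · have h' : ∃ z, b.app m' z = P'.map φ x.1.1 :=
        ⟨P.map φ h.choose, by rw [NatTrans.naturality_apply, h.choose_spec]⟩
      have h'' : h'.choose = P.map φ h.choose :=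
        hb (h'.choose_spec.trans (by rw [NatTrans.naturality_apply, h.choose_spec]))
      rw [dif_pos h, dif_pos h', h'', ← NatTrans.naturality_apply b]
      exact congrArg (b.app m') (naturality_tensor_apply R φ h.choose x.2)
    · rw [dif_neg h]
      split_ifs with h'
      -- A simplex outside `P` may have a face in `P`, but by definition of the subcomplex that face
      -- is in `Y`, where `R` is constant.
      · have hx : x.1.1 ∈ (extensionSubcomplex b i).obj m := x.1.2.resolve_left h
        obtain ⟨y, hy⟩ := hx m' φ h'.choose h'.choose_spec
        rw [← hy, ← h'.choose_spec, ← hy]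
        exact congrArg (b.app m') (congr_tensor_app hR y ((Δ[1] : SSet.{u}).map φ x.2))
      · rfl

lemma extensionHomotopy_app_of_eq [Mono b] (R : P ⊗ Δ[1] ⟶ P)
    (hR : i ▷ _ ≫ R = CartesianMonoidalCategory.fst _ _ ≫ i) {m : SimplexCategoryᵒᵖ}
    (s : ((SSet.Subcomplex.range b ⊔ extensionSubcomplex b i : P'.Subcomplex) : SSet.{u}).obj m)
    (t : (Δ[1] : SSet.{u}).obj m) (z : P.obj m) (hz : b.app m z = s.1) :
    (extensionHomotopy b i R hR).app m (s, t) = b.app m (R.app m (z, t)) := by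
  have hb := (mono_iff_injective (b.app m)).1 inferInstance
  have h : ∃ z, b.app m z = s.1 := ⟨z, hz⟩
  obtain rfl : h.choose = z := hb (h.choose_spec.trans hz.symm)
  exact dif_pos h

lemma extensionHomotopy_app_of_mem [Mono b] (R : P ⊗ Δ[1] ⟶ P)
    (hR : i ▷ _ ≫ R = CartesianMonoidalCategory.fst _ _ ≫ i) {m : SimplexCategoryᵒᵖ}
    (s : ((SSet.Subcomplex.range b ⊔ extensionSubcomplex b i : P'.Subcomplex) : SSet.{u}).obj m)
    (t : (Δ[1] : SSet.{u}).obj m) (hs : s.1 ∈ (extensionSubcomplex b i).obj m) :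
    (extensionHomotopy b i R hR).app m (s, t) = s.1 := by
  by_cases h : ∃ z, b.app m z = s.1
  · obtain ⟨z, hz⟩ := h
    rw [extensionHomotopy_app_of_eq b i R hR s t z hz]
    obtain ⟨y, rfl⟩ := hs m (𝟙 _) z (by simpa using hz)
    rw [← hz]
    exact congrArg (b.app m) (congr_tensor_app hR y t)
  · exact dif_neg h

end

/-- Kan fibrations over a horn extend to Kan fibrations over the simplex. -/
lemma exists_extension_of_horn {Y : SSet.{u}} (q : Y ⟶ Λ[n + 1, k]) [Fibration q] :
    ∃ (Y' : SSet.{u}) (q' : Y' ⟶ Δ[n + 1]) (j : Y ⟶ Y'),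
      Fibration q' ∧ IsPullback j q q' Λ[n + 1, k].ι := by
  obtain ⟨P, P', p, p', b, i, hp', sq, hi, rfl⟩ := exists_anodyne_of_horn k q
  have hip : Fibration (i ≫ p) := inferInstance
  have := fibration_of_isPullback sq
  have := mono_fst_of_isPullback sq
  -- As `i` is anodyne and `i ≫ p` a fibration, `Y` is a retract of `P` over the horn, and `R`
  -- deforms `P` onto it relative to `Y` and fibrewise.
  obtain ⟨r, hr, hr'⟩ : ∃ r : P ⟶ Y, i ≫ r = 𝟙 Y ∧ r ≫ i ≫ p = p := by
    have := hi _ hip.mem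
    have sq : CommSq (𝟙 Y) i (i ≫ p) p := ⟨by simp⟩
    exact ⟨sq.lift, sq.fac_left, sq.fac_right⟩
  obtain ⟨R, hR₀, hR₁, hR, hRp⟩ := exists_homotopy_lift_of_anodyne hi p (𝟙 P) (r ≫ i)
    (CartesianMonoidalCategory.fst _ _ ≫ i) (CartesianMonoidalCategory.fst _ _ ≫ p)
    (by simp) (by simp [reassoc_of% hr]) (by simp) (by simp [hr']) (by simp)
  -- The deformation is made constant on the subcomplex of simplices whose faces in `P` lie in `Y`,
  -- then extended fibrewise to `P'`. Its end `ρ` is a retraction of `P'` over the simplex onto that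
  -- subcomplex, which is therefore fibred; over the horn the subcomplex is exactly `Y`.
  let S := SSet.Subcomplex.range b ⊔ extensionSubcomplex b i
  let K := extensionHomotopy b i R hR
  obtain ⟨G, hG₀, hG, hGp⟩ := exists_homotopy_lift₀ S.ι p' K (𝟙 P')
    (CartesianMonoidalCategory.fst _ _ ≫ p')
    (by
      ext m s
      by_cases hs : s.1 ∈ (extensionSubcomplex b i).obj m
      · exact (extensionHomotopy_app_of_mem b i R hR s _ hs).symm
      · obtain ⟨z, hz⟩ := s.2.resolve_right hs
        refine Eq.trans ?_ (extensionHomotopy_app_of_eq b i R hR s _ z hz).symm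
        refine hz.symm.trans (congrArg (b.app m) ?_)
        exact (ConcreteCategory.congr_hom (NatTrans.congr_app hR₀ m) z).symm)
    (by simp)
    (by
      ext m ⟨s, t⟩
      by_cases hs : s.1 ∈ (extensionSubcomplex b i).obj m
      · exact congrArg (p'.app m) (extensionHomotopy_app_of_mem b i R hR s _ hs)
      · obtain ⟨z, hz⟩ := s.2.resolve_right hs
        refine (congrArg (p'.app m) (extensionHomotopy_app_of_eq b i R hR s t z hz)).trans ?_
        refine Eq.trans ?_ (congrArg (p'.app m) hz)
        refine (ConcreteCategory.congr_hom (NatTrans.congr_app sq.w m) _).trans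
          (Eq.trans ?_ (ConcreteCategory.congr_hom (NatTrans.congr_app sq.w m) _).symm)
        exact congrArg (Λ[n + 1, k].ι.app m) (congr_tensor_app hRp z t))
  let ρ := ι₁ ≫ G
  have hρ : ρ ≫ p' = p' := by simp [ρ, hGp]
  have hSρ : S.ι ≫ ρ = ι₁ ≫ K := by rw [← hG]; rfl
  have hbρ {m : SimplexCategoryᵒᵖ} (z : P.obj m) :
      ρ.app m (b.app m z) = b.app m (i.app m (r.app m z)) := by
    refine (ConcreteCategory.congr_hom (NatTrans.congr_app hSρ m)
      ⟨b.app m z, .inl ⟨z, rfl⟩⟩).trans ?_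
    refine (extensionHomotopy_app_of_eq b i R hR _ _ z rfl).trans (congrArg (b.app m) ?_)
    exact ConcreteCategory.congr_hom (NatTrans.congr_app hR₁ m) z
  have hbp {m : SimplexCategoryᵒᵖ} (s : P'.obj m) (hs : p'.app m s ∈ Λ[n + 1, k].obj m) :
      ∃ z, b.app m z = s := by
    obtain ⟨z, hz, -⟩ := (((isPullback_iff_app _ _ _ _).1 sq).2 m).2 s ⟨_, hs⟩ rfl
    exact ⟨z, hz⟩
  -- Since `ρ` is a map over the simplex, a face of `ρ s` lying over the horn comes from a face of
  -- `s` over the horn, and on `P` the map `ρ` is `r ≫ i`, with values in `Y`.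
  have hmem {m : SimplexCategoryᵒᵖ} (s : P'.obj m) :
      ρ.app m s ∈ (extensionSubcomplex b i).obj m := by
    intro l θ z hz
    obtain ⟨z', hz'⟩ := hbp (P'.map θ s) (by
      have : p'.app l (P'.map θ s) = (p.app l z).1 := by
        refine (ConcreteCategory.congr_hom (NatTrans.congr_app hρ l) (P'.map θ s)).symm.trans ?_
        refine Eq.trans (congrArg (p'.app l) ?_)
          (ConcreteCategory.congr_hom (NatTrans.congr_app sq.w l) z)
        exact (NatTrans.naturality_apply ρ θ s).trans hz.symm
      rw [this]
      exact (p.app l z).2)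
    refine ⟨r.app l z', ?_⟩
    apply (mono_iff_injective (b.app l)).1 inferInstance
    rw [← hbρ, hz', hz, NatTrans.naturality_apply]
  let Y' := extensionSubcomplex b i
  have hretract : Y'.ι ≫ ρ = Y'.ι := by
    ext m s
    refine (ConcreteCategory.congr_hom (NatTrans.congr_app hSρ m) ⟨s.1, .inr s.2⟩).trans ?_
    exact extensionHomotopy_app_of_mem b i R hR _ _ s.2
  let ρ' : P' ⟶ Y' := SSet.Subcomplex.lift ρ (by rintro m _ ⟨s, rfl⟩; exact hmem s)
  have hρ' : ρ' ≫ Y'.ι = ρ := rfl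
  refine ⟨Y', Y'.ι ≫ p', SSet.Subcomplex.lift (i ≫ b) (by
    rintro m _ ⟨y, rfl⟩; exact mem_extensionSubcomplex_of_mem b i y), ?_, ?_⟩
  · refine ⟨MorphismProperty.of_retract (P := J.rlp) (g := p')
      { i := Arrow.homMk Y'.ι (𝟙 _) (by simp)
        r := Arrow.homMk ρ' (𝟙 _) (by simp [reassoc_of% hρ', hρ])
        retract := ?_ } hp'.mem⟩
    ext : 1
    · rw [← cancel_mono Y'.ι]
      simpa [hρ'] using hretract
    · simp
  · rw [isPullback_iff_app]
    refine ⟨?_, fun m ↦ ⟨fun z z' h _ ↦ ?_, fun s y h ↦ ?_⟩⟩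
    · rw [Category.assoc, ← sq.w]
      rfl
    · have := mono_of_anodyne hi
      have : Mono (i ≫ b) := mono_comp _ _
      exact (mono_iff_injective ((i ≫ b).app m)).1 inferInstance (congrArg Subtype.val h)
    · obtain ⟨z, hz, hz'⟩ := (((isPullback_iff_app _ _ _ _).1 sq).2 m).2 s.1 y h
      obtain ⟨y, rfl⟩ := s.2 m (𝟙 _) z (by simpa using hz)
      exact ⟨y, Subtype.ext hz, hz'⟩

end hornExtension

/-! ### Extension of fibrations along anodyne maps: closure properties. -/

section locality

/-- Being a Kan fibration can be checked on a covering family of the base. -/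
lemma fibration_of_cover {E B : SSet.{u}} (p : E ⟶ B) {ι : Type*} {E' B' : ι → SSet.{u}}
    (p' : ∀ i, E' i ⟶ B' i) (e : ∀ i, E' i ⟶ E) (b : ∀ i, B' i ⟶ B)
    (sq : ∀ i, IsPullback (e i) (p' i) p (b i)) (hp' : ∀ i, Fibration (p' i))
    (hb : ∀ (n : ℕ) (x : B _⦋n⦌), ∃ i y, (b i).app _ y = x) : Fibration p := by
  refine (SSet.modelCategoryQuillen.fibration_iff p).2 fun A X j hj ↦ ?_
  refine ⟨fun {f g} comm ↦ ?_⟩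
  -- The target of a horn inclusion is a standard simplex, so its map to `B` is a single simplex and
  -- factors through one member of the cover.
  obtain ⟨i, g', rfl⟩ : ∃ i g', g' ≫ b i = g := by
    simp only [J, MorphismProperty.iSup_iff] at hj
    obtain ⟨n, ⟨k⟩⟩ := hj
    obtain ⟨i, y, hy⟩ := hb _ (SSet.yonedaEquiv g)
    refine ⟨i, SSet.yonedaEquiv.symm y, ?_⟩
    rw [SSet.yonedaEquiv_symm_comp, Equiv.symm_apply_eq]
    exact hy
  have := (SSet.modelCategoryQuillen.fibration_iff (p' i)).1 inferInstance j hj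
  have comm' : CommSq ((sq i).lift f (j ≫ g') (by rw [comm.w, Category.assoc])) j (p' i) g' :=
    ⟨by simp⟩
  refine ⟨⟨⟨comm'.lift ≫ e i, ?_, ?_⟩⟩⟩
  · rw [comm'.fac_left_assoc, (sq i).lift_fst]
  · rw [Category.assoc, (sq i).w, comm'.fac_right_assoc]

end locality

/-- The monomorphisms along which every Kan fibration extends to a Kan fibration. -/
def extendsFibrations : MorphismProperty SSet.{u} := fun A X j ↦ Mono j ∧
  ∀ ⦃E : SSet.{u}⦄ (p : E ⟶ A) [Fibration p],
    ∃ (E' : SSet.{u}) (p' : E' ⟶ X) (i : E ⟶ E'), Fibration p' ∧ IsPullback i p p' j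

lemma J_le_extendsFibrations : J.{u} ≤ extendsFibrations := by
  intro A X j hj
  refine ⟨J_le_monomorphisms _ hj, ?_⟩
  simp only [J, MorphismProperty.iSup_iff] at hj
  obtain ⟨n, ⟨k⟩⟩ := hj
  intro E p _
  exact exists_extension_of_horn k p

/-- Pull the fibration back along the retraction of sources, extend it, and restrict the extension
along the section of targets. -/
instance : extendsFibrations.{u}.IsStableUnderRetracts where
  of_retract {A X A' X' j j'} h hj' := by
    obtain ⟨h₁, h₂⟩ := hj'
    refine ⟨MorphismProperty.of_retract (P := MorphismProperty.monomorphisms _) h h₁, ?_⟩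
    intro E p _
    have sq := IsPullback.of_hasPullback p h.r.left
    have := fibration_of_isPullback sq
    obtain ⟨E', p', i, _, sq'⟩ := h₂ (pullback.snd p h.r.left)
    have sq'' := IsPullback.of_hasPullback p' h.i.right
    have sq₁ : IsPullback (𝟙 E) p p (h.i.left ≫ h.r.left) := by
      rw [RetractArrow.retract_left h]
      exact IsPullback.of_horiz_isIso ⟨by simp⟩
    have sq₂ := (IsPullback.of_right' sq₁ sq).paste_horiz sq'
    rw [h.i_w] at sq₂
    exact ⟨_, _, _, fibration_of_isPullback sq'', IsPullback.of_right' sq₂ sq''⟩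

/-- Pull back to `A`, extend to `A'`, and glue with the given fibration. By the van Kampen property
the glued map pulls back to the two pieces, which cover the base, so it is a fibration. -/
instance : extendsFibrations.{u}.IsStableUnderCobaseChange where
  of_isPushout {A A' B B' f g f' g'} sq hf := by
    obtain ⟨_, hf⟩ := hf
    have : Mono f' := Adhesive.mono_of_isPushout_of_mono_right sq
    refine ⟨inferInstance, fun E p _ ↦ ?_⟩
    have sq₁ := IsPullback.of_hasPullback p g
    have := fibration_of_isPullback sq₁
    obtain ⟨F, q, i, _, sq₂⟩ := hf (pullback.snd p g)
    have := mono_fst_of_isPullback sq₂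
    have po := IsPushout.of_hasPushout (pullback.fst p g) i
    let p' : pushout (pullback.fst p g) i ⟶ B' := po.desc (p ≫ f') (q ≫ g') (by
      rw [reassoc_of% sq₁.w, reassoc_of% sq₂.w, sq.w])
    have hl : pushout.inl (pullback.fst p g) i ≫ p' = p ≫ f' := po.inl_desc _ _ _
    have hr : pushout.inr (pullback.fst p g) i ≫ p' = q ≫ g' := po.inr_desc _ _ _
    have := (Adhesive.van_kampen' sq _ _ _ _ _ p q p' sq₁ sq₂ ⟨hl⟩ ⟨hr⟩ ⟨po.w⟩).1 po
    refine ⟨_, p', _, ?_, this.1⟩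
    refine fibration_of_cover (ι := Bool) p' (E' := fun b ↦ bif b then F else E)
      (B' := fun b ↦ bif b then A' else B)
      (fun b ↦ match b with
        | true => q
        | false => p)
      (fun b ↦ match b with
        | true => pushout.inr (pullback.fst p g) i
        | false => pushout.inl (pullback.fst p g) i)
      (fun b ↦ match b with
        | true => g'
        | false => f')
      ?_ ?_ ?_
    · rintro (_ | _)
      · exact this.1
      · exact this.2
    · rintro (_ | _) <;> assumption
    · intro n x
      obtain ⟨y, hy⟩ | ⟨y, hy⟩ := Types.eq_or_eq_of_isPushout (sq.app (op ⦋n⦌)) x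
      · exact ⟨false, y, hy⟩
      · exact ⟨true, y, hy⟩

section coproducts

/-- The coproduct of a family of simplicial sets, with explicit simplices. -/
def sigmaObj {ι : Type u} (X : ι → SSet.{u}) : SSet.{u} where
  obj m := Σ i, (X i).obj m
  map φ := ↾fun x ↦ ⟨x.1, (X x.1).map φ x.2⟩

/-- The comparison with the abstract coproduct. -/
noncomputable def toSigmaObj {ι : Type u} (X : ι → SSet.{u}) : ∐ X ⟶ sigmaObj X :=
  Sigma.desc fun i ↦ { app m := ↾fun x ↦ ⟨i, x⟩ }

lemma toSigmaObj_ι_app {ι : Type u} (X : ι → SSet.{u}) (i : ι) {m : SimplexCategoryᵒᵖ}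
    (x : (X i).obj m) : (toSigmaObj X).app m ((Sigma.ι X i).app m x) = ⟨i, x⟩ :=
  ConcreteCategory.congr_hom (NatTrans.congr_app (Sigma.ι_desc (f := X) _ i) m) x

lemma exists_sigma_ι_app_eq {ι : Type u} (X : ι → SSet.{u}) {m : SimplexCategoryᵒᵖ}
    (x : (∐ X).obj m) : ∃ i y, (Sigma.ι X i).app m y = x := by
  obtain ⟨⟨i⟩, y, h⟩ := Types.jointly_surjective_of_isColimit
    (isColimitOfPreserves ((evaluation _ _).obj m) (colimit.isColimit (Discrete.functor X))) x
  exact ⟨i, y, h⟩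

lemma sigma_ι_app_injective {ι : Type u} (X : ι → SSet.{u}) (i : ι) {m : SimplexCategoryᵒᵖ} :
    Function.Injective ((Sigma.ι X i).app m) := by
  intro x y h
  have := congrArg ((toSigmaObj X).app m) h
  rw [toSigmaObj_ι_app, toSigmaObj_ι_app] at this
  exact eq_of_heq (Sigma.mk.inj this).2

lemma eq_of_sigma_ι_app_eq {ι : Type u} (X : ι → SSet.{u}) {i j : ι} {m : SimplexCategoryᵒᵖ}
    {x : (X i).obj m} {y : (X j).obj m} (h : (Sigma.ι X i).app m x = (Sigma.ι X j).app m y) :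
    i = j := by
  have := congrArg ((toSigmaObj X).app m) h
  rw [toSigmaObj_ι_app, toSigmaObj_ι_app] at this
  exact (Sigma.mk.inj this).1

lemma sigma_map_app_ι {ι : Type u} {X Y : ι → SSet.{u}} (f : ∀ i, X i ⟶ Y i) (i : ι)
    {m : SimplexCategoryᵒᵖ} (x : (X i).obj m) :
    (Limits.Sigma.map f).app m ((Sigma.ι X i).app m x) = (Sigma.ι Y i).app m ((f i).app m x) :=
  ConcreteCategory.congr_hom (NatTrans.congr_app (Sigma.ι_map f i) m) x

lemma isPullback_sigma_ι {ι : Type u} {X Y : ι → SSet.{u}} (f : ∀ i, X i ⟶ Y i) (i : ι) :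
    IsPullback (Sigma.ι X i) (f i) (Limits.Sigma.map f) (Sigma.ι Y i) := by
  rw [isPullback_iff_app]
  refine ⟨Sigma.ι_map f i, fun m ↦ ⟨fun z z' h _ ↦ sigma_ι_app_injective X i h, fun x y h ↦ ?_⟩⟩
  obtain ⟨j, x, rfl⟩ := exists_sigma_ι_app_eq X x
  rw [sigma_map_app_ι] at h
  obtain rfl := eq_of_sigma_ι_app_eq Y h
  exact ⟨x, rfl, sigma_ι_app_injective Y _ h⟩

lemma isPullback_sigma_map {ι : Type u} {P X Y Z : ι → SSet.{u}} (a : ∀ i, P i ⟶ X i)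
    (b : ∀ i, P i ⟶ Y i) (f : ∀ i, X i ⟶ Z i) (g : ∀ i, Y i ⟶ Z i)
    (sq : ∀ i, IsPullback (a i) (b i) (f i) (g i)) :
    IsPullback (Limits.Sigma.map a) (Limits.Sigma.map b) (Limits.Sigma.map f)
      (Limits.Sigma.map g) := by
  rw [isPullback_iff_app]
  refine ⟨Sigma.hom_ext _ _ fun i ↦ ?_, fun m ↦ ⟨fun z z' h h' ↦ ?_, fun x y h ↦ ?_⟩⟩
  · simp [(sq i).w_assoc]
  · obtain ⟨i, z, rfl⟩ := exists_sigma_ι_app_eq P z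
    obtain ⟨j, z', rfl⟩ := exists_sigma_ι_app_eq P z'
    rw [sigma_map_app_ι, sigma_map_app_ι] at h h'
    obtain rfl := eq_of_sigma_ι_app_eq X h
    exact congrArg _ ((((isPullback_iff_app _ _ _ _).1 (sq i)).2 m).1 z z'
      (sigma_ι_app_injective _ _ h) (sigma_ι_app_injective _ _ h'))
  · obtain ⟨i, x, rfl⟩ := exists_sigma_ι_app_eq X x
    obtain ⟨j, y, rfl⟩ := exists_sigma_ι_app_eq Y y
    rw [sigma_map_app_ι, sigma_map_app_ι] at h
    obtain rfl := eq_of_sigma_ι_app_eq Z h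
    obtain ⟨z, rfl, rfl⟩ := (((isPullback_iff_app _ _ _ _).1 (sq i)).2 m).2 x y
      (sigma_ι_app_injective _ _ h)
    exact ⟨(Sigma.ι P i).app m z, sigma_map_app_ι _ _ _, sigma_map_app_ι _ _ _⟩

/-- A simplicial set over a coproduct decomposes as a coproduct. -/
lemma isIso_desc_of_isPullback {ι : Type u} {E : SSet.{u}} {X : ι → SSet.{u}} (p : E ⟶ ∐ X)
    {E' : ι → SSet.{u}} (p' : ∀ i, E' i ⟶ X i) (e : ∀ i, E' i ⟶ E)
    (sq : ∀ i, IsPullback (e i) (p' i) p (Sigma.ι X i)) : IsIso (Sigma.desc e) := by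
  have hd (i : ι) {m : SimplexCategoryᵒᵖ} (x : (E' i).obj m) :
      (Sigma.desc e).app m ((Sigma.ι E' i).app m x) = (e i).app m x :=
    ConcreteCategory.congr_hom (NatTrans.congr_app (Sigma.ι_desc e i) m) x
  have he (i : ι) {m : SimplexCategoryᵒᵖ} (x : (E' i).obj m) :
      p.app m ((e i).app m x) = (Sigma.ι X i).app m ((p' i).app m x) :=
    ConcreteCategory.congr_hom (NatTrans.congr_app (sq i).w m) x
  rw [NatTrans.isIso_iff_isIso_app]
  intro m
  rw [isIso_iff_bijective]
  refine ⟨fun z z' h ↦ ?_, fun x ↦ ?_⟩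
  · obtain ⟨i, z, rfl⟩ := exists_sigma_ι_app_eq E' z
    obtain ⟨j, z', rfl⟩ := exists_sigma_ι_app_eq E' z'
    rw [hd, hd] at h
    have h' := congrArg (p.app m) h
    rw [he, he] at h'
    obtain rfl := eq_of_sigma_ι_app_eq X h'
    exact congrArg _ ((((isPullback_iff_app _ _ _ _).1 (sq i)).2 m).1 z z' h
      (sigma_ι_app_injective _ _ h'))
  · obtain ⟨i, y, hy⟩ := exists_sigma_ι_app_eq X (p.app m x)
    obtain ⟨z, rfl, -⟩ := (((isPullback_iff_app _ _ _ _).1 (sq i)).2 m).2 x y hy.symm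
    exact ⟨_, hd i z⟩

instance : extendsFibrations.{u}.RespectsIso :=
  MorphismProperty.RespectsIso.of_respects_arrow_iso _ fun _ _ e h ↦
    MorphismProperty.of_retract (P := extendsFibrations) e.symm.retract h

instance : MorphismProperty.IsStableUnderCoproducts.{u} extendsFibrations.{u} where
  isStableUnderCoproductsOfShape ι := by
    refine MorphismProperty.IsStableUnderCoproductsOfShape.mk _ _ fun A X _ _ f hf ↦ ?_
    have hf₁ (i : ι) : Mono (f i) := (hf i).1
    refine ⟨inferInstance, fun E p _ ↦ ?_⟩
    have sq (i : ι) := IsPullback.of_hasPullback p (Sigma.ι A i)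
    have hp (i : ι) := fibration_of_isPullback (sq i)
    choose E' p' e hp' sq' using fun i ↦ (hf i).2 (pullback.snd p (Sigma.ι A i))
    have := isIso_desc_of_isPullback p _ _ sq
    have sq₁ := isPullback_sigma_map e _ p' f sq'
    have sq₂ : IsPullback (inv (Sigma.desc fun i ↦ pullback.fst p (Sigma.ι A i))) p
        (Limits.Sigma.map fun i ↦ pullback.snd p (Sigma.ι A i)) (𝟙 _) := by
      refine IsPullback.of_horiz_isIso ⟨?_⟩
      rw [IsIso.inv_comp_eq, Category.comp_id]
      refine Sigma.hom_ext _ _ fun i ↦ ?_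
      simp [(sq i).w]
    refine ⟨_, Limits.Sigma.map p', _, ?_, by simpa using sq₂.paste_horiz sq₁⟩
    exact fibration_of_cover _ p' _ _ (isPullback_sigma_ι p') hp'
      fun n x ↦ exists_sigma_ι_app_eq X x

end coproducts

section sequences

lemma isPullback_map_of_succ {E F : ℕ ⥤ SSet.{u}} (α : E ⟶ F)
    (hα : ∀ n : ℕ, IsPullback (E.map (homOfLE (Nat.le_add_right n 1))) (α.app n) (α.app (n + 1))
      (F.map (homOfLE (Nat.le_add_right n 1)))) {n k : ℕ} (f : n ⟶ k) :
    IsPullback (E.map f) (α.app n) (α.app k) (F.map f) := by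
  obtain ⟨l, rfl⟩ := Nat.exists_eq_add_of_le (leOfHom f)
  induction l with
  | zero =>
    obtain rfl : f = 𝟙 n := Subsingleton.elim _ _
    exact IsPullback.of_horiz_isIso ⟨by simp⟩
  | succ l hl =>
    obtain rfl : f = homOfLE (Nat.le_add_right n l) ≫ homOfLE (Nat.le_add_right (n + l) 1) :=
      Subsingleton.elim _ _
    rw [Functor.map_comp, Functor.map_comp]
    exact (hl _).paste_horiz (hα _)

/-- Colimits of sequences are filtered, so an equality of simplices in the colimit already holds at
some stage, where the finite-stage pullback squares apply. -/
lemma isPullback_ι_of_sequence {E F : ℕ ⥤ SSet.{u}} (α : E ⟶ F)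
    (hα : ∀ n : ℕ, IsPullback (E.map (homOfLE (Nat.le_add_right n 1))) (α.app n) (α.app (n + 1))
      (F.map (homOfLE (Nat.le_add_right n 1)))) {c : Cocone E} (hc : IsColimit c)
    {d : Cocone F} (hd : IsColimit d) (p : c.pt ⟶ d.pt)
    (hp : ∀ n, c.ι.app n ≫ p = α.app n ≫ d.ι.app n) (n : ℕ) :
    IsPullback (c.ι.app n) (α.app n) p (d.ι.app n) := by
  have hα' {n k : ℕ} (f : n ⟶ k) (m : SimplexCategoryᵒᵖ) :=
    ((isPullback_iff_app _ _ _ _).1 (isPullback_map_of_succ α hα f)).2 m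
  have hα'' {n k : ℕ} (f : n ⟶ k) {m : SimplexCategoryᵒᵖ} (x : (E.obj n).obj m) :
      (α.app k).app m ((E.map f).app m x) = (F.map f).app m ((α.app n).app m x) :=
    ConcreteCategory.congr_hom (NatTrans.congr_app (α.naturality f) m) x
  have hp' (n : ℕ) {m : SimplexCategoryᵒᵖ} (x : (E.obj n).obj m) :
      p.app m ((c.ι.app n).app m x) = (d.ι.app n).app m ((α.app n).app m x) :=
    ConcreteCategory.congr_hom (NatTrans.congr_app (hp n) m) x
  have hc' {n k : ℕ} (f : n ⟶ k) {m : SimplexCategoryᵒᵖ} (x : (E.obj n).obj m) :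
      (c.ι.app k).app m ((E.map f).app m x) = (c.ι.app n).app m x :=
    ConcreteCategory.congr_hom (NatTrans.congr_app (c.w f) m) x
  rw [isPullback_iff_app]
  refine ⟨hp n, fun m ↦ ?_⟩
  have hcm := isColimitOfPreserves ((evaluation _ _).obj m) hc
  have hdm := isColimitOfPreserves ((evaluation _ _).obj m) hd
  refine ⟨fun z z' h h' ↦ ?_, fun x y h ↦ ?_⟩
  · obtain ⟨k, f, h⟩ := (Types.FilteredColimit.isColimit_eq_iff' hcm z z').1 h
    exact (hα' f m).1 z z' h h'
  · obtain ⟨k, x, rfl⟩ := Types.jointly_surjective_of_isColimit hcm x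
    have h := (hp' k x).symm.trans h
    obtain ⟨l, f, g, h⟩ := (Types.FilteredColimit.isColimit_eq_iff _ hdm).1 h
    obtain ⟨z, hz, rfl⟩ := (hα' g m).2 ((E.map f).app m x) y ((hα'' f x).trans h)
    refine ⟨z, ?_, rfl⟩
    rw [← hc' g, hz]
    exact hc' f x

/-- Extend stage by stage and take the colimit of the total spaces. The stages of the base cover its
colimit, and the colimit fibration restricts to each of them correctly. -/
instance : extendsFibrations.{u}.IsStableUnderTransfiniteCompositionOfShape ℕ where
  le A X j := by
    rintro ⟨h⟩
    have hj : MorphismProperty.monomorphisms _ j :=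
      MorphismProperty.transfiniteCompositionsOfShape_le _ ℕ _
      ⟨h.ofLE (W' := MorphismProperty.monomorphisms _) fun _ _ _ h ↦ h.1⟩
    refine ⟨hj, fun E₀ p₀ _ ↦ ?_⟩
    let S (n : ℕ) := Σ' (E : SSet.{u}) (p : E ⟶ h.F.obj n), Fibration p
    have next (n : ℕ) (s : S n) : ∃ (t : S (n + 1)) (e : s.1 ⟶ t.1),
        IsPullback e s.2.1 t.2.1 (h.F.map (homOfLE (Nat.le_add_right n 1))) := by
      obtain ⟨E, p, _⟩ := s
      obtain ⟨E', p', e, hp', sq⟩ := (h.map_mem n (not_isMax n)).2 p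
      exact ⟨⟨E', p', hp'⟩, e, sq⟩
    choose t e sq using next
    have : Fibration (p₀ ≫ h.isoBot.inv) :=
      fibration_of_isPullback (IsPullback.of_horiz_isIso
        (⟨by simp⟩ : CommSq (𝟙 E₀) (p₀ ≫ h.isoBot.inv) p₀ h.isoBot.hom))
    let s (n : ℕ) : S n := Nat.rec ⟨E₀, p₀ ≫ h.isoBot.inv, this⟩ t n
    let E : ℕ ⥤ SSet.{u} := Functor.ofSequence (X := fun n ↦ (s n).1) fun n ↦ e n (s n)
    have hE (n : ℕ) : E.map (homOfLE (Nat.le_add_right n 1)) = e n (s n) :=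
      Functor.ofSequence_map_homOfLE_succ _ _
    let α : E ⟶ h.F := NatTrans.ofSequence (fun n ↦ (s n).2.1) fun n ↦ by
      rw [hE]
      exact (sq n (s n)).w
    let p := IsColimit.map (colimit.isColimit E) (Cocone.mk _ h.incl) α
    have hp (n : ℕ) : colimit.ι E n ≫ p = α.app n ≫ h.incl.app n :=
      (colimit.isColimit E).ι_map _ _ _
    have sq' := isPullback_ι_of_sequence α (fun n ↦ by rw [hE]; exact sq n (s n))
      (colimit.isColimit E) h.isColimit p hp
    refine ⟨_, p, 𝟙 E₀ ≫ colimit.ι E 0, ?_, ?_⟩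
    · refine fibration_of_cover _ _ _ _ sq' (fun n ↦ (s n).2.2) fun n x ↦ ?_
      exact Types.jointly_surjective_of_isColimit
        (isColimitOfPreserves ((evaluation _ _).obj (op ⦋n⦌)) h.isColimit) x
    · have sq₀ : IsPullback (𝟙 E₀) p₀ (α.app 0) h.isoBot.inv :=
        IsPullback.of_horiz_isIso ⟨Category.id_comp _⟩
      exact (congrArg (IsPullback _ p₀ p) h.fac).mp (sq₀.paste_horiz (sq' 0))

end sequences

lemma anodyneExtensions_le_extendsFibrations : anodyneExtensions.{u} ≤ extendsFibrations := by
  rw [SSet.anodyneExtensions_eq_retracts_transfiniteCompositionsOfShape,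
    MorphismProperty.retracts_le_iff]
  refine le_trans (MorphismProperty.transfiniteCompositionsOfShape_monotone ℕ ?_)
    (MorphismProperty.transfiniteCompositionsOfShape_le _ ℕ)
  rw [MorphismProperty.pushouts_le_iff]
  exact MorphismProperty.coproducts_le_iff.2 J_le_extendsFibrations

/-! ### Trivial fibrations and monic weak equivalences in general. -/

/-- A Kan fibration which is a weak equivalence is a trivial fibration. -/
theorem rlp_of_fibration_of_weakEquivalence {E B : SSet.{u}} (p : E ⟶ B) [Fibration p]
    (hp : sSetWeakEquivalences p) : I.rlp p := by
  obtain ⟨B', b, q, hb, hq, -⟩ := exists_factorization_anodyne_fibration (terminal.from B)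
  have : KanComplex B' := (isFibrant_iff_of_isTerminal q terminalIsTerminal).2 hq
  obtain ⟨E', p', e, hp', sq⟩ := (anodyneExtensions_le_extendsFibrations _ hb).2 p
  obtain ⟨T, i, t, _, ht, fac⟩ := exists_factorization_mono_rlp p
  have hi : sSetWeakEquivalences i := by
    rw [← fac] at hp
    exact MorphismProperty.of_postcomp _ _ _ (sSetWeakEquivalences_of_rlp _ ht) hp
  have := hasLiftingProperty_of_kanComplex i hi p'
  have comm : CommSq e i p' (t ≫ b) := ⟨by rw [reassoc_of% fac, sq.w]⟩
  -- The lift lands in the extended fibration over `B'`; its image in `B'` comes from `t`, so the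
  -- pullback property brings it back to `E`, as a retraction of `i` over `B`.
  let r : T ⟶ E := sq.lift comm.lift t comm.fac_right
  have hr : r ≫ p = t := sq.lift_snd _ _ _
  have hir : i ≫ r = 𝟙 E := by
    apply sq.hom_ext
    · simp [r]
    · simp [hr, fac]
  refine MorphismProperty.of_retract (P := I.rlp) (g := t)
    { i := Arrow.homMk i (𝟙 _) (by simp [fac])
      r := Arrow.homMk r (𝟙 _) (by simp [hr])
      retract := ?_ } ht
  ext : 1
  · exact hir
  · simp

/-- A monomorphism which is a weak equivalence is anodyne. -/
theorem anodyneExtensions_of_mono_of_weakEquivalence {A X : SSet.{u}} (j : A ⟶ X) [Mono j]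
    (hj : sSetWeakEquivalences j) : anodyneExtensions j := by
  obtain ⟨Z, i, p, hi, _, rfl⟩ := exists_factorization_anodyne_fibration j
  have := hasLiftingProperty_of_rlp (i ≫ p) (rlp_of_fibration_of_weakEquivalence p
    (MorphismProperty.of_precomp _ _ _ (sSetWeakEquivalences_of_anodyne hi) hj))
  exact MorphismProperty.of_retract (RetractArrow.ofLeftLiftingProperty rfl) hi

/-! ### Spaces of compatible families over a nerve. -/

section sections

variable {J' : Type u} [SmallCategory J']

lemma comp_last_le {l l' m : SimplexCategory} (φ : l' ⟶ l) (θ : l ⟶ m) :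
    (φ ≫ θ).toOrderHom (Fin.last _) ≤ θ.toOrderHom (Fin.last _) :=
  θ.toOrderHom.monotone (Fin.le_last _)

/-- For a chain `c` of length `m` in the indexing category of a diagram `M` of simplicial sets,
a compatible family of simplices in the values of `M` at the last vertices of the faces of `c`. -/
@[ext]
structure CompatibleFamily (M : J' ⥤ SSet.{u}) {m : SimplexCategory}
    (c : Fin (m.len + 1) ⥤ J') where
  val (l : SimplexCategory) (θ : l ⟶ m) :
    (M.obj (c.obj (θ.toOrderHom (Fin.last _)))).obj (op l)
  map_val (l l' : SimplexCategory) (θ : l ⟶ m) (φ : l' ⟶ l) :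
    (M.obj (c.obj (θ.toOrderHom (Fin.last _)))).map φ.op (val l θ) =
      (M.map (c.map (homOfLE (comp_last_le φ θ)))).app (op l') (val l' (φ ≫ θ))

/-- The simplicial set of chains equipped with a compatible family. -/
def familySpace (M : J' ⥤ SSet.{u}) : SSet.{u} where
  obj m := Σ c : Fin (m.unop.len + 1) ⥤ J', CompatibleFamily M c
  map ψ := ↾fun y ↦ ⟨ψ.unop.toOrderHom.monotone.functor ⋙ y.1,
    { val l θ := y.2.val l (θ ≫ ψ.unop)
      map_val l l' θ φ := y.2.map_val l l' (θ ≫ ψ.unop) φ }⟩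
  map_id _ := ConcreteCategory.hom_ext _ _ fun _ ↦ by with_unfolding_all rfl
  map_comp _ _ := ConcreteCategory.hom_ext _ _ fun _ ↦ rfl

/-- The map of spaces of families induced by a natural transformation. -/
def familySpaceMap {M M' : J' ⥤ SSet.{u}} (q : M ⟶ M') : familySpace M ⟶ familySpace M' where
  app m := ↾fun y ↦ ⟨y.1,
    { val l θ := (q.app _).app _ (y.2.val l θ)
      map_val l l' θ φ := by
        rw [← NatTrans.naturality_apply (q.app _), y.2.map_val]
        exact ConcreteCategory.congr_hom (NatTrans.congr_app (q.naturality _) _) _ }⟩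
  naturality _ _ _ := rfl

/-- The simplices of a family whose underlying chain is identified with a given one. -/
def familyEval {M : J' ⥤ SSet.{u}} {m : SimplexCategory} (y : (familySpace M).obj (op m))
    {c : Fin (m.len + 1) ⥤ J'} (h : y.1 = c) (l : SimplexCategory) (θ : l ⟶ m) :
    (M.obj (c.obj (θ.toOrderHom (Fin.last _)))).obj (op l) :=
  (h ▸ y.2 : CompatibleFamily M c).val l θ

lemma map_familyEval {M : J' ⥤ SSet.{u}} {m : SimplexCategory} (y : (familySpace M).obj (op m))
    {c : Fin (m.len + 1) ⥤ J'} (h : y.1 = c) (l l' : SimplexCategory) (θ : l ⟶ m) (φ : l' ⟶ l)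
    (θ' : l' ⟶ m) (hθ' : φ ≫ θ = θ')
    (hle : θ'.toOrderHom (Fin.last _) ≤ θ.toOrderHom (Fin.last _)) :
    (M.obj (c.obj (θ.toOrderHom (Fin.last _)))).map φ.op (familyEval y h l θ) =
      (M.map (c.map (homOfLE hle))).app (op l') (familyEval y h l' θ') := by
  subst h hθ'
  exact y.2.map_val l l' θ φ

lemma familyEval_id_of_eq_map {M : J' ⥤ SSet.{u}} {m m' : SimplexCategory} (ψ : m' ⟶ m)
    (y : (familySpace M).obj (op m)) {c : Fin (m.len + 1) ⥤ J'} (h : y.1 = c)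
    (y' : (familySpace M).obj (op m')) (hy' : y' = (familySpace M).map ψ.op y)
    (h' : y'.1 = ψ.toOrderHom.monotone.functor ⋙ c) :
    familyEval y' h' m' (𝟙 m') = familyEval y h m' ψ := by
  subst hy' h
  with_unfolding_all rfl

lemma familySpaceMap_familyEval {M M' : J' ⥤ SSet.{u}} (q : M ⟶ M') {m : SimplexCategory}
    (y : (familySpace M).obj (op m)) {c : Fin (m.len + 1) ⥤ J'} (h : y.1 = c)
    (y' : (familySpace M').obj (op m)) (hy' : (familySpaceMap q).app _ y = y') (h' : y'.1 = c)
    (l : SimplexCategory) (θ : l ⟶ m) :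
    (q.app _).app _ (familyEval y h l θ) = familyEval y' h' l θ := by
  subst hy' h
  rfl

lemma familySpace_ext {M : J' ⥤ SSet.{u}} {m : SimplexCategory}
    (y y' : (familySpace M).obj (op m)) (h : y.1 = y'.1)
    (h' : ∀ l θ, familyEval y h l θ = y'.2.val l θ) : y = y' := by
  obtain ⟨c, e⟩ := y
  obtain ⟨c', e'⟩ := y'
  obtain rfl : c = c' := h
  refine congrArg (Sigma.mk c) (CompatibleFamily.ext ?_)
  funext l θ
  exact h' l θ

section lifting

variable {M M' : J' ⥤ SSet.{u}} {m : ℕ} (f : (∂Δ[m] : SSet.{u}) ⟶ familySpace M)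
  {c : Fin (m + 1) ⥤ J'}
  (hf : ∀ (k : SimplexCategory) (s : (∂Δ[m] : SSet.{u}).obj (op k)),
    (f.app _ s).1 = (SSet.stdSimplex.objEquiv s.1).toOrderHom.monotone.functor ⋙ c)

/-- The simplex attached by a partially defined family to a face in the boundary. -/
def boundaryVal {k : SimplexCategory} (s : (∂Δ[m] : SSet.{u}).obj (op k)) :
    (M.obj (c.obj ((SSet.stdSimplex.objEquiv s.1).toOrderHom (Fin.last _)))).obj (op k) :=
  familyEval (f.app _ s) (hf k s) k (𝟙 k)

lemma map_boundaryVal {k k' : SimplexCategory} (s : (∂Δ[m] : SSet.{u}).obj (op k)) (φ : k' ⟶ k) :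
    (M.obj (c.obj ((SSet.stdSimplex.objEquiv s.1).toOrderHom (Fin.last _)))).map φ.op
      (boundaryVal f hf s) =
    (M.map (c.map (homOfLE (comp_last_le φ (SSet.stdSimplex.objEquiv s.1))))).app (op k')
      (boundaryVal f hf ((∂Δ[m] : SSet.{u}).map φ.op s)) := by
  have h₂ := familyEval_id_of_eq_map φ (f.app _ s) (hf k s)
    (f.app _ ((∂Δ[m] : SSet.{u}).map φ.op s)) (NatTrans.naturality_apply f φ.op s) (hf k' _)
  refine (map_familyEval (f.app _ s) (hf k s) k k' (𝟙 k) φ φ (Category.comp_id _)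
    (Fin.le_last _)).trans ?_
  exact congrArg _ h₂.symm

lemma chain_map_map_apply {n : ℕ} (M : J' ⥤ SSet.{u}) (c : Fin (n + 1) ⥤ J') {a b d : Fin (n + 1)}
    (f : a ⟶ b) (g : b ⟶ d) (h : a ⟶ d) {k : SimplexCategoryᵒᵖ} (x : (M.obj (c.obj a)).obj k) :
    (M.map (c.map g)).app k ((M.map (c.map f)).app k x) = (M.map (c.map h)).app k x := by
  obtain rfl : h = f ≫ g := Subsingleton.elim _ _
  rw [Functor.map_comp, Functor.map_comp]
  rfl

lemma chain_map_self_apply {n : ℕ} (M : J' ⥤ SSet.{u}) (c : Fin (n + 1) ⥤ J') {a : Fin (n + 1)}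
    (f : a ⟶ a) {k : SimplexCategoryᵒᵖ} (x : (M.obj (c.obj a)).obj k) :
    (M.map (c.map f)).app k x = x := by
  obtain rfl : f = 𝟙 a := Subsingleton.elim _ _
  rw [CategoryTheory.Functor.map_id, CategoryTheory.Functor.map_id]
  rfl

/-- The boundary of the simplex to be found at the last vertex. -/
def boundaryMap : (∂Δ[m] : SSet.{u}) ⟶ M.obj (c.obj (Fin.last _)) where
  app k := ↾fun s ↦ (M.map (c.map (homOfLE (Fin.le_last _)))).app k
    (boundaryVal f hf (k := k.unop) s)
  naturality k k' φ := by
    ext s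
    refine Eq.trans ?_ (NatTrans.naturality_apply (M.map (c.map (homOfLE (Fin.le_last
      ((SSet.stdSimplex.objEquiv s.1).toOrderHom (Fin.last _)))))) φ _)
    refine Eq.trans ?_ (congrArg _ (map_boundaryVal f hf (k := k.unop) s φ.unop).symm)
    exact (chain_map_map_apply M c _ _ _ _).symm

variable (x : (M.obj (c.obj (Fin.last m))).obj (op ⦋m⦌))

/-- This is in fact an equality, but as an inequality it gives a morphism of the chain to transport
along, avoiding casts between objects. -/
lemma last_le_of_surjective {l : SimplexCategory} {θ : l ⟶ ⦋m⦌}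
    (h : Function.Surjective θ.toOrderHom) : Fin.last m ≤ θ.toOrderHom (Fin.last _) := by
  obtain ⟨y, hy⟩ := h (Fin.last m)
  rw [← hy]
  exact θ.toOrderHom.monotone (Fin.le_last _)

open Classical in
/-- The simplices of the family extending `f` by a filler `x`. -/
noncomputable def fillVal (l : SimplexCategory) (θ : l ⟶ ⦋m⦌) :
    (M.obj (c.obj (θ.toOrderHom (Fin.last _)))).obj (op l) :=
  if h : Function.Surjective θ.toOrderHom then
    (M.map (c.map (homOfLE (last_le_of_surjective h)))).app _
      ((M.obj (c.obj (Fin.last m))).map θ.op x)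
  else boundaryVal f hf ⟨SSet.stdSimplex.objEquiv.symm θ, h⟩

lemma fillVal_of_surjective {l : SimplexCategory} {θ : l ⟶ ⦋m⦌}
    (h : Function.Surjective θ.toOrderHom) : fillVal f hf x l θ =
      (M.map (c.map (homOfLE (last_le_of_surjective h)))).app _
        ((M.obj (c.obj (Fin.last m))).map θ.op x) :=
  dif_pos h

lemma fillVal_of_not_surjective {l : SimplexCategory} {θ : l ⟶ ⦋m⦌}
    (h : ¬ Function.Surjective θ.toOrderHom) :
    fillVal f hf x l θ = boundaryVal f hf ⟨SSet.stdSimplex.objEquiv.symm θ, h⟩ :=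
  dif_neg h

/-- The family extending `f` by a filler `x`. -/
noncomputable def fillFamily (hx : ∀ (k : SimplexCategory) (s : (∂Δ[m] : SSet.{u}).obj (op k)),
    (M.obj (c.obj (Fin.last m))).map (SSet.stdSimplex.objEquiv s.1).op x =
      (boundaryMap f hf).app _ s) : CompatibleFamily M (m := ⦋m⦌) c where
  val := fillVal f hf x
  map_val l l' θ φ := by
    by_cases hφ : Function.Surjective (φ ≫ θ).toOrderHom
    · have hθ : Function.Surjective θ.toOrderHom := Function.Surjective.of_comp hφ
      rw [fillVal_of_surjective f hf x hφ, fillVal_of_surjective f hf x hθ,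
        ← NatTrans.naturality_apply, chain_map_map_apply M c _ _ (homOfLE (last_le_of_surjective hθ)),
        ← Functor.map_comp_apply]
      rfl
    · rw [fillVal_of_not_surjective f hf x hφ]
      by_cases hθ : Function.Surjective θ.toOrderHom
      · rw [fillVal_of_surjective f hf x hθ, ← NatTrans.naturality_apply, ← Functor.map_comp_apply]
        have := hx _ ⟨SSet.stdSimplex.objEquiv.symm (φ ≫ θ), hφ⟩
        refine (congrArg _ this).trans ?_
        exact chain_map_map_apply M c _ _ _ _
      · rw [fillVal_of_not_surjective f hf x hθ]
        exact map_boundaryVal f hf ⟨SSet.stdSimplex.objEquiv.symm θ, hθ⟩ φ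

end lifting

/-- A pointwise trivial fibration of diagrams induces a trivial fibration of spaces of families. -/
lemma rlp_familySpaceMap {M M' : J' ⥤ SSet.{u}} (q : M ⟶ M') (hq : ∀ j, I.rlp (q.app j)) :
    I.rlp (familySpaceMap q) := by
  rintro _ _ _ ⟨m⟩
  refine ⟨fun {f g} sq ↦ ?_⟩
  obtain ⟨⟨c, e⟩, rfl⟩ := SSet.yonedaEquiv.symm.surjective g
  have hsq (k : SimplexCategory) (s : (∂Δ[m] : SSet.{u}).obj (op k)) :
      (familySpaceMap q).app _ (f.app _ s) =
        (familySpace M').map (SSet.stdSimplex.objEquiv s.1).op ⟨c, e⟩ :=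
    ConcreteCategory.congr_hom (NatTrans.congr_app sq.w (op k)) s
  have hf (k : SimplexCategory) (s : (∂Δ[m] : SSet.{u}).obj (op k)) :
      (f.app _ s).1 = (SSet.stdSimplex.objEquiv s.1).toOrderHom.monotone.functor ⋙ c :=
    congrArg Sigma.fst (hsq k s)
  have hq' := hq (c.obj (Fin.last _)) _ (SSet.modelCategoryQuillen.boundary_ι_mem_I m)
  have hval (k : SimplexCategory) (s : (∂Δ[m] : SSet.{u}).obj (op k)) :
      (q.app _).app _ (boundaryVal f hf s) = e.val k (SSet.stdSimplex.objEquiv s.1) := by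
    refine (familySpaceMap_familyEval q (f.app _ s) (hf k s) _ (hsq k s) rfl k (𝟙 k)).trans ?_
    exact familyEval_id_of_eq_map (SSet.stdSimplex.objEquiv s.1) ⟨c, e⟩ rfl _ rfl rfl
  have he {k : SimplexCategory} (θ : k ⟶ ⦋m⦌) :
      (M'.obj (c.obj (Fin.last m))).map θ.op (e.val ⦋m⦌ (𝟙 _)) =
        (M'.map (c.map (homOfLE (Fin.le_last _)))).app _ (e.val k θ) :=
    map_familyEval (M := M') (m := ⦋m⦌) ⟨c, e⟩ rfl _ _ _ _ θ (Category.comp_id _) _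
  have hqM {a b : Fin (m + 1)} (φ : a ⟶ b) {k : SimplexCategoryᵒᵖ}
      (z : (M.obj (c.obj a)).obj k) : (q.app _).app _ ((M.map (c.map φ)).app k z) =
        (M'.map (c.map φ)).app k ((q.app _).app _ z) :=
    ConcreteCategory.congr_hom (NatTrans.congr_app (q.naturality (c.map φ)) k) z
  -- Values on non-surjective faces are prescribed by `f`, and values on surjective ones are
  -- degeneracies of the value at the identity. The only unknown is thus one `m`-simplex of `M` at
  -- the last vertex of `c`, with given boundary and given image under `q`.
  have comm : CommSq (boundaryMap f hf) ∂Δ[m].ι (q.app (c.obj (Fin.last _)))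
      (SSet.yonedaEquiv.symm (e.val ⦋m⦌ (𝟙 _))) := ⟨by
    ext k s
    refine (hqM _ _).trans (Eq.trans ?_ (he (SSet.stdSimplex.objEquiv s.1)).symm)
    exact congrArg _ (hval k.unop s)⟩
  obtain ⟨x, hx⟩ := SSet.yonedaEquiv.symm.surjective comm.lift
  have hx₁ : (q.app (c.obj (Fin.last _))).app _ x = e.val ⦋m⦌ (𝟙 _) := by
    have := comm.fac_right
    rw [← hx, SSet.yonedaEquiv_symm_comp] at this
    exact SSet.yonedaEquiv.symm.injective this
  have hx₂ (k : SimplexCategory) (s : (∂Δ[m] : SSet.{u}).obj (op k)) :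
      (M.obj (c.obj (Fin.last m))).map (SSet.stdSimplex.objEquiv s.1).op x =
        (boundaryMap f hf).app _ s := by
    have := comm.fac_left
    rw [← hx] at this
    exact ConcreteCategory.congr_hom (NatTrans.congr_app this (op k)) s
  refine ⟨⟨⟨SSet.yonedaEquiv.symm ⟨c, fillFamily f hf x hx₂⟩, ?_, ?_⟩⟩⟩
  · ext k s
    refine (familySpace_ext (m := k.unop) (f.app k s) _ (hf k.unop s) fun l θ ↦ ?_).symm
    have hs : ¬ Function.Surjective (θ ≫ SSet.stdSimplex.objEquiv s.1).toOrderHom :=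
      fun h ↦ s.2 (Function.Surjective.of_comp h)
    refine Eq.trans ?_ (fillVal_of_not_surjective f hf x hs).symm
    exact (familyEval_id_of_eq_map θ (f.app k s) (hf k.unop s) _
      (NatTrans.naturality_apply f θ.op s) (hf l _)).symm
  · refine (SSet.yonedaEquiv_symm_comp _ _).trans ?_
    refine congrArg _ (congrArg (Sigma.mk c) (CompatibleFamily.ext ?_))
    funext l θ
    change (q.app _).app _ (fillVal f hf x l θ) = _
    by_cases hθ : Function.Surjective θ.toOrderHom
    · rw [fillVal_of_surjective f hf x hθ, hqM, NatTrans.naturality_apply, hx₁, he,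
        chain_map_map_apply M' c _ _ (𝟙 _), chain_map_self_apply]
    · rw [fillVal_of_not_surjective f hf x hθ]
      exact hval l ⟨SSet.stdSimplex.objEquiv.symm θ, hθ⟩

end sections

/-! ### The weight of the homotopy colimit is projectively cofibrant. -/

section weight

variable {I : Type u} [SmallCategory I]

/-- A simplex of `N((i ↓ I)ᵒᵖ)`, given by a chain in `Iᵒᵖ` under `i`. -/
def weightMk {i : I} {m : SimplexCategoryᵒᵖ} (c : Fin (m.unop.len + 1) ⥤ Iᵒᵖ)
    (a : ∀ k, i ⟶ (c.obj k).unop) (ha : ∀ ⦃k l⦄ (h : k ⟶ l), a l ≫ (c.map h).unop = a k) :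
    ((hocolimWeight I).obj (op i)).obj m :=
  show Fin (m.unop.len + 1) ⥤ (Under i)ᵒᵖ from
    { obj k := op (Under.mk (a k))
      map h := (Under.homMk (c.map h).unop (ha h)).op }

/-- The chain underlying a simplex of `N((i ↓ I)ᵒᵖ)`. -/
def weightChain {i : I} {m : SimplexCategoryᵒᵖ} (w : ((hocolimWeight I).obj (op i)).obj m) :
    Fin (m.unop.len + 1) ⥤ Iᵒᵖ :=
  (show Fin (m.unop.len + 1) ⥤ (Under i)ᵒᵖ from w) ⋙ (Under.forget i).op

/-- The structure maps of a simplex of `N((i ↓ I)ᵒᵖ)`. -/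
def weightHom {i : I} {m : SimplexCategoryᵒᵖ} (w : ((hocolimWeight I).obj (op i)).obj m)
    (k : Fin (m.unop.len + 1)) : i ⟶ ((weightChain w).obj k).unop :=
  ((show Fin (m.unop.len + 1) ⥤ (Under i)ᵒᵖ from w).obj k).unop.hom

lemma weightHom_comp {i : I} {m : SimplexCategoryᵒᵖ} (w : ((hocolimWeight I).obj (op i)).obj m)
    {k l : Fin (m.unop.len + 1)} (h : k ⟶ l) :
    weightHom w l ≫ ((weightChain w).map h).unop = weightHom w k :=
  Under.w ((show Fin (m.unop.len + 1) ⥤ (Under i)ᵒᵖ from w).map h).unop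

/-- The simplex of `N((i ↓ I)ᵒᵖ)` given by a chain in `Iᵒᵖ` and a map to its last vertex. -/
def weightOfLast {i : I} {m : SimplexCategoryᵒᵖ} (c : Fin (m.unop.len + 1) ⥤ Iᵒᵖ)
    (f : i ⟶ (c.obj (Fin.last _)).unop) : ((hocolimWeight I).obj (op i)).obj m :=
  weightMk c (fun k ↦ f ≫ (c.map (homOfLE (Fin.le_last k))).unop) (fun k l h ↦ by
    rw [Category.assoc, ← unop_comp, ← Functor.map_comp]
    rfl)

/-- In `I` the last vertex of a chain in `Iᵒᵖ` maps to all the others, so the structure map to it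
determines the rest and can be arbitrary. This is the freeness of the weight. -/
lemma weightOfLast_eq {i : I} {m : SimplexCategoryᵒᵖ}
    (w : ((hocolimWeight I).obj (op i)).obj m) :
    weightOfLast (weightChain w) (weightHom w (Fin.last _)) = w := by
  have h : (fun k ↦ weightHom w (Fin.last _) ≫
      ((weightChain w).map (homOfLE (Fin.le_last k))).unop) = weightHom w :=
    funext fun k ↦ weightHom_comp w _
  have h' (a : ∀ k, i ⟶ ((weightChain w).obj k).unop) (ha) (h : a = weightHom w) :
      weightMk (weightChain w) a ha = w := by
    subst h
    rfl
  exact h' _ _ h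

lemma map_weightOfLast {i : I} {m m' : SimplexCategoryᵒᵖ} (ψ : m ⟶ m')
    (c : Fin (m.unop.len + 1) ⥤ Iᵒᵖ) (f : i ⟶ (c.obj (Fin.last _)).unop) :
    ((hocolimWeight I).obj (op i)).map ψ (weightOfLast c f) =
      weightOfLast (ψ.unop.toOrderHom.monotone.functor ⋙ c)
        (f ≫ (c.map (homOfLE (Fin.le_last _))).unop) :=
  (weightOfLast_eq _).symm

lemma hocolimWeight_map_weightOfLast {i j : I} (g : i ⟶ j) {m : SimplexCategoryᵒᵖ}
    (c : Fin (m.unop.len + 1) ⥤ Iᵒᵖ) (f : j ⟶ (c.obj (Fin.last _)).unop) :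
    ((hocolimWeight I).map g.op).app m (weightOfLast c f) = weightOfLast c (g ≫ f) := by
  refine (weightOfLast_eq _).symm.trans ?_
  refine congrArg (weightOfLast c) ?_
  change g ≫ f ≫ (c.map (𝟙 _)).unop = _
  rw [CategoryTheory.Functor.map_id, unop_id, Category.comp_id]

/-- The family of simplices attached to a natural transformation out of `hocolimWeight I`. -/
def familyOfWeight {M : Iᵒᵖ ⥤ SSet.{u}} (b : hocolimWeight I ⟶ M) : nerve Iᵒᵖ ⟶ familySpace M where
  app m := ↾fun c ↦ ⟨c,
    { val l θ := (b.app (op (unop _))).app (op l)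
        (weightOfLast (m := op l) (θ.toOrderHom.monotone.functor ⋙ c) (𝟙 _))
      map_val l l' θ φ := by
        let c' : Fin (m.unop.len + 1) ⥤ Iᵒᵖ := c
        refine (NatTrans.naturality_apply (b.app (op (unop _))) φ.op _).symm.trans ?_
        refine Eq.trans ?_ (ConcreteCategory.congr_hom (NatTrans.congr_app
          (b.naturality (c'.map (homOfLE (comp_last_le φ θ))).unop.op) (op l')) _)
        refine congrArg ((b.app (op (unop _))).app (op l')) ?_
        refine (map_weightOfLast _ _ _).trans (Eq.trans ?_
          (hocolimWeight_map_weightOfLast _ _ _).symm)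
        exact (congrArg (weightOfLast (m := op l') ((φ ≫ θ).toOrderHom.monotone.functor ⋙ c'))
          ((Category.id_comp _).trans (Category.comp_id _).symm)) }⟩
  naturality _ _ _ := rfl

/-- The functor `i ↦ N((i ↓ I)ᵒᵖ)` is projectively cofibrant. -/
lemma exists_lift_hocolimWeight {M M' : Iᵒᵖ ⥤ SSet.{u}} (q : M ⟶ M')
    (hq : ∀ i, SSet.modelCategoryQuillen.I.rlp (q.app i)) (b : hocolimWeight I ⟶ M') :
    ∃ l : hocolimWeight I ⟶ M, l ≫ q = b := by
  -- Since every simplicial set lifts against trivial fibrations, the family attached to `b` lifts.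
  -- Compatibility of the lifted family is exactly what makes the transformation below simplicial.
  obtain ⟨σ, hσ⟩ : ∃ σ : nerve Iᵒᵖ ⟶ familySpace M, σ ≫ familySpaceMap q = familyOfWeight b := by
    have := hasLiftingProperty_of_rlp (initial.to (nerve Iᵒᵖ)) (rlp_familySpaceMap q hq)
    have sq : CommSq (initial.to _) (initial.to (nerve Iᵒᵖ)) (familySpaceMap q)
      (familyOfWeight b) := ⟨initialIsInitial.hom_ext _ _⟩
    exact ⟨sq.lift, sq.fac_right⟩
  have hσ' {m : SimplexCategoryᵒᵖ} (c : (nerve Iᵒᵖ).obj m) :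
      (familySpaceMap q).app m (σ.app m c) = (familyOfWeight b).app m c :=
    ConcreteCategory.congr_hom (NatTrans.congr_app hσ m) c
  have hσ₁ {m : SimplexCategoryᵒᵖ} (c : (nerve Iᵒᵖ).obj m) : (σ.app m c).1 = c :=
    congrArg Sigma.fst (hσ' c)
  let s {m : SimplexCategoryᵒᵖ} (c : Fin (m.unop.len + 1) ⥤ Iᵒᵖ) :
      (M.obj (c.obj (Fin.last _))).obj m := familyEval (σ.app m c) (hσ₁ c) m.unop (𝟙 _)
  have hs {m m' : SimplexCategoryᵒᵖ} (φ : m ⟶ m') (c : Fin (m.unop.len + 1) ⥤ Iᵒᵖ) :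
      (M.obj (c.obj (Fin.last _))).map φ (s c) = (M.map (c.map (homOfLE (Fin.le_last _)))).app m'
        (s (φ.unop.toOrderHom.monotone.functor ⋙ c)) := by
    refine (map_familyEval (m := m.unop) (σ.app m c) (hσ₁ c) m.unop m'.unop (𝟙 _) φ.unop φ.unop
      (Category.comp_id _) (Fin.le_last _)).trans (congrArg _ ?_)
    exact (familyEval_id_of_eq_map φ.unop (σ.app m c) (hσ₁ c) _ (NatTrans.naturality_apply σ φ c)
      (hσ₁ _)).symm
  have hsq {m : SimplexCategoryᵒᵖ} (c : Fin (m.unop.len + 1) ⥤ Iᵒᵖ) :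
      (q.app _).app m (s c) = (b.app (op (unop _))).app m (weightOfLast c (𝟙 _)) :=
    familySpaceMap_familyEval (m := m.unop) q (σ.app m c) (hσ₁ c) _ (hσ' c) rfl m.unop (𝟙 _)
  -- By freeness, the value on a chain with map `f` to its last vertex must be `M` of `f` applied to
  -- the value `s` at the identity.
  refine ⟨{ app i :=
              { app m := ↾fun w ↦ (M.map (weightHom (i := i.unop) w (Fin.last _)).op).app m
                  (s (weightChain (i := i.unop) w))
                naturality m m' φ := ?_ }
            naturality i j f := ?_ }, ?_⟩
  · ext w
    refine Eq.trans ?_ (NatTrans.naturality_apply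
      (M.map (weightHom (i := i.unop) w (Fin.last _)).op) φ _)
    refine Eq.trans ?_ (congrArg ((M.map (weightHom (i := i.unop) w (Fin.last _)).op).app m')
      (hs φ (weightChain (i := i.unop) w)).symm)
    have := weightHom_comp (i := i.unop) w
      (homOfLE (Fin.le_last (φ.unop.toOrderHom (Fin.last _))))
    have := congrArg (fun f ↦ M.map f.op) this
    rw [op_comp, Quiver.Hom.op_unop, Functor.map_comp] at this
    exact ConcreteCategory.congr_hom (NatTrans.congr_app this.symm m') _
  · ext m w
    exact ConcreteCategory.congr_hom (NatTrans.congr_app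
      (M.map_comp (weightHom (i := i.unop) w (Fin.last _)).op f) m) _
  · ext i m w
    refine (ConcreteCategory.congr_hom (NatTrans.congr_app
      (q.naturality (weightHom (i := i.unop) w (Fin.last _)).op) m) _).trans ?_
    refine (congrArg ((M'.map (weightHom (i := i.unop) w (Fin.last _)).op).app m)
      (hsq (weightChain (i := i.unop) w))).trans ?_
    refine (ConcreteCategory.congr_hom (NatTrans.congr_app
      (b.naturality (weightHom (i := i.unop) w (Fin.last _)).op) m) _).symm.trans ?_
    refine congrArg ((b.app i).app m) ?_
    refine (hocolimWeight_map_weightOfLast _ _ _).trans ?_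
    rw [Category.comp_id]
    exact weightOfLast_eq (i := i.unop) w

end weight

/-! ### Cofibrancy of the homotopy colimit. -/

noncomputable section cofibrant

lemma rlp_ihom_map (X : SSet.{u}) {Z W : SSet.{u}} {p : Z ⟶ W} (hp : I.rlp p) :
    I.rlp ((ihom X).map p) := by
  rw [← SSet.rlp_monomorphisms]
  intro A B i hi
  have : Mono i := hi
  rw [← (ihom.adjunction X).hasLiftingProperty_iff]
  exact hasLiftingProperty_of_rlp (X ◁ i) hp

variable {C : Type u} [SmallCategory C] {K : Type u} [SmallCategory K]
  (P : K ⥤ C × SimplexCategory)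

/-- The diagram of mapping spaces from `rA ⊗ Δ[n]` to a simplicial presheaf. -/
def mappingDiagram (E : U C) : Kᵒᵖ ⥤ SSet.{u} where
  obj i := (ihom (SSet.stdSimplex.obj (P.obj i.unop).2)).obj (E.obj (op (P.obj i.unop).1))
  map f := (MonoidalClosed.pre (SSet.stdSimplex.map (P.map f.unop).2)).app _ ≫
    (ihom _).map (E.map (P.map f.unop).1.op)
  map_id i := by
    have : SSet.stdSimplex.{u}.map (𝟙 (P.obj i.unop).2) = 𝟙 _ := CategoryTheory.Functor.map_id _ _
    simp [this, MonoidalClosed.pre_id]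
  map_comp f g := by
    have : SSet.stdSimplex.{u}.map ((P.map g.unop).2 ≫ (P.map f.unop).2) = _ :=
      CategoryTheory.Functor.map_comp _ _ _
    simp [this, MonoidalClosed.pre_map]

/-- The map of mapping spaces induced by a map of simplicial presheaves. -/
def mappingDiagramMap {E B : U C} (p : E ⟶ B) : mappingDiagram P E ⟶ mappingDiagram P B where
  app i := (ihom _).map (p.app _)
  naturality i j f := by
    dsimp [mappingDiagram]
    simp only [Category.assoc, ← Functor.map_comp, p.naturality]
    simp

lemma curry_mappingDiagram_map {E : U C} {i j : K} (f : i ⟶ j) {L : SSet.{u}}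
    (g : SSet.stdSimplex.obj (P.obj j).2 ⊗ L ⟶ E.obj (op (P.obj j).1)) :
    MonoidalClosed.curry g ≫ (mappingDiagram P E).map f.op =
      MonoidalClosed.curry (SSet.stdSimplex.map (P.map f).2 ▷ L ≫ g ≫ E.map (P.map f).1.op) := by
  dsimp [mappingDiagram]
  rw [MonoidalClosed.curry_pre_app_assoc, ← MonoidalClosed.curry_natural_right, Category.assoc]

/-- A simplex of `(rA ⊗ Δ[n]) ⊗ L`. -/
def tensorSimplex {x : C × SimplexCategory} {L : SSet.{u}} {X : Cᵒᵖ} {m : SimplexCategoryᵒᵖ}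
    (f : X.unop ⟶ x.1) (t : (SSet.stdSimplex.{u}.obj x.2).obj m) (w : L.obj m) :
    (((tensor.obj L).obj (repTensorSimplex.obj x)).obj X).obj m :=
  id (α := ((X.unop ⟶ x.1) × (SSet.stdSimplex.{u}.obj x.2).obj m) × L.obj m) ((f, t), w)

/-- The simplicial map corresponding to a map `(rA ⊗ Δ[n]) ⊗ L ⟶ B` of simplicial presheaves. -/
def evalAtId {x : C × SimplexCategory} {L : SSet.{u}} {B : U C}
    (b : (tensor.obj L).obj (repTensorSimplex.obj x) ⟶ B) :
    SSet.stdSimplex.obj x.2 ⊗ L ⟶ B.obj (op x.1) where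
  app m := ↾fun y ↦ (b.app (op x.1)).app m (tensorSimplex (L := L) (X := op x.1) (𝟙 x.1) y.1 y.2)
  naturality m m' φ := by
    ext y
    exact NatTrans.naturality_apply (b.app (op x.1)) φ (tensorSimplex (L := L) (X := op x.1) (𝟙 x.1) y.1 y.2)

/-- This is the Yoneda lemma for the representable factor: a map out of `(rA ⊗ Δ[n]) ⊗ L` is
determined by its restriction to the identity of `A`. -/
lemma app_tensorSimplex {x : C × SimplexCategory} {L : SSet.{u}} {B : U C}
    (b : (tensor.obj L).obj (repTensorSimplex.obj x) ⟶ B) {X : Cᵒᵖ} {m : SimplexCategoryᵒᵖ}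
    (f : X.unop ⟶ x.1) (t : (SSet.stdSimplex.{u}.obj x.2).obj m) (w : L.obj m) :
    (b.app X).app m (tensorSimplex f t w) = (B.map f.op).app m ((evalAtId b).app m (t, w)) := by
  refine Eq.trans ?_ (ConcreteCategory.congr_hom (NatTrans.congr_app (b.naturality f.op) m)
    (tensorSimplex (L := L) (X := op x.1) (𝟙 x.1) t w))
  refine congrArg ((b.app X).app m) ?_
  change tensorSimplex f t w = tensorSimplex (f ≫ 𝟙 x.1) t w
  rw [Category.comp_id]

/-- The map `(rA ⊗ Δ[n]) ⊗ L ⟶ E` corresponding to a simplicial map. -/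
def ofEvalAtId {x : C × SimplexCategory} {L : SSet.{u}} {E : U C}
    (g : SSet.stdSimplex.obj x.2 ⊗ L ⟶ E.obj (op x.1)) :
    (tensor.obj L).obj (repTensorSimplex.obj x) ⟶ E where
  app X :=
    { app m := ↾fun y ↦ (E.map (show X.unop ⟶ x.1 from y.1.1).op).app m (g.app m (y.1.2, y.2))
      naturality m m' φ := by
        ext y
        refine Eq.trans ?_ (NatTrans.naturality_apply
          (E.map (show X.unop ⟶ x.1 from y.1.1).op) φ _)
        exact congrArg _ (naturality_tensor_apply g φ y.1.2 y.2) }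
  naturality X Y f := by
    ext m y
    exact ConcreteCategory.congr_hom (NatTrans.congr_app
      (E.map_comp (show X.unop ⟶ x.1 from y.1.1).op f) m) (g.app m (y.1.2, y.2))

lemma ofEvalAtId_app {x : C × SimplexCategory} {L : SSet.{u}} {E : U C}
    (g : SSet.stdSimplex.obj x.2 ⊗ L ⟶ E.obj (op x.1)) {X : Cᵒᵖ} {m : SimplexCategoryᵒᵖ}
    (f : X.unop ⟶ x.1) (t : (SSet.stdSimplex.{u}.obj x.2).obj m) (w : L.obj m) :
    ((ofEvalAtId g).app X).app m (tensorSimplex f t w) = (E.map f.op).app m (g.app m (t, w)) :=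
  rfl

lemma hom_ext_tensorSimplex {x : C × SimplexCategory} {L : SSet.{u}} {B : U C}
    {b b' : (tensor.obj L).obj (repTensorSimplex.obj x) ⟶ B} (h : evalAtId b = evalAtId b') :
    b = b' := by
  ext X m y
  refine (app_tensorSimplex b y.1.1 y.1.2 y.2).trans
    (Eq.trans ?_ (app_tensorSimplex b' y.1.1 y.1.2 y.2).symm)
  rw [h]

lemma evalAtId_ofEvalAtId {x : C × SimplexCategory} {L : SSet.{u}} {E : U C}
    (g : SSet.stdSimplex.obj x.2 ⊗ L ⟶ E.obj (op x.1)) : evalAtId (ofEvalAtId g) = g := by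
  ext m y
  refine (ofEvalAtId_app g (X := op x.1) (𝟙 x.1) y.1 y.2).trans ?_
  rw [op_id, CategoryTheory.Functor.map_id]
  rfl

lemma evalAtId_comp {x : C × SimplexCategory} {L : SSet.{u}} {E B : U C}
    (b : (tensor.obj L).obj (repTensorSimplex.obj x) ⟶ E) (p : E ⟶ B) :
    evalAtId (b ≫ p) = evalAtId b ≫ p.app _ := rfl

lemma evalAtId_tensor_map {x : C × SimplexCategory} {L L' : SSet.{u}} (k : L ⟶ L') {B : U C}
    (b : (tensor.obj L').obj (repTensorSimplex.obj x) ⟶ B) :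
    evalAtId ((tensor.map k).app _ ≫ b) = _ ◁ k ≫ evalAtId b := rfl

lemma evalAtId_map_comp {x y : C × SimplexCategory} (f : x ⟶ y) {L : SSet.{u}} {B : U C}
    (b : (tensor.obj L).obj (repTensorSimplex.obj y) ⟶ B) :
    evalAtId ((tensor.obj L).map (repTensorSimplex.map f) ≫ b) =
      SSet.stdSimplex.map f.2 ▷ L ≫ evalAtId b ≫ B.map f.1.op := by
  ext m z
  refine Eq.trans ?_ (app_tensorSimplex b (X := op x.1) f.1
    ((SSet.stdSimplex.map f.2).app m z.1) z.2)
  refine congrArg ((b.app (op x.1)).app m) ?_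
  change tensorSimplex (L := L) (X := op x.1) (𝟙 x.1 ≫ f.1) _ _ = _
  rw [Category.id_comp]
  rfl

/-- Maps out of the homotopy colimit of a diagram of objects `rA ⊗ Δ[n]` lift along pointwise
trivial fibrations. -/
lemma exists_lift_hocolim {E B : U C} (p : E ⟶ B) (hp : ∀ X, I.rlp (p.app X))
    (b : hocolim (P ⋙ repTensorSimplex) ⟶ B) :
    ∃ l : hocolim (P ⋙ repTensorSimplex) ⟶ E, l ≫ p = b := by
  -- The coend condition on `b` is precisely naturality of its transposes, so the problem becomes
  -- lifting out of the weight.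
  let β : hocolimWeight K ⟶ mappingDiagram P B :=
    { app i := MonoidalClosed.curry (evalAtId (x := P.obj i.unop)
        (hocolim.ι (P ⋙ repTensorSimplex) i.unop ≫ b))
      naturality j i f := by
        refine Eq.trans ?_ (curry_mappingDiagram_map P f.unop _).symm
        rw [← evalAtId_map_comp]
        have h := hocolim.condition (P ⋙ repTensorSimplex) f.unop =≫ b
        rw [Category.assoc, Category.assoc] at h
        have h' := congrArg (fun g ↦ MonoidalClosed.curry (evalAtId (x := P.obj i.unop) g)) h
        refine Eq.trans ?_ h'
        refine Eq.trans ?_ (congrArg MonoidalClosed.curry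
          (evalAtId_tensor_map (x := P.obj i.unop) _ _).symm)
        exact (MonoidalClosed.curry_natural_left _ _).symm }
  obtain ⟨l, hl⟩ := exists_lift_hocolimWeight (mappingDiagramMap P p)
    (fun i ↦ rlp_ihom_map _ (hp _)) β
  let φ (i : K) : (tensor.obj ((hocolimWeight K).obj (op i))).obj ((P ⋙ repTensorSimplex).obj i) ⟶
    E := ofEvalAtId (x := P.obj i) (MonoidalClosed.uncurry (l.app (op i)))
  have hφ' (i : K) : MonoidalClosed.curry (evalAtId (x := P.obj i) (φ i)) = l.app (op i) := by
    dsimp only [φ]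
    rw [evalAtId_ofEvalAtId]
    exact MonoidalClosed.curry_uncurry _
  refine ⟨hocolim.desc φ fun i j f ↦ ?_, hocolim.hom_ext fun i ↦ ?_⟩
  · refine hom_ext_tensorSimplex (x := P.obj i) (MonoidalClosed.curry_injective ?_)
    refine Eq.trans ?_ ((l.naturality f.op).trans ?_)
    · refine (congrArg MonoidalClosed.curry (evalAtId_tensor_map (x := P.obj i) _ _)).trans ?_
      rw [MonoidalClosed.curry_natural_left, hφ']
      rfl
    · refine (congrArg (· ≫ (mappingDiagram P E).map f.op) (hφ' j).symm).trans ?_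
      refine (curry_mappingDiagram_map P f _).trans ?_
      exact (congrArg MonoidalClosed.curry (evalAtId_map_comp (P.map f) (φ j))).symm
  · refine (Category.assoc _ _ _).symm.trans ?_
    rw [hocolim.ι_desc]
    refine hom_ext_tensorSimplex (x := P.obj i) (MonoidalClosed.curry_injective ?_)
    refine (congrArg MonoidalClosed.curry (evalAtId_comp (x := P.obj i) (φ i) p)).trans ?_
    rw [MonoidalClosed.curry_natural_right, hφ']
    exact NatTrans.congr_app hl (op i)

lemma isCofibrant_Q (F : U C) : IsCofibrant (Q.obj F) := by
  refine ⟨?_⟩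
  intro E B p hp
  obtain ⟨hp₁, hp₂⟩ := hp
  refine ⟨fun {f g} sq ↦ ?_⟩
  have hp (X : Cᵒᵖ) : I.rlp (p.app X) := by
    have : Fibration (p.app X) := ⟨hp₁ X⟩
    exact rlp_of_fibration_of_weakEquivalence _ (hp₂ X)
  obtain ⟨l, hl⟩ := exists_lift_hocolim (CostructuredArrow.proj repTensorSimplex F) p hp g
  exact ⟨⟨⟨l, initialIsInitial.hom_ext _ _, hl⟩⟩⟩

end cofibrant

/-! ### Pushouts of left adjoints, and relative lifting for natural transformations. -/

section adjoint

variable {C D : Type*} [Category* C] [Category* D]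

lemma homEquiv_app_comp {L₁ L₂ : C ⥤ D} {R₁ R₂ : D ⥤ C} (adj₁ : L₁ ⊣ R₁) (adj₂ : L₂ ⊣ R₂)
    (α : L₂ ⟶ L₁) {X : C} {Z : D} (g : L₁.obj X ⟶ Z) :
    adj₂.homEquiv X Z (α.app X ≫ g) =
      adj₁.homEquiv X Z g ≫ (conjugateEquiv adj₁ adj₂ α).app Z := by
  have h := unit_conjugateEquiv adj₁ adj₂ α X =≫ R₂.map g
  rw [Category.assoc, Category.assoc] at h
  rw [Adjunction.homEquiv_unit, Adjunction.homEquiv_unit, Functor.map_comp, Category.assoc, ← h,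
    NatTrans.naturality]

/-- A pushout of left adjoint functors is a left adjoint. -/
lemma isLeftAdjoint_of_isPushout [HasPullbacks C] {L₀ L₁ L₂ M : C ⥤ D} [L₀.IsLeftAdjoint]
    [L₁.IsLeftAdjoint] [L₂.IsLeftAdjoint] {α : L₀ ⟶ L₁} {β : L₀ ⟶ L₂} {inl : L₁ ⟶ M}
    {inr : L₂ ⟶ M}
    (sq : ∀ X, IsPushout (α.app X) (β.app X) (inl.app X) (inr.app X)) : M.IsLeftAdjoint := by
  let adj₀ := Adjunction.ofIsLeftAdjoint L₀
  let adj₁ := Adjunction.ofIsLeftAdjoint L₁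
  let adj₂ := Adjunction.ofIsLeftAdjoint L₂
  obtain ⟨a, ha⟩ : ∃ a : L₁.rightAdjoint ⟶ L₀.rightAdjoint, ∀ {X : C} {Z : D} (g : L₁.obj X ⟶ Z),
      adj₀.homEquiv X Z (α.app X ≫ g) = adj₁.homEquiv X Z g ≫ a.app Z :=
    ⟨_, homEquiv_app_comp adj₁ adj₀ α⟩
  obtain ⟨b, hb⟩ : ∃ b : L₂.rightAdjoint ⟶ L₀.rightAdjoint, ∀ {X : C} {Z : D} (g : L₂.obj X ⟶ Z),
      adj₀.homEquiv X Z (β.app X ≫ g) = adj₂.homEquiv X Z g ≫ b.app Z :=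
    ⟨_, homEquiv_app_comp adj₂ adj₀ β⟩
  -- The right adjoint is the pullback of the three right adjoints along the mates of `α` and `β`.
  let e (X : C) (Z : D) : (M.obj X ⟶ Z) ≃ (X ⟶ pullback (a.app Z) (b.app Z)) :=
    { toFun g := pullback.lift (adj₁.homEquiv X Z (inl.app X ≫ g))
        (adj₂.homEquiv X Z (inr.app X ≫ g)) (by
          rw [← ha, ← hb, (sq X).w_assoc])
      invFun u := (sq X).desc ((adj₁.homEquiv X Z).symm (u ≫ pullback.fst _ _))
        ((adj₂.homEquiv X Z).symm (u ≫ pullback.snd _ _)) (by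
          apply (adj₀.homEquiv X Z).injective
          rw [ha, hb, Equiv.apply_symm_apply, Equiv.apply_symm_apply, Category.assoc,
            Category.assoc, pullback.condition])
      left_inv g := by
        apply (sq X).hom_ext
        · rw [IsPushout.inl_desc, pullback.lift_fst, Equiv.symm_apply_apply]
        · rw [IsPushout.inr_desc, pullback.lift_snd, Equiv.symm_apply_apply]
      right_inv u := by
        apply pullback.hom_ext
        · rw [pullback.lift_fst, IsPushout.inl_desc, Equiv.apply_symm_apply]
        · rw [pullback.lift_snd, IsPushout.inr_desc, Equiv.apply_symm_apply] }
  exact ⟨_, ⟨Adjunction.adjunctionOfEquivRight e (fun X' X Z f g ↦ by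
    apply pullback.hom_ext
    · dsimp only [e, Equiv.coe_fn_mk]
      rw [Category.assoc, pullback.lift_fst, pullback.lift_fst,
        ← Adjunction.homEquiv_naturality_left, NatTrans.naturality_assoc]
    · dsimp only [e, Equiv.coe_fn_mk]
      rw [Category.assoc, pullback.lift_snd, pullback.lift_snd,
        ← Adjunction.homEquiv_naturality_left, NatTrans.naturality_assoc])⟩⟩

/-- The lifting property of `T Y ⊔_{T A} M A ⟶ M Y` with respect to `p`. -/
def LeibnizLift {T M : C ⥤ D} (i : T ⟶ M) {A Y : C} (f : A ⟶ Y) {Z W : D} (p : Z ⟶ W) : Prop :=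
  ∀ (a : T.obj Y ⟶ Z) (b : M.obj A ⟶ Z) (c : M.obj Y ⟶ W), T.map f ≫ a = i.app A ≫ b →
    i.app Y ≫ c = a ≫ p → M.map f ≫ c = b ≫ p →
      ∃ l : M.obj Y ⟶ Z, i.app Y ≫ l = a ∧ M.map f ≫ l = b ∧ l ≫ p = c

/-- Transposing along both adjunctions turns the corner map in the source into a pullback-corner map
in the target, leaving an ordinary lifting problem for `f`. -/
lemma leibnizLift_iff [HasPullbacks C] {T M : C ⥤ D} {S R : D ⥤ C} (adj : T ⊣ S) (adj' : M ⊣ R)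
    (i : T ⟶ M) {A Y : C} (f : A ⟶ Y) {Z W : D} (p : Z ⟶ W) :
    LeibnizLift i f p ↔ HasLiftingProperty f
      (pullback.lift (f := S.map p) (g := (conjugateEquiv adj' adj i).app W)
        ((conjugateEquiv adj' adj i).app Z) (R.map p) (NatTrans.naturality _ _).symm) := by
  constructor
  · intro h
    refine ⟨fun {u v} sq ↦ ?_⟩
    obtain ⟨b, rfl⟩ := (adj'.homEquiv _ _).surjective u
    obtain ⟨a, ha⟩ := (adj.homEquiv _ _).surjective (v ≫ pullback.fst _ _)
    obtain ⟨c, hc⟩ := (adj'.homEquiv _ _).surjective (v ≫ pullback.snd _ _)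
    have h₁ := sq.w =≫ pullback.fst _ _
    have h₂ := sq.w =≫ pullback.snd _ _
    rw [Category.assoc, Category.assoc, pullback.lift_fst, ← ha, ← homEquiv_app_comp,
      ← Adjunction.homEquiv_naturality_left] at h₁
    rw [Category.assoc, Category.assoc, pullback.lift_snd, ← hc,
      ← Adjunction.homEquiv_naturality_left, ← Adjunction.homEquiv_naturality_right] at h₂
    obtain ⟨l, hl₁, hl₂, hl₃⟩ := h a b c ((adj.homEquiv _ _).injective h₁.symm)
      ((adj.homEquiv _ _).injective (by
        rw [homEquiv_app_comp adj' adj, hc, Adjunction.homEquiv_naturality_right, ha,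
          Category.assoc, Category.assoc, pullback.condition]))
      ((adj'.homEquiv _ _).injective h₂.symm)
    refine ⟨⟨⟨adj'.homEquiv _ _ l, ?_, pullback.hom_ext ?_ ?_⟩⟩⟩
    · rw [← Adjunction.homEquiv_naturality_left, hl₂]
    · rw [Category.assoc, pullback.lift_fst, ← homEquiv_app_comp, hl₁, ha]
    · rw [Category.assoc, pullback.lift_snd, ← Adjunction.homEquiv_naturality_right, hl₃, hc]
  · intro h a b c h₁ h₂ h₃
    have sq : CommSq (adj'.homEquiv _ _ b) f
        (pullback.lift (f := S.map p) (g := (conjugateEquiv adj' adj i).app W)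
        ((conjugateEquiv adj' adj i).app Z) (R.map p) (NatTrans.naturality _ _).symm)
        (pullback.lift (adj.homEquiv _ _ a) (adj'.homEquiv _ _ c) (by
          rw [← homEquiv_app_comp, h₂, Adjunction.homEquiv_naturality_right])) := by
      refine ⟨pullback.hom_ext ?_ ?_⟩
      · rw [Category.assoc, Category.assoc, pullback.lift_fst, pullback.lift_fst,
          ← homEquiv_app_comp, ← h₁, Adjunction.homEquiv_naturality_left]
      · rw [Category.assoc, Category.assoc, pullback.lift_snd, pullback.lift_snd,
          ← Adjunction.homEquiv_naturality_right, ← h₃, Adjunction.homEquiv_naturality_left]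
    refine ⟨(adj'.homEquiv _ _).symm sq.lift, ?_, ?_, ?_⟩
    · apply (adj.homEquiv _ _).injective
      rw [homEquiv_app_comp adj' adj, Equiv.apply_symm_apply]
      have := sq.fac_right =≫ pullback.fst _ _
      rwa [Category.assoc, pullback.lift_fst, pullback.lift_fst] at this
    · apply (adj'.homEquiv _ _).injective
      rw [Adjunction.homEquiv_naturality_left, Equiv.apply_symm_apply, sq.fac_left]
    · apply (adj'.homEquiv _ _).injective
      rw [Adjunction.homEquiv_naturality_right, Equiv.apply_symm_apply]
      have := sq.fac_right =≫ pullback.snd _ _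
      rwa [Category.assoc, pullback.lift_snd, pullback.lift_snd] at this

/-- Being an ordinary lifting property in `f`, the relative one need only be checked on generators.
-/
lemma leibnizLift_of_llp_rlp [HasPullbacks C] {T M : C ⥤ D} [T.IsLeftAdjoint] [M.IsLeftAdjoint]
    (i : T ⟶ M) {Z W : D} (p : Z ⟶ W) (P : MorphismProperty C)
    (hP : ∀ ⦃A Y : C⦄ (f : A ⟶ Y), P f → LeibnizLift i f p) {A Y : C} (f : A ⟶ Y)
    (hf : P.rlp.llp f) : LeibnizLift i f p := by
  rw [leibnizLift_iff (.ofIsLeftAdjoint T) (.ofIsLeftAdjoint M)]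
  refine hf _ fun _ _ g hg ↦ ?_
  rw [← leibnizLift_iff]
  exact hP g hg

end adjoint

/-! ### The functorial mapping cylinder of a transformation to the identity. -/

noncomputable section cylinder

instance (B : SSet.{u}) : IsIso (toTensorPoint B) :=
  ⟨CartesianMonoidalCategory.fst _ _, by simp, by
    apply CartesianMonoidalCategory.hom_ext
    · simp
    · exact SSet.stdSimplex.isTerminalObj₀.hom_ext _ _⟩

lemma anodyneExtensions_ι₁ (B : SSet.{u}) : anodyneExtensions (ι₁ : B ⟶ B ⊗ Δ[1]) := by
  have : Mono (ι₁ : B ⟶ B ⊗ Δ[1]) :=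
    mono_of_mono_fac (show ι₁ ≫ CartesianMonoidalCategory.fst B Δ[1] = 𝟙 B from rfl)
  refine anodyneExtensions_of_mono_of_weakEquivalence _ ?_
  have h : (ι₁ : B ⟶ B ⊗ Δ[1]) = toTensorPoint B ≫ B ◁ SSet.stdSimplex.δ (0 : Fin 2) := by
    rw [whiskerLeft_δ_zero, toTensorPoint_fst_assoc]
  rw [h]
  exact MorphismProperty.comp_mem _ _ _ (sSetWeakEquivalences_of_isIso _)
    (sSetWeakEquivalences_whiskerLeft _ (sSetWeakEquivalences_of_anodyne (anodyneExtensions_δ 0)))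

variable {T : SSet.{u} ⥤ SSet.{u}} (π : T ⟶ 𝟭 SSet.{u})

variable (T) in
/-- The inclusion of the end `0` of the cylinder. -/
def cylinderZero : T ⟶ T ⋙ tensorRight Δ[1] where
  app Y := ι₀

variable (T) in
/-- The inclusion of the end `1` of the cylinder. -/
def cylinderOne : T ⟶ T ⋙ tensorRight Δ[1] where
  app Y := ι₁

/-- The mapping cylinder of a natural transformation `π : T ⟶ 𝟭`. -/
def mappingCylinder : SSet.{u} ⥤ SSet.{u} := pushout (cylinderOne T) π

/-- The map from the cylinder to the mapping cylinder. -/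
def cylinderToMappingCylinder : T ⋙ tensorRight Δ[1] ⟶ mappingCylinder π :=
  pushout.inl (cylinderOne T) π

/-- The inclusion of the target in the mapping cylinder. -/
def targetToMappingCylinder : 𝟭 _ ⟶ mappingCylinder π := pushout.inr (cylinderOne T) π

/-- The inclusion of the source in the mapping cylinder. -/
def sourceToMappingCylinder : T ⟶ mappingCylinder π :=
  cylinderZero T ≫ cylinderToMappingCylinder π

lemma isPushout_mappingCylinder (Y : SSet.{u}) :
    IsPushout (ι₁ : T.obj Y ⟶ T.obj Y ⊗ Δ[1]) (π.app Y) ((cylinderToMappingCylinder π).app Y)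
      ((targetToMappingCylinder π).app Y) :=
  (IsPushout.of_hasPushout (cylinderOne T) π).app Y

lemma isPushout_mappingCylinder_app (Y : SSet.{u}) (m : SimplexCategoryᵒᵖ) :
    IsPushout ((ι₁ : T.obj Y ⟶ T.obj Y ⊗ Δ[1]).app m) ((π.app Y).app m)
      (((cylinderToMappingCylinder π).app Y).app m) (((targetToMappingCylinder π).app Y).app m) :=
  (isPushout_mappingCylinder π Y).app m

instance [T.IsLeftAdjoint] : (mappingCylinder π).IsLeftAdjoint :=
  isLeftAdjoint_of_isPushout (α := cylinderOne T) (β := π) (isPushout_mappingCylinder π)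

/-- Collapsing the cylinder is a weak equivalence because it retracts the inclusion of the target,
which is a pushout of the anodyne end `ι₁`. -/
lemma exists_mappingCylinder_retraction (Y : SSet.{u}) :
    ∃ q : (mappingCylinder π).obj Y ⟶ Y, (sourceToMappingCylinder π).app Y ≫ q = π.app Y ∧
      sSetWeakEquivalences q := by
  let q : (mappingCylinder π).obj Y ⟶ Y := (isPushout_mappingCylinder π Y).desc
    (CartesianMonoidalCategory.fst _ _ ≫ π.app Y) (𝟙 Y) (Category.comp_id (π.app Y)).symm
  refine ⟨q, ?_, ?_⟩
  · have h : (cylinderToMappingCylinder π).app Y ≫ q = CartesianMonoidalCategory.fst _ _ ≫ π.app Y :=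
      (isPushout_mappingCylinder π Y).inl_desc _ _ _
    exact congrArg (ι₀ ≫ ·) h
  · have h : anodyneExtensions ((targetToMappingCylinder π).app Y) :=
      MorphismProperty.of_isPushout (P := anodyneExtensions)
        (isPushout_mappingCylinder π Y).flip (anodyneExtensions_ι₁ _)
    refine MorphismProperty.of_precomp _ _ q (sSetWeakEquivalences_of_anodyne h) ?_
    rw [show (targetToMappingCylinder π).app Y ≫ q = 𝟙 Y from
      (isPushout_mappingCylinder π Y).inr_desc _ _ _]
    exact sSetWeakEquivalences_of_isIso (𝟙 Y)

/-- This replaces `π` by an inclusion, for which being a weak equivalence can be studied through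
lifting properties. -/
lemma weakEquivalence_source_iff (Y : SSet.{u}) :
    sSetWeakEquivalences ((sourceToMappingCylinder π).app Y) ↔
      sSetWeakEquivalences (π.app Y) := by
  obtain ⟨q, hq, hq'⟩ := exists_mappingCylinder_retraction π Y
  rw [← hq]
  exact ⟨fun h ↦ MorphismProperty.comp_mem _ _ _ h hq',
    fun h ↦ MorphismProperty.of_postcomp _ _ _ hq' h⟩

lemma notMem_range_ι₁ {X : SSet.{u}} {m : SimplexCategoryᵒᵖ} (x : X.obj m) :
    (ι₀ : X ⟶ X ⊗ Δ[1]).app m x ∉ Set.range ((ι₁ : X ⟶ X ⊗ Δ[1]).app m) := by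
  rintro ⟨x', hx'⟩
  have h : ((ι₁ : X ⟶ X ⊗ Δ[1]).app m x').2 = ((ι₀ : X ⟶ X ⊗ Δ[1]).app m x).2 :=
    congrArg Prod.snd hx'
  have h' := DFunLike.congr_fun (congrArg SSet.stdSimplex.asOrderHom h) 0
  exact absurd h' (show ¬ (1 : Fin 2) = 0 by decide)

lemma mem_range_ι₁_of_whiskerRight {X Y : SSet.{u}} (f : X ⟶ Y) {m : SimplexCategoryᵒᵖ}
    (z : (X ⊗ Δ[1]).obj m) (hz : (f ▷ Δ[1]).app m z ∈ Set.range ((ι₁ : Y ⟶ Y ⊗ Δ[1]).app m)) :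
    z ∈ Set.range ((ι₁ : X ⟶ X ⊗ Δ[1]).app m) := by
  obtain ⟨y, hy⟩ := hz
  have h : ((ι₁ : Y ⟶ Y ⊗ Δ[1]).app m y).2 = z.2 := congrArg Prod.snd hy
  exact ⟨z.1, Prod.ext rfl h⟩

variable {π} in
lemma eq_of_cylinderToMappingCylinder_app_eq {Y : SSet.{u}} {m : SimplexCategoryᵒᵖ}
    {z z' : (T.obj Y ⊗ Δ[1]).obj m} (hz : z ∉ Set.range ((ι₁ : T.obj Y ⟶ _).app m))
    (h : ((cylinderToMappingCylinder π).app Y).app m z =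
      ((cylinderToMappingCylinder π).app Y).app m z') : z = z' := by
  classical
  -- Collapsing the glued end to `none` extends to the whole pushout, and still separates all
  -- simplices away from that end.
  let k : (T.obj Y ⊗ Δ[1]).obj m ⟶ Option ((T.obj Y ⊗ Δ[1]).obj m) :=
    ↾fun z ↦ if z ∈ Set.range ((ι₁ : T.obj Y ⟶ _).app m) then none else some z
  let d := (isPushout_mappingCylinder_app π Y m).desc k (↾fun _ ↦ none) (ConcreteCategory.hom_ext _ _ fun x ↦
      if_pos (Set.mem_range_self x))
  have hd (z) : d (((cylinderToMappingCylinder π).app Y).app m z) = k z :=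
    ConcreteCategory.congr_hom ((isPushout_mappingCylinder_app π Y m).inl_desc k _ _) z
  have h₁ : k z = k z' := by rw [← hd, ← hd, h]
  have h₂ : k z = some z := if_neg hz
  rw [h₂] at h₁
  by_cases hz' : z' ∈ Set.range ((ι₁ : T.obj Y ⟶ _).app m)
  · exact absurd (h₁.trans (if_pos hz')) (by simp)
  · exact Option.some_injective _ (h₁.trans (if_neg hz'))

lemma injective_ι₁_app (X : SSet.{u}) (m : SimplexCategoryᵒᵖ) :
    Function.Injective ((ι₁ : X ⟶ X ⊗ Δ[1]).app m) :=
  fun _ _ h ↦ congrArg Prod.fst h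

variable {π} in
lemma mem_range_ι₁_of_eq_target {Y : SSet.{u}} {m : SimplexCategoryᵒᵖ}
    {z : (T.obj Y ⊗ Δ[1]).obj m} {y : Y.obj m}
    (h : ((cylinderToMappingCylinder π).app Y).app m z =
      ((targetToMappingCylinder π).app Y).app m y) :
    z ∈ Set.range ((ι₁ : T.obj Y ⟶ _).app m) := by
  obtain ⟨x, hx, -⟩ := Types.exists_of_isPullback (Types.isPullback_of_isPushout
    (isPushout_mappingCylinder_app π Y m) (injective_ι₁_app _ m)) z y h
  exact ⟨x, hx⟩

lemma injective_target_app (Y : SSet.{u}) (m : SimplexCategoryᵒᵖ) :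
    Function.Injective (((targetToMappingCylinder π).app Y).app m) :=
  Types.pushoutCocone_inr_injective_of_isColimit
    (isPushout_mappingCylinder_app π Y m).isColimit (injective_ι₁_app _ m)

lemma mappingCylinder_cases {Y : SSet.{u}} {m : SimplexCategoryᵒᵖ}
    (x : ((mappingCylinder π).obj Y).obj m) :
    (∃ y, ((targetToMappingCylinder π).app Y).app m y = x) ∨
      ∃ z, ((cylinderToMappingCylinder π).app Y).app m z = x ∧
        z ∉ Set.range ((ι₁ : T.obj Y ⟶ _).app m) :=
  Types.eq_or_eq_of_isPushout' (isPushout_mappingCylinder_app π Y m).flip x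

lemma mappingCylinder_map_target {A Y : SSet.{u}} (f : A ⟶ Y) {m : SimplexCategoryᵒᵖ}
    (a : A.obj m) : ((mappingCylinder π).map f).app m (((targetToMappingCylinder π).app A).app m a) =
      ((targetToMappingCylinder π).app Y).app m (f.app m a) :=
  (ConcreteCategory.congr_hom (NatTrans.congr_app ((targetToMappingCylinder π).naturality f) m)
    a).symm

lemma mappingCylinder_map_cylinder {A Y : SSet.{u}} (f : A ⟶ Y) {m : SimplexCategoryᵒᵖ}
    (z : (T.obj A ⊗ Δ[1]).obj m) :
    ((mappingCylinder π).map f).app m (((cylinderToMappingCylinder π).app A).app m z) =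
      ((cylinderToMappingCylinder π).app Y).app m ((T.map f ▷ Δ[1]).app m z) :=
  (ConcreteCategory.congr_hom (NatTrans.congr_app ((cylinderToMappingCylinder π).naturality f) m)
    z).symm

variable [T.PreservesMonomorphisms]

lemma injective_map_whiskerRight {A Y : SSet.{u}} (f : A ⟶ Y) [Mono f] (m : SimplexCategoryᵒᵖ) :
    Function.Injective ((T.map f ▷ Δ[1]).app m) := by
  have : Mono ((T.map f ▷ Δ[1]).app m) := inferInstance
  exact (mono_iff_injective _).1 this

lemma injective_mappingCylinder_map {A Y : SSet.{u}} (f : A ⟶ Y) [Mono f]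
    (m : SimplexCategoryᵒᵖ) : Function.Injective (((mappingCylinder π).map f).app m) := by
  have hf : Function.Injective (f.app m) := (mono_iff_injective _).1 inferInstance
  intro x x' h
  obtain ⟨a, rfl⟩ | ⟨z, rfl, hz⟩ := mappingCylinder_cases π x <;>
  obtain ⟨a', rfl⟩ | ⟨z', rfl, hz'⟩ := mappingCylinder_cases π x'
  · rw [mappingCylinder_map_target, mappingCylinder_map_target] at h
    rw [hf (injective_target_app π Y m h)]
  · rw [mappingCylinder_map_target, mappingCylinder_map_cylinder] at h
    exact absurd (mem_range_ι₁_of_whiskerRight _ _ (mem_range_ι₁_of_eq_target h.symm)) hz'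
  · rw [mappingCylinder_map_target, mappingCylinder_map_cylinder] at h
    exact absurd (mem_range_ι₁_of_whiskerRight _ _ (mem_range_ι₁_of_eq_target h)) hz
  · rw [mappingCylinder_map_cylinder, mappingCylinder_map_cylinder] at h
    rw [injective_map_whiskerRight f m (eq_of_cylinderToMappingCylinder_app_eq
      (fun hz' ↦ hz (mem_range_ι₁_of_whiskerRight _ _ hz')) h)]

/-- The source sits at the end 0, away from the gluing, so it meets the mapping cylinder of `A` only
in `T.obj A`. This makes the corner map below monic. -/
lemma isPullback_sourceToMappingCylinder_app {A Y : SSet.{u}} (f : A ⟶ Y) [Mono f]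
    (m : SimplexCategoryᵒᵖ) :
    IsPullback (((sourceToMappingCylinder π).app A).app m) ((T.map f).app m)
      (((mappingCylinder π).map f).app m) (((sourceToMappingCylinder π).app Y).app m) := by
  rw [Types.isPullback_iff]
  have hf : Function.Injective ((T.map f).app m) := (mono_iff_injective _).1 inferInstance
  refine ⟨(NatTrans.congr_app ((sourceToMappingCylinder π).naturality f) m).symm,
    fun x x' h ↦ hf h.2, fun b x h ↦ ?_⟩
  change _ = ((cylinderToMappingCylinder π).app Y).app m (ι₀.app m x) at h
  obtain ⟨a, rfl⟩ | ⟨z, rfl, hz⟩ := mappingCylinder_cases π b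
  · rw [mappingCylinder_map_target] at h
    exact absurd (mem_range_ι₁_of_eq_target h.symm) (notMem_range_ι₁ _)
  · rw [mappingCylinder_map_cylinder] at h
    have h' := eq_of_cylinderToMappingCylinder_app_eq
      (fun hz' ↦ hz (mem_range_ι₁_of_whiskerRight _ _ hz')) h
    refine ⟨z.1, ?_, congrArg Prod.fst h'⟩
    exact congrArg (((cylinderToMappingCylinder π).app A).app m)
      (Prod.ext rfl (congrArg Prod.snd h').symm)

end cylinder

/-! ### Cell induction from standard simplices to all simplicial sets. -/

noncomputable section cylinder

lemma mono_desc_of_isPullback_app {A B X Y : SSet.{u}} {t : A ⟶ B} {l : A ⟶ X} {r : B ⟶ Y}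
    {b : X ⟶ Y} (sq : ∀ m, IsPullback (t.app m) (l.app m) (r.app m) (b.app m)) (w : t ≫ r = l ≫ b)
    [Mono r] [Mono b] : Mono (pushout.desc r b w) := by
  have (m : SimplexCategoryᵒᵖ) : Mono ((pushout.desc r b w).app m) :=
    Types.mono_of_isPushout_of_isPullback ((IsPushout.of_hasPushout t l).app m) (sq m)
      (NatTrans.congr_app (pushout.inl_desc r b w) m)
      (NatTrans.congr_app (pushout.inr_desc r b w) m)
      (fun _ _ _ _ h ↦ (mono_iff_injective (b.app m)).1 inferInstance h)
  exact NatTrans.mono_of_mono_app _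

/-- The boundary inclusions `∂Δ[k] ⟶ Δ[k]` for `k < n`. -/
def boundaryInclusionsLT (n : ℕ) : MorphismProperty SSet.{u} :=
  MorphismProperty.ofHoms fun k : Fin n ↦ (SSet.boundary.{u} k).ι

/-- All cells attached to build `Y` from `A` come from nondegenerate simplices of `Y`, which have
dimension below `n`. -/
lemma llp_rlp_boundaryInclusionsLT (n : ℕ) {A Y : SSet.{u}} (f : A ⟶ Y) [Mono f]
    [Y.HasDimensionLT n] : (boundaryInclusionsLT n).rlp.llp f := by
  refine MorphismProperty.transfiniteCompositionsOfShape_pushouts_coproducts_le_llp_rlp.{u} _ ℕ f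
    ⟨(SSet.relativeCellComplexOfMono f).transfiniteCompositionOfShape' fun s ↦ ?_⟩
  exact ⟨(⟨s.j, Y.dim_lt_of_nonDegenerate ⟨_, s.k.nonDegenerate⟩ n⟩ : Fin n)⟩

variable {T : SSet.{u} ⥤ SSet.{u}} (π : T ⟶ 𝟭 SSet.{u})

lemma anodyneExtensions_of_leibnizLift [T.IsLeftAdjoint] {Y : SSet.{u}}
    (h : ∀ ⦃Z W : SSet.{u}⦄ (p : Z ⟶ W) [Fibration p],
      LeibnizLift (sourceToMappingCylinder π) (initial.to Y) p) :
    anodyneExtensions ((sourceToMappingCylinder π).app Y) := by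
  intro Z W p hp
  have : Fibration p := ⟨hp⟩
  refine ⟨fun {a c} sq ↦ ?_⟩
  have h₁ : IsInitial (T.obj (⊥_ SSet.{u})) := initialIsInitial.isInitialObj T
  have h₂ : IsInitial ((mappingCylinder π).obj (⊥_ SSet.{u})) :=
    initialIsInitial.isInitialObj (mappingCylinder π)
  obtain ⟨l, hl₁, -, hl₂⟩ := h p a (h₂.to _) c (h₁.hom_ext _ _) sq.w.symm (h₂.hom_ext _ _)
  exact ⟨⟨⟨l, hl₁, hl₂⟩⟩⟩

variable [T.PreservesMonomorphisms]

instance (Y : SSet.{u}) : Mono ((sourceToMappingCylinder π).app Y) := by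
  have (m : SimplexCategoryᵒᵖ) : Mono (((sourceToMappingCylinder π).app Y).app m) := by
    rw [mono_iff_injective]
    intro x x' h
    exact congrArg Prod.fst (eq_of_cylinderToMappingCylinder_app_eq (notMem_range_ι₁ x) h)
  exact NatTrans.mono_of_mono_app _

instance : (mappingCylinder π).PreservesMonomorphisms where
  preserves f hf := by
    have (m : SimplexCategoryᵒᵖ) : Mono (((mappingCylinder π).map f).app m) :=
      (mono_iff_injective _).2 (injective_mappingCylinder_map π f m)
    exact NatTrans.mono_of_mono_app _

/-- The corner map from the pushout of `T Y` and the cylinder of `A` to the cylinder of `Y` is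
monic. The inclusion of `T Y` into that pushout is anodyne by `hA`, and its inclusion into the
cylinder of `Y` is a weak equivalence by `hY`. Two-out-of-three then makes the corner map anodyne.
-/
lemma leibnizLift_of_weakEquivalence {A Y : SSet.{u}} (f : A ⟶ Y) [Mono f]
    (hA : anodyneExtensions ((sourceToMappingCylinder π).app A))
    (hY : sSetWeakEquivalences (π.app Y)) {Z W : SSet.{u}} (p : Z ⟶ W) [hp : Fibration p] :
    LeibnizLift (sourceToMappingCylinder π) f p := by
  intro a b c h₁ h₂ h₃
  let k := pushout.desc ((mappingCylinder π).map f) ((sourceToMappingCylinder π).app Y)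
    ((sourceToMappingCylinder π).naturality f).symm
  have : Mono k := mono_desc_of_isPullback_app (isPullback_sourceToMappingCylinder_app π f) _
  have h₀ : anodyneExtensions (pushout.inr ((sourceToMappingCylinder π).app A) (T.map f)) :=
    MorphismProperty.of_isPushout (IsPushout.of_hasPushout _ _).flip hA
  have hk : anodyneExtensions k := by
    refine anodyneExtensions_of_mono_of_weakEquivalence k
      (MorphismProperty.of_precomp _ _ _ (sSetWeakEquivalences_of_anodyne h₀) ?_)
    rw [pushout.inr_desc, weakEquivalence_source_iff]
    exact hY
  have := hk p hp.mem
  have sq : CommSq (pushout.desc b a h₁.symm) k p c := by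
    refine ⟨pushout.hom_ext ?_ ?_⟩
    · rw [pushout.inl_desc_assoc, pushout.inl_desc_assoc, h₃]
    · rw [pushout.inr_desc_assoc, pushout.inr_desc_assoc, h₂]
  refine ⟨sq.lift, ?_, ?_, sq.fac_right⟩
  · have := pushout.inr _ _ ≫= sq.fac_left
    rwa [pushout.inr_desc_assoc, pushout.inr_desc] at this
  · have := pushout.inl _ _ ≫= sq.fac_left
    rwa [pushout.inl_desc_assoc, pushout.inl_desc] at this

variable [T.IsLeftAdjoint]

/-- Strong induction: ∂Δ[n] is built from cells of dimension less than `n`, and each such cell needs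
only the case of its own boundary and of its simplex. -/
lemma anodyneExtensions_source_boundary (hπ : ∀ n : ℕ, sSetWeakEquivalences (π.app Δ[n])) (n : ℕ) :
    anodyneExtensions ((sourceToMappingCylinder π).app (SSet.boundary.{u} n)) := by
  induction n using Nat.strong_induction_on with
  | _ n hn =>
    refine anodyneExtensions_of_leibnizLift π fun Z W p _ ↦ ?_
    refine leibnizLift_of_llp_rlp (sourceToMappingCylinder π) p (boundaryInclusionsLT n) ?_ _
      (llp_rlp_boundaryInclusionsLT n (initial.to (SSet.boundary n : SSet.{u})))
    rintro _ _ _ ⟨k⟩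
    exact leibnizLift_of_weakEquivalence π _ (hn k k.2) (hπ k) p

/-- A natural transformation to the identity from a left adjoint preserving monomorphisms is a
weak equivalence if it is one on simplices. -/
theorem weakEquivalence_of_stdSimplex (hπ : ∀ n : ℕ, sSetWeakEquivalences (π.app Δ[n]))
    (Y : SSet.{u}) : sSetWeakEquivalences (π.app Y) := by
  rw [← weakEquivalence_source_iff]
  refine sSetWeakEquivalences_of_anodyne (anodyneExtensions_of_leibnizLift π fun Z W p _ ↦ ?_)
  refine leibnizLift_of_llp_rlp (sourceToMappingCylinder π) p I ?_ _ ?_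
  · rintro _ _ _ ⟨n⟩
    exact leibnizLift_of_weakEquivalence π _ (anodyneExtensions_source_boundary π hπ n) (hπ n) p
  · intro Z W q hq
    exact hasLiftingProperty_of_rlp _ hq

end cylinder

/-! ### The simplicial replacement as a left adjoint functor. -/

section replacement

/-- The restriction of a chain along a map of simplices. -/
def restrictChain {E : Type*} [Category* E] {m m' : SimplexCategoryᵒᵖ} (φ : m ⟶ m')
    (c : Fin (m.unop.len + 1) ⥤ E) : Fin (m'.unop.len + 1) ⥤ E :=
  φ.unop.toOrderHom.monotone.functor ⋙ c

/-- The map from the last vertex of a restricted chain to the last vertex of the chain. -/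
def restrictChainLast {E : Type*} [Category* E] {m m' : SimplexCategoryᵒᵖ} (φ : m ⟶ m')
    (c : Fin (m.unop.len + 1) ⥤ E) :
    (restrictChain φ c).obj (Fin.last _) ⟶ c.obj (Fin.last _) :=
  c.map (homOfLE (Fin.le_last _))

/-- The map from the first vertex of a chain to the first vertex of a restricted chain. -/
def restrictChainZero {E : Type*} [Category* E] {m m' : SimplexCategoryᵒᵖ} (φ : m ⟶ m')
    (c : Fin (m.unop.len + 1) ⥤ E) : c.obj 0 ⟶ (restrictChain φ c).obj 0 :=
  c.map (homOfLE (Fin.zero_le _))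

section

variable {E : Type*} [Category* E] {m m' m'' : SimplexCategoryᵒᵖ} (c : Fin (m.unop.len + 1) ⥤ E)

lemma restrictChainLast_id : restrictChainLast (𝟙 m) c = 𝟙 (c.obj (Fin.last _)) :=
  c.map_id _

lemma restrictChainZero_id : restrictChainZero (𝟙 m) c = 𝟙 (c.obj 0) :=
  c.map_id _

lemma restrictChainLast_comp (φ : m ⟶ m') (ψ : m' ⟶ m'') :
    restrictChainLast (φ ≫ ψ) c =
      restrictChainLast ψ (restrictChain φ c) ≫ restrictChainLast φ c :=
  c.map_comp (homOfLE _) (homOfLE _)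

lemma restrictChainZero_comp (φ : m ⟶ m') (ψ : m' ⟶ m'') :
    restrictChainZero (φ ≫ ψ) c =
      restrictChainZero φ c ≫ restrictChainZero ψ (restrictChain φ c) :=
  c.map_comp (homOfLE _) (homOfLE _)

end

section

variable {E : Type*} [Category* E] (p : E ⥤ SimplexCategoryᵒᵖ) {m m' m'' : SimplexCategoryᵒᵖ}
  (c : Fin (m.unop.len + 1) ⥤ E) (s : p.obj (c.obj (Fin.last _)) ⟶ m)

lemma map_restrictChainLast_id : p.map (restrictChainLast (𝟙 m) c) ≫ s ≫ 𝟙 m = s :=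
  (congrArg (p.map · ≫ s ≫ 𝟙 m) (restrictChainLast_id c)).trans
    ((congrArg (· ≫ s ≫ 𝟙 m) (p.map_id _)).trans
      ((Category.id_comp _).trans (Category.comp_id _)))

lemma map_restrictChainLast_comp (φ : m ⟶ m') (ψ : m' ⟶ m'') :
    p.map (restrictChainLast (φ ≫ ψ) c) ≫ s ≫ φ ≫ ψ =
      p.map (restrictChainLast ψ (restrictChain φ c)) ≫
        (p.map (restrictChainLast φ c) ≫ s ≫ φ) ≫ ψ := by
  refine (congrArg (p.map · ≫ s ≫ φ ≫ ψ) (restrictChainLast_comp c φ ψ)).trans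
    ((congrArg (· ≫ s ≫ φ ≫ ψ) (p.map_comp _ _)).trans ?_)
  simp only [Category.assoc]
  rfl

end

/-- The simplices of the simplicial replacement of a diagram of simplices. -/
structure BarSimplex {E : Type u} [SmallCategory E] (p : E ⥤ SimplexCategoryᵒᵖ)
    (m : SimplexCategoryᵒᵖ) where
  /-- the chain of indices -/
  chain : Fin (m.unop.len + 1) ⥤ E
  /-- the simplex of the value of the diagram -/
  hom : p.obj (chain.obj (Fin.last _)) ⟶ m

/-- The simplicial replacement of the diagram of simplices attached to `p : E ⥤ Δᵒᵖ`. -/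
def bar {E : Type u} [SmallCategory E] (p : E ⥤ SimplexCategoryᵒᵖ) : SSet.{u} where
  obj m := BarSimplex p m
  map φ := ↾fun x ↦ ⟨restrictChain φ x.chain, p.map (restrictChainLast φ x.chain) ≫ x.hom ≫ φ⟩
  map_id _ := ConcreteCategory.hom_ext _ _ fun x ↦
    congrArg (BarSimplex.mk x.chain) (map_restrictChainLast_id p x.chain x.hom)
  map_comp φ ψ := ConcreteCategory.hom_ext _ _ fun x ↦
    congrArg (BarSimplex.mk (restrictChain (φ ≫ ψ) x.chain))
      (map_restrictChainLast_comp p x.chain x.hom φ ψ)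

/-- The simplices of the simplicial replacement of a simplicial set. -/
structure ReplacementSimplex (Y : SSet.{u}) (m : SimplexCategoryᵒᵖ) where
  /-- the chain of dimensions -/
  chain : Fin (m.unop.len + 1) ⥤ SimplexCategoryᵒᵖ
  /-- the simplex of the last standard simplex -/
  hom : chain.obj (Fin.last _) ⟶ m
  /-- the simplex determining the chain of simplices -/
  simplex : Y.obj (chain.obj 0)

/-- The simplicial replacement of the diagram of simplices of a simplicial set. -/
def replacement (Y : SSet.{u}) : SSet.{u} where
  obj m := ReplacementSimplex Y m
  map φ := ↾fun x ↦ ⟨restrictChain φ x.chain, restrictChainLast φ x.chain ≫ x.hom ≫ φ,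
        Y.map (restrictChainZero φ x.chain) x.simplex⟩
  map_id _ := ConcreteCategory.hom_ext _ _ fun x ↦
    congrArg₂ (ReplacementSimplex.mk x.chain)
      (map_restrictChainLast_id (𝟭 _) x.chain x.hom)
      (ConcreteCategory.congr_hom ((congrArg Y.map (restrictChainZero_id x.chain)).trans
            (Y.map_id _)) x.simplex)
  map_comp φ ψ := ConcreteCategory.hom_ext _ _ fun x ↦
    congrArg₂ (ReplacementSimplex.mk (restrictChain (φ ≫ ψ) x.chain))
      (map_restrictChainLast_comp (𝟭 _) x.chain x.hom φ ψ)
      (ConcreteCategory.congr_hom ((congrArg Y.map (restrictChainZero_comp x.chain φ ψ)).trans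
            (Y.map_comp _ _)) x.simplex)

/-- The functor sending `Y` to the simplicial replacement of the diagram of its simplices. -/
def simplicialReplacement : SSet.{u} ⥤ SSet.{u} where
  obj Y := replacement Y
  map f :=
    { app m := ↾fun x ↦ ⟨x.chain, x.hom, f.app _ x.simplex⟩
      naturality m m' φ := ConcreteCategory.hom_ext _ _ fun x ↦
        congrArg (ReplacementSimplex.mk (restrictChain φ x.chain) _)
          (NatTrans.naturality_apply f (restrictChainZero φ x.chain) x.simplex) }

/-- A simplex of the simplicial replacement. -/
def replacementMk {Y : SSet.{u}} {m : SimplexCategoryᵒᵖ}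
    (c : Fin (m.unop.len + 1) ⥤ SimplexCategoryᵒᵖ) (s : c.obj (Fin.last _) ⟶ m)
    (y : Y.obj (c.obj 0)) : (simplicialReplacement.obj Y).obj m :=
  ReplacementSimplex.mk c s y

lemma simplicialReplacement_obj_map {Y : SSet.{u}} {m m' : SimplexCategoryᵒᵖ} (φ : m ⟶ m')
    (c : Fin (m.unop.len + 1) ⥤ SimplexCategoryᵒᵖ) (s : c.obj (Fin.last _) ⟶ m)
    (y : Y.obj (c.obj 0)) :
    (simplicialReplacement.obj Y).map φ (replacementMk c s y) =
      replacementMk (restrictChain φ c) (restrictChainLast φ c ≫ s ≫ φ)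
        (Y.map (restrictChainZero φ c) y) :=
  rfl

lemma simplicialReplacement_map_app {Y Y' : SSet.{u}} (f : Y ⟶ Y') {m : SimplexCategoryᵒᵖ}
    (c : Fin (m.unop.len + 1) ⥤ SimplexCategoryᵒᵖ) (s : c.obj (Fin.last _) ⟶ m)
    (y : Y.obj (c.obj 0)) :
    (simplicialReplacement.map f).app m (replacementMk c s y) =
      replacementMk c s (f.app _ y) :=
  rfl

/-- The chain and the map to `m` do not involve `Y`; only the simplex at the first vertex is
transported. -/
instance : simplicialReplacement.{u}.PreservesMonomorphisms where
  preserves {Y Y'} f hf := by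
    have (m : SimplexCategoryᵒᵖ) : Mono ((simplicialReplacement.map f).app m) := by
      rw [mono_iff_injective]
      intro x x' h
      obtain ⟨c, s, y⟩ : ReplacementSimplex Y m := x
      obtain ⟨c', s', y'⟩ : ReplacementSimplex Y m := x'
      obtain ⟨h₁, h₂, h₃⟩ := ReplacementSimplex.mk.inj h
      subst h₁
      obtain rfl := eq_of_heq h₂
      obtain rfl : y = y' := (mono_iff_injective (f.app _)).1 inferInstance (eq_of_heq h₃)
      rfl
    exact NatTrans.mono_of_mono_app _

/-- The identity of `[n]`, as a simplex of `Δ[n]`. -/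
def idSimplex (n : SimplexCategoryᵒᵖ) : (SSet.stdSimplex.{u}.obj n.unop).obj n :=
  SSet.stdSimplex.objEquiv.symm (𝟙 n.unop)

lemma yonedaEquiv_symm_app_idSimplex {Y : SSet.{u}} {n : SimplexCategoryᵒᵖ} (y : Y.obj n) :
    (SSet.yonedaEquiv.symm y : SSet.stdSimplex.obj n.unop ⟶ Y).app n (idSimplex n) = y :=
  SSet.yonedaEquiv.apply_symm_apply y

lemma stdSimplex_map_idSimplex {n n' : SimplexCategoryᵒᵖ} (φ : n ⟶ n') :
    (SSet.stdSimplex.{u}.obj n.unop).map φ (idSimplex n) =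
      (SSet.stdSimplex.map φ.unop).app n' (idSimplex n') := by
  apply SSet.stdSimplex.objEquiv.injective
  change φ.unop ≫ 𝟙 _ = 𝟙 _ ≫ φ.unop
  rw [Category.comp_id, Category.id_comp]

/-- The right adjoint of the simplicial replacement functor. -/
def replacementRightAdjoint (K : SSet.{u}) : SSet.{u} :=
  (SSet.stdSimplex ⋙ simplicialReplacement).op ⋙ yoneda.obj K

lemma yonedaEquiv_symm_map {Y : SSet.{u}} {n n' : SimplexCategoryᵒᵖ} (φ : n ⟶ n') (y : Y.obj n) :
    (SSet.yonedaEquiv.symm (Y.map φ y) : SSet.stdSimplex.obj n'.unop ⟶ Y) =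
      SSet.stdSimplex.map φ.unop ≫ SSet.yonedaEquiv.symm y := by
  apply SSet.yonedaEquiv.injective
  rw [Equiv.apply_symm_apply]
  change _ = (SSet.yonedaEquiv.symm y).app _ ((SSet.stdSimplex.map φ.unop).app n' (idSimplex n'))
  rw [← stdSimplex_map_idSimplex]
  exact (congrArg (Y.map φ) (yonedaEquiv_symm_app_idSimplex y).symm).trans
    (NatTrans.naturality_apply (SSet.yonedaEquiv.symm y) φ (idSimplex n)).symm

/-- The adjunction bijection for the simplicial replacement functor. -/
def replacementHomEquiv (Y K : SSet.{u}) :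
    (simplicialReplacement.obj Y ⟶ K) ≃ (Y ⟶ replacementRightAdjoint K) where
  toFun g :=
    { app n := ↾fun y ↦ simplicialReplacement.map (SSet.yonedaEquiv.symm y) ≫ g
      naturality n n' φ := ConcreteCategory.hom_ext _ _ fun y ↦ by
        refine (congrArg (simplicialReplacement.map · ≫ g) (yonedaEquiv_symm_map φ y)).trans ?_
        rw [Functor.map_comp, Category.assoc]
        rfl }
  invFun h :=
    { app m := ↾fun (x : ReplacementSimplex Y m) ↦ (show simplicialReplacement.obj (SSet.stdSimplex.obj _) ⟶ K from
        h.app _ x.simplex).app m (replacementMk x.chain x.hom (idSimplex _))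
      naturality m m' φ := ConcreteCategory.hom_ext _ _ fun (x : ReplacementSimplex Y m) ↦ by
        let g : simplicialReplacement.obj (SSet.stdSimplex.obj _) ⟶ K := h.app _ x.simplex
        refine Eq.trans ?_ (NatTrans.naturality_apply g φ (replacementMk x.chain x.hom (idSimplex _)))
        rw [simplicialReplacement_obj_map, stdSimplex_map_idSimplex,
          ← simplicialReplacement_map_app]
        exact ConcreteCategory.congr_hom (NatTrans.congr_app
          (NatTrans.naturality_apply h (restrictChainZero φ x.chain) x.simplex) m')
            (replacementMk (restrictChain φ x.chain) (restrictChainLast φ x.chain ≫ x.hom ≫ φ)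
              (idSimplex _)) }
  left_inv g := by
    ext m x
    obtain ⟨c, s, y⟩ : ReplacementSimplex Y m := x
    refine congrArg (g.app m) ?_
    exact congrArg (replacementMk c s) (yonedaEquiv_symm_app_idSimplex y)
  right_inv h := by
    ext n y
    refine NatTrans.ext (funext fun m ↦ ConcreteCategory.hom_ext _ _ fun x ↦ ?_)
    obtain ⟨c, s, t⟩ : ReplacementSimplex (SSet.stdSimplex.obj n.unop) m := x
    let g : simplicialReplacement.obj (SSet.stdSimplex.obj n.unop) ⟶ K := h.app _ y
    let τ : n ⟶ c.obj 0 := (SSet.stdSimplex.objEquiv t).op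
    refine (ConcreteCategory.congr_hom (NatTrans.congr_app (NatTrans.naturality_apply h τ y) m)
      (replacementMk c s (idSimplex _))).trans ?_
    refine congrArg (fun t ↦ g.app m (replacementMk c s t)) ?_
    apply SSet.stdSimplex.objEquiv.injective
    exact Category.id_comp (SSet.stdSimplex.objEquiv t)

/-- In each degree the replacement is a coproduct of sets `Y.obj (c.obj 0)`, so a map out of it is
determined by its restrictions along the simplices of `Y`. -/
instance : simplicialReplacement.{u}.IsLeftAdjoint :=
  ⟨_, ⟨Adjunction.adjunctionOfEquivRight replacementHomEquiv (fun Y' Y K f g ↦ by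
    ext n y
    change simplicialReplacement.map (SSet.yonedaEquiv.symm y) ≫ simplicialReplacement.map f ≫ g =
      simplicialReplacement.map (SSet.yonedaEquiv.symm (f.app n y)) ≫ g
    rw [← Category.assoc, ← Functor.map_comp]
    exact congrArg (simplicialReplacement.map · ≫ g) (SSet.yonedaEquiv_symm_comp y f))⟩⟩

/-- The natural map from the simplicial replacement of a simplicial set. -/
def replacementπ : simplicialReplacement.{u} ⟶ 𝟭 SSet.{u} where
  app Y :=
    { app m := ↾fun (x : ReplacementSimplex Y m) ↦
        Y.map (x.chain.map (homOfLE (Fin.zero_le (Fin.last _))) ≫ x.hom) x.simplex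
      naturality m m' φ := ConcreteCategory.hom_ext _ _ fun (x : ReplacementSimplex Y m) ↦ by
        change Y.map _ (Y.map _ _) = Y.map _ (Y.map _ _)
        refine (Functor.map_comp_apply Y _ _ _).symm.trans
          (Eq.trans ?_ (Functor.map_comp_apply Y _ _ _))
        refine ConcreteCategory.congr_hom (congrArg Y.map ?_) x.simplex
        change x.chain.map _ ≫ x.chain.map _ ≫ x.chain.map _ ≫ x.hom ≫ φ = _
        simp only [← Category.assoc, ← Functor.map_comp]
        rfl }
  naturality Y Y' f := by
    ext m x
    obtain ⟨c, s, y⟩ : ReplacementSimplex Y m := x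
    exact (NatTrans.naturality_apply f _ y).symm

end replacement

/-! ### Functoriality and homotopies of simplicial replacements. -/

section bar

variable {E E' : Type u} [SmallCategory E] [SmallCategory E'] {p : E ⥤ SimplexCategoryᵒᵖ}
  {p' : E' ⥤ SimplexCategoryᵒᵖ}

lemma BarSimplex.mk_eq {m : SimplexCategoryᵒᵖ} {c c' : Fin (m.unop.len + 1) ⥤ E} (h : c = c')
    (s : p.obj (c.obj (Fin.last _)) ⟶ m) (s' : p.obj (c'.obj (Fin.last _)) ⟶ m)
    (hs : s = p.map (eqToHom (by rw [h])) ≫ s') : BarSimplex.mk c s = BarSimplex.mk c' s' := by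
  subst h
  rw [hs, eqToHom_refl, CategoryTheory.Functor.map_id, Category.id_comp]

/-- The functoriality of the simplicial replacement. -/
def barMap (G : E ⥤ E') (γ : G ⋙ p' ⟶ p) : bar p ⟶ bar p' where
  app m := ↾fun (x : BarSimplex p m) ↦ BarSimplex.mk (x.chain ⋙ G) (γ.app _ ≫ x.hom)
  naturality m m' φ := ConcreteCategory.hom_ext _ _ fun (x : BarSimplex p m) ↦ by
    refine congrArg (BarSimplex.mk (restrictChain φ x.chain ⋙ G)) ?_
    refine ((Category.assoc _ _ _).symm.trans
      (congrArg (· ≫ x.hom ≫ φ) (γ.naturality (restrictChainLast φ x.chain)).symm)).trans ?_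
    simp only [Category.assoc]
    rfl

/-- The functor `Fin (m + 1) ⥤ Fin 2` given by a simplex of `Δ[1]`. -/
def intervalFunctor {m : SimplexCategoryᵒᵖ} (t : (Δ[1] : SSet.{u}).obj m) :
    Fin (m.unop.len + 1) ⥤ Fin 2 :=
  (SSet.stdSimplex.asOrderHom t).monotone.functor

lemma comp_eq_of_two_squares {C : Type*} [Category* C] {X₁ X₂ X₃ X₄ X₅ X₆ Y Y' : C} {a : X₁ ⟶ X₂}
    {g : X₂ ⟶ X₃} {f : X₃ ⟶ X₄} {f' : X₂ ⟶ Y} {g' : Y ⟶ X₄} {b : X₁ ⟶ Y'} {d : Y' ⟶ Y}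
    (h : f' ≫ g' = g ≫ f) (h' : a ≫ f' = b ≫ d) (s : X₄ ⟶ X₅) (φ : X₅ ⟶ X₆) :
    a ≫ g ≫ f ≫ s ≫ φ = b ≫ (d ≫ g' ≫ s) ≫ φ := by
  rw [← reassoc_of% h, reassoc_of% h']
  simp only [Category.assoc]

/-- A homotopy between maps of simplicial replacements. -/
def barHomotopy (W : E × Fin 2 ⥤ E') (γ : Prod.sectL E (1 : Fin 2) ⋙ W ⋙ p' ⟶ p) :
    bar p ⊗ Δ[1] ⟶ bar p' where
  -- The comparison `γ` is needed only at the end 1: the last vertex of the new chain always maps to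
  -- its counterpart at that end.
  app m := ↾fun x ↦ BarSimplex.mk ((BarSimplex.chain x.1).prod' (intervalFunctor x.2) ⋙ W)
    (p'.map (W.map (Prod.mkHom (𝟙 _) (homOfLE (Fin.le_last _)))) ≫ γ.app _ ≫ BarSimplex.hom x.1)
  naturality m m' φ := ConcreteCategory.hom_ext _ _ fun x ↦ by
    obtain ⟨⟨c, s⟩, t⟩ : BarSimplex p m × (Δ[1] : SSet.{u}).obj m := x
    refine congrArg (BarSimplex.mk (restrictChain φ (c.prod' (intervalFunctor t) ⋙ W))) ?_
    refine comp_eq_of_two_squares (γ.naturality (restrictChainLast φ c)) ?_ s φ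
    refine (p'.map_comp _ _).symm.trans (Eq.trans (congrArg p'.map ?_) (p'.map_comp _ _))
    refine (W.map_comp _ _).symm.trans (Eq.trans (congrArg W.map ?_) (W.map_comp _ _))
    exact Prod.ext ((Category.id_comp _).trans (Category.comp_id _).symm)
      (Subsingleton.elim _ _)

/-- The functor `E × Fin 2 ⥤ E'` given by a natural transformation. -/
def natTransCylinder {G G' : E ⥤ E'} (θ : G ⟶ G') : E × Fin 2 ⥤ E' :=
  Functor.uncurry.obj (Functor.flip (ComposableArrows.mk₁ θ))

lemma sectL_zero_natTransCylinder {G G' : E ⥤ E'} (θ : G ⟶ G') :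
    Prod.sectL E (0 : Fin 2) ⋙ natTransCylinder θ = G :=
  CategoryTheory.Functor.ext (fun _ ↦ rfl) (fun X Y f ↦ by
    refine Eq.trans ?_ ((Category.id_comp _).trans (Category.comp_id _)).symm
    exact Category.comp_id (G.map f))

lemma sectL_one_natTransCylinder {G G' : E ⥤ E'} (θ : G ⟶ G') :
    Prod.sectL E (1 : Fin 2) ⋙ natTransCylinder θ = G' :=
  CategoryTheory.Functor.ext (fun _ ↦ rfl) (fun X Y f ↦ by
    refine Eq.trans ?_ ((Category.id_comp _).trans (Category.comp_id _)).symm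
    exact Category.comp_id (G'.map f))

lemma natTransCylinder_map {G G' : E ⥤ E'} (θ : G ⟶ G') (e : E) :
    (natTransCylinder θ).map (Prod.mkHom (𝟙 e) (homOfLE (Fin.le_last (0 : Fin 2)))) = θ.app e :=
  (congrArg (· ≫ θ.app e) (G.map_id e)).trans (Category.id_comp _)

lemma natTransCylinder_map_one {G G' : E ⥤ E'} (θ : G ⟶ G') (e : E) :
    (natTransCylinder θ).map (Prod.mkHom (𝟙 e) (homOfLE (Fin.le_last (1 : Fin 2)))) =
      𝟙 (G'.obj e) :=
  (natTransCylinder θ).map_id (e, 1)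

/-- A natural transformation induces a homotopy of simplicial replacements. -/
lemma htpy_barMap {G G' : E ⥤ E'} (θ : G ⟶ G') (γ : G ⋙ p' ⟶ p) (γ' : G' ⋙ p' ⟶ p)
    (h : ∀ e, p'.map (θ.app e) ≫ γ'.app e = γ.app e) : Htpy (barMap G γ) (barMap G' γ') := by
  let γ'' : Prod.sectL E (1 : Fin 2) ⋙ natTransCylinder θ ⋙ p' ⟶ p :=
    eqToHom (congrArg (· ⋙ p') (sectL_one_natTransCylinder θ)) ≫ γ'
  have hγ (e : E) : γ''.app e = γ'.app e := by
    refine (congrArg (· ≫ γ'.app e) (eqToHom_app _ e)).trans (Category.id_comp _)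
  refine ⟨barHomotopy (natTransCylinder θ) γ'', ?_, ?_⟩
  · ext m x
    obtain ⟨c, s⟩ : BarSimplex p m := x
    refine BarSimplex.mk_eq (congrArg (c ⋙ ·) (sectL_zero_natTransCylinder θ)) _ _ ?_
    refine Eq.trans ?_ ((congrArg (· ≫ _) (p'.map_id _)).trans (Category.id_comp _)).symm
    refine (congrArg₂ (fun a b ↦ p'.map a ≫ b ≫ s) (natTransCylinder_map θ _) (hγ _)).trans ?_
    exact (Category.assoc _ _ _).symm.trans (congrArg (· ≫ s) (h _))
  · ext m x
    obtain ⟨c, s⟩ : BarSimplex p m := x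
    refine BarSimplex.mk_eq (congrArg (c ⋙ ·) (sectL_one_natTransCylinder θ)) _ _ ?_
    refine Eq.trans ?_ ((congrArg (· ≫ _) (p'.map_id _)).trans (Category.id_comp _)).symm
    refine (congrArg₂ (fun a b ↦ p'.map a ≫ b ≫ s) (natTransCylinder_map_one θ _) (hγ _)).trans ?_
    exact (congrArg (· ≫ _) (p'.map_id _)).trans (Category.id_comp _)

end bar

/-! ### The simplices of a simplicial set: their replacement is weakly equivalent to it. -/

section simplices

/-- The objects of the opposite of the category of simplices of a simplicial set. -/
structure Simplices (Y : SSet.{u}) where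
  /-- the dimension -/
  dim : SimplexCategoryᵒᵖ
  /-- the simplex -/
  simplex : Y.obj dim

/-- The morphisms of the opposite of the category of simplices of a simplicial set. -/
@[ext]
structure Simplices.Hom {Y : SSet.{u}} (x y : Simplices Y) : Type u where
  /-- the map of simplices -/
  hom : x.dim ⟶ y.dim
  w : Y.map hom x.simplex = y.simplex

instance (Y : SSet.{u}) : SmallCategory (Simplices Y) where
  Hom x y := x.Hom y
  id x := ⟨𝟙 _, ConcreteCategory.congr_hom (Y.map_id _) x.simplex⟩
  comp f g := ⟨f.hom ≫ g.hom, (Functor.map_comp_apply Y _ _ _).trans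
    ((congrArg (Y.map g.hom) f.w).trans g.w)⟩
  id_comp f := Simplices.Hom.ext (Category.id_comp f.hom)
  comp_id f := Simplices.Hom.ext (Category.comp_id f.hom)
  assoc f g h := Simplices.Hom.ext (Category.assoc f.hom g.hom h.hom)

/-- The dimension functor. -/
def simplicesDim (Y : SSet.{u}) : Simplices Y ⥤ SimplexCategoryᵒᵖ where
  obj x := x.dim
  map f := Simplices.Hom.hom f

/-- A chain of simplices, given by a compatible family. -/
def simplicesChain {Y : SSet.{u}} {m : SimplexCategoryᵒᵖ}
    (c : Fin (m.unop.len + 1) ⥤ SimplexCategoryᵒᵖ) (y : ∀ k, Y.obj (c.obj k))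
    (hy : ∀ ⦃k l⦄ (h : k ⟶ l), Y.map (c.map h) (y k) = y l) :
    Fin (m.unop.len + 1) ⥤ Simplices Y where
  obj k := ⟨c.obj k, y k⟩
  map h := ⟨c.map h, hy h⟩
  map_id k := Simplices.Hom.ext (c.map_id k)
  map_comp f g := Simplices.Hom.ext (c.map_comp f g)

/-- The chain of simplices given by a chain of dimensions and a first simplex. -/
def simplicesChainOfZero {Y : SSet.{u}} {m : SimplexCategoryᵒᵖ}
    (c : Fin (m.unop.len + 1) ⥤ SimplexCategoryᵒᵖ) (y : Y.obj (c.obj 0)) :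
    Fin (m.unop.len + 1) ⥤ Simplices Y :=
  simplicesChain c (fun k ↦ Y.map (c.map (homOfLE (Fin.zero_le k))) y) (fun k l h ↦ by
    refine (Functor.map_comp_apply Y _ _ _).symm.trans ?_
    rw [← Functor.map_comp]
    rfl)

/-- Morphisms of `Simplices Y` push simplices forward, so the first simplex and the chain of
dimensions determine the chain. -/
lemma simplicesChainOfZero_eq {Y : SSet.{u}} {m : SimplexCategoryᵒᵖ}
    (c : Fin (m.unop.len + 1) ⥤ Simplices Y) :
    simplicesChainOfZero (c ⋙ simplicesDim Y) (c.obj 0).simplex = c := by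
  have h : (fun k ↦ Y.map ((c ⋙ simplicesDim Y).map (homOfLE (Fin.zero_le k)))
      (c.obj 0).simplex) = fun k ↦ (c.obj k).simplex :=
    funext fun k ↦ (c.map (homOfLE (Fin.zero_le k))).w
  have aux (y : ∀ k, Y.obj ((c ⋙ simplicesDim Y).obj k)) (hy)
      (h : y = fun k ↦ (c.obj k).simplex) : simplicesChain (c ⋙ simplicesDim Y) y hy = c := by
    subst h
    rfl
  exact aux _ _ h

/-- The comparison between the two simplicial replacements. -/
def replacementOfBar (Y : SSet.{u}) : bar (simplicesDim Y) ⟶ simplicialReplacement.obj Y where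
  app m := ↾fun (x : BarSimplex (simplicesDim Y) m) ↦
    replacementMk (x.chain ⋙ simplicesDim Y) x.hom (x.chain.obj 0).simplex
  naturality m m' φ := ConcreteCategory.hom_ext _ _ fun (x : BarSimplex (simplicesDim Y) m) ↦ by
    refine congrArg (replacementMk (restrictChain φ (x.chain ⋙ simplicesDim Y)) _) ?_
    exact (x.chain.map (homOfLE (Fin.zero_le _))).w.symm

instance (Y : SSet.{u}) : IsIso (replacementOfBar Y) := by
  have (m : SimplexCategoryᵒᵖ) : IsIso ((replacementOfBar Y).app m) := by
    rw [isIso_iff_bijective]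
    constructor
    · intro x x' h
      obtain ⟨c, s⟩ : BarSimplex (simplicesDim Y) m := x
      obtain ⟨c', s'⟩ : BarSimplex (simplicesDim Y) m := x'
      obtain rfl : c = c' := by
        rw [← simplicesChainOfZero_eq c, ← simplicesChainOfZero_eq c']
        exact congrArg (fun (x : ReplacementSimplex Y m) ↦
          simplicesChainOfZero x.chain x.simplex) h
      exact congrArg (BarSimplex.mk c) (eq_of_heq (ReplacementSimplex.mk.inj h).2.1)
    · intro x
      obtain ⟨c, s, y⟩ : ReplacementSimplex Y m := x
      refine ⟨BarSimplex.mk (simplicesChainOfZero c y) s, ?_⟩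
      have h : Y.map (c.map (homOfLE (Fin.zero_le 0))) y = y := ConcreteCategory.congr_hom
        ((congrArg Y.map (c.map_id 0)).trans (Y.map_id _)) y
      exact congrArg (replacementMk c s) h
  exact NatIso.isIso_of_isIso_app _

/-- The natural map from the simplicial replacement of the diagram of simplices of `Y` to `Y`. -/
def barπ (Y : SSet.{u}) : bar (simplicesDim Y) ⟶ Y where
  app m := ↾fun (x : BarSimplex (simplicesDim Y) m) ↦ Y.map x.hom (x.chain.obj (Fin.last _)).simplex
  naturality m m' φ := ConcreteCategory.hom_ext _ _ fun (x : BarSimplex (simplicesDim Y) m) ↦ by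
    refine Eq.trans ?_ (Functor.map_comp_apply Y _ _ _)
    refine (Functor.map_comp_apply Y _ _ _).trans (congrArg (Y.map (x.hom ≫ φ)) ?_)
    exact (restrictChainLast φ x.chain).w

lemma replacementOfBar_comp_π (Y : SSet.{u}) :
    replacementOfBar Y ≫ replacementπ.app Y = barπ Y := by
  ext m x
  obtain ⟨c, s⟩ : BarSimplex (simplicesDim Y) m := x
  refine (Functor.map_comp_apply Y _ _ _).trans (congrArg (Y.map s) ?_)
  exact (c.map (homOfLE (Fin.zero_le (Fin.last _)))).w

/-- The top simplex `e` maps canonically to every object of `Simplices`. This natural transformation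
from the constant functor at `e` to the identity induces a homotopy from `barπ` followed by the
section `g` to the identity. -/
lemma weakEquivalence_barπ_stdSimplex (n : ℕ) : sSetWeakEquivalences (barπ (Δ[n] : SSet.{u})) := by
  let e : Simplices (Δ[n] : SSet.{u}) := ⟨op ⦋n⦌, idSimplex _⟩
  let g : (Δ[n] : SSet.{u}) ⟶ bar (simplicesDim Δ[n]) :=
    { app m := ↾fun t ↦ BarSimplex.mk ((Functor.const _).obj e) (SSet.stdSimplex.objEquiv t).op
      naturality m m' φ := ConcreteCategory.hom_ext _ _ fun t ↦
        congrArg (BarSimplex.mk ((Functor.const _).obj e)) (Category.id_comp _).symm }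
  let θ : (Functor.const (Simplices (Δ[n] : SSet.{u}))).obj e ⟶ 𝟭 _ :=
    { app x := ⟨(SSet.stdSimplex.objEquiv x.simplex).op, by
        apply SSet.stdSimplex.objEquiv.injective
        exact Category.comp_id (SSet.stdSimplex.objEquiv x.simplex)⟩
      naturality x y f := by
        refine Simplices.Hom.ext
          ((Category.id_comp (SSet.stdSimplex.objEquiv y.simplex).op).trans ?_)
        exact congrArg (fun s ↦ (SSet.stdSimplex.objEquiv s).op) f.w.symm }
  refine sSetWeakEquivalences_of_homotopyEquiv (barπ (Δ[n] : SSet.{u})) g (Or.inl ?_) (Or.inl ?_)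
  · have := htpy_barMap (p := simplicesDim (Δ[n] : SSet.{u})) θ
      (Functor.whiskerRight θ (simplicesDim Δ[n])) (𝟙 _) (fun _ ↦ Category.comp_id _)
    convert this using 1
    · rfl
    · ext m x
      obtain ⟨c, s⟩ : BarSimplex (simplicesDim (Δ[n] : SSet.{u})) m := x
      exact congrArg (BarSimplex.mk c) (Category.id_comp s).symm
  · convert Htpy.refl (𝟙 (Δ[n] : SSet.{u})) using 1
    ext m t
    apply SSet.stdSimplex.objEquiv.injective
    exact Category.comp_id (SSet.stdSimplex.objEquiv t)

lemma weakEquivalence_barπ (Y : SSet.{u}) : sSetWeakEquivalences (barπ Y) := by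
  have h (n : ℕ) : sSetWeakEquivalences (replacementπ.app (Δ[n] : SSet.{u})) := by
    refine MorphismProperty.of_precomp _ (replacementOfBar _) _ (sSetWeakEquivalences_of_isIso _) ?_
    rw [replacementOfBar_comp_π]
    exact weakEquivalence_barπ_stdSimplex n
  rw [← replacementOfBar_comp_π]
  exact MorphismProperty.comp_mem _ _ _ (sSetWeakEquivalences_of_isIso _)
    (weakEquivalence_of_stdSimplex replacementπ h Y)

end simplices

/-! ### An explicit model of the homotopy colimit. -/

noncomputable section hocolimModel

variable {C : Type u} [SmallCategory C] {K : Type u} [SmallCategory K] (D : K ⥤ U C)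

/-- The simplices of the explicit model of the homotopy colimit of `D`. -/
structure HocolimSimplex (X : Cᵒᵖ) (m : SimplexCategoryᵒᵖ) where
  /-- the chain of indices -/
  chain : Fin (m.unop.len + 1) ⥤ Kᵒᵖ
  /-- the simplex of the value of the diagram -/
  simplex : ((D.obj (chain.obj (Fin.last _)).unop).obj X).obj m

/-- The explicit model of the homotopy colimit of `D`. -/
def hocolimModel : U C where
  obj X :=
    { obj m := HocolimSimplex D X m
      map φ := ↾fun x ↦ ⟨restrictChain φ x.chain,
        ((D.map (restrictChainLast φ x.chain).unop).app X).app _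
          (((D.obj _).obj X).map φ x.simplex)⟩
      map_id m := ConcreteCategory.hom_ext _ _ fun x ↦ by
        refine congrArg (HocolimSimplex.mk x.chain) ?_
        refine (congrArg (fun f : _ ⟶ x.chain.obj (Fin.last _) ↦ ((D.map f.unop).app X).app m
          (((D.obj _).obj X).map (𝟙 m) x.simplex)) (restrictChainLast_id x.chain)).trans ?_
        refine (ConcreteCategory.congr_hom (NatTrans.congr_app (NatTrans.congr_app
          (D.map_id _) X) m) _).trans ?_
        exact ConcreteCategory.congr_hom (((D.obj _).obj X).map_id m) x.simplex
      map_comp {m m' m''} φ ψ := ConcreteCategory.hom_ext _ _ fun x ↦ by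
        refine congrArg (HocolimSimplex.mk (restrictChain (φ ≫ ψ) x.chain)) ?_
        refine (congrArg (fun f : _ ⟶ x.chain.obj (Fin.last _) ↦ ((D.map f.unop).app X).app m''
          (((D.obj _).obj X).map (φ ≫ ψ) x.simplex)) (restrictChainLast_comp x.chain φ ψ)).trans ?_
        refine (ConcreteCategory.congr_hom (NatTrans.congr_app (NatTrans.congr_app
          (D.map_comp _ _) X) m'') _).trans ?_
        refine congrArg ((D.map (restrictChainLast ψ (restrictChain φ x.chain)).unop).app X |>.app m'')
          ?_
        refine Eq.trans ?_ (NatTrans.naturality_apply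
          ((D.map (restrictChainLast φ x.chain).unop).app X) ψ _)
        exact congrArg _ (Functor.map_comp_apply ((D.obj _).obj X) φ ψ x.simplex) }
  map {X X'} f :=
    { app m := ↾fun x ↦ ⟨x.chain, ((D.obj _).map f).app m x.simplex⟩
      naturality m m' φ := ConcreteCategory.hom_ext _ _ fun x ↦ by
        refine congrArg (HocolimSimplex.mk (restrictChain φ x.chain)) ?_
        refine (ConcreteCategory.congr_hom (NatTrans.congr_app
          ((D.map (restrictChainLast φ x.chain).unop).naturality f) m') _).symm.trans ?_
        exact congrArg _ (NatTrans.naturality_apply ((D.obj _).map f) φ x.simplex) }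
  map_id X := by
    ext m x
    refine congrArg (HocolimSimplex.mk (HocolimSimplex.chain x)) ?_
    exact ConcreteCategory.congr_hom (NatTrans.congr_app ((D.obj _).map_id X) m) _
  map_comp f g := by
    ext m x
    refine congrArg (HocolimSimplex.mk (HocolimSimplex.chain x)) ?_
    exact ConcreteCategory.congr_hom (NatTrans.congr_app ((D.obj _).map_comp f g) m) _

/-- A simplex of a tensor product. -/
def tensorMk {F : U C} {L : SSet.{u}} {X : Cᵒᵖ} {m : SimplexCategoryᵒᵖ} (d : (F.obj X).obj m)
    (w : L.obj m) : (((tensor.obj L).obj F).obj X).obj m :=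
  id (α := (F.obj X).obj m × L.obj m) (d, w)

lemma hocolim_condition_apply {i j : K} (f : i ⟶ j) {X : Cᵒᵖ} {m : SimplexCategoryᵒᵖ}
    (d : ((D.obj i).obj X).obj m) (w : ((hocolimWeight K).obj (op j)).obj m) :
    ((hocolim.ι D i).app X).app m (tensorMk d (((hocolimWeight K).map f.op).app m w)) =
      ((hocolim.ι D j).app X).app m (tensorMk (((D.map f).app X).app m d) w) :=
  ConcreteCategory.congr_hom (NatTrans.congr_app (NatTrans.congr_app (hocolim.condition D f) X) m)
    (tensorMk (L := (hocolimWeight K).obj (op j)) d w)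

/-- The map from the homotopy colimit to its explicit model. -/
def hocolimToModel : hocolim D ⟶ hocolimModel D :=
  hocolim.desc
    (fun i ↦
      { app X :=
          { app m := ↾fun x ↦ HocolimSimplex.mk (weightChain (i := i) x.2)
              (((D.map (weightHom (i := i) x.2 (Fin.last _))).app X).app m x.1)
            naturality m m' φ := ConcreteCategory.hom_ext _ _ fun x ↦ by
              refine congrArg (HocolimSimplex.mk (restrictChain φ (weightChain (i := i) x.2))) ?_
              have h := weightHom_comp (i := i) x.2
                (homOfLE (Fin.le_last (φ.unop.toOrderHom (Fin.last _))))
              refine (congrArg (fun g ↦ ((D.map g).app X).app m' (((D.obj i).obj X).map φ x.1))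
                h.symm).trans ?_
              refine (ConcreteCategory.congr_hom (NatTrans.congr_app (NatTrans.congr_app
                (D.map_comp _ _) X) m') _).trans ?_
              exact congrArg _ (NatTrans.naturality_apply
                ((D.map (weightHom (i := i) x.2 (Fin.last _))).app X) φ x.1) }
        naturality X X' f := by
          ext m x
          refine congrArg (HocolimSimplex.mk (weightChain (i := i) x.2)) ?_
          exact ConcreteCategory.congr_hom (NatTrans.congr_app
            ((D.map (weightHom (i := i) x.2 (Fin.last _))).naturality f) m) x.1 })
    (fun i j f ↦ by
      ext X m x
      refine congrArg (HocolimSimplex.mk (weightChain (i := j) x.2)) ?_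
      exact ConcreteCategory.congr_hom (NatTrans.congr_app (NatTrans.congr_app
        (D.map_comp f (weightHom (i := j) x.2 (Fin.last _))) X) m) x.1)

lemma ι_hocolimToModel_app (i : K) {X : Cᵒᵖ} {m : SimplexCategoryᵒᵖ}
    (d : ((D.obj i).obj X).obj m) (w : ((hocolimWeight K).obj (op i)).obj m) :
    ((hocolimToModel D).app X).app m (((hocolim.ι D i).app X).app m (tensorMk d w)) =
      HocolimSimplex.mk (weightChain w) (((D.map (weightHom w (Fin.last _))).app X).app m d) :=
  ConcreteCategory.congr_hom (NatTrans.congr_app (NatTrans.congr_app (hocolim.ι_desc _ _ i) X) m)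
    (tensorMk (L := (hocolimWeight K).obj (op i)) d w)

/-- The simplex of `D i ⊗ N((i ↓ K)ᵒᵖ)` given by a simplex of the explicit model. -/
def HocolimSimplex.pair {D : K ⥤ U C} {X : Cᵒᵖ} {m : SimplexCategoryᵒᵖ}
    (x : HocolimSimplex D X m) :
    (((tensor.obj ((hocolimWeight K).obj (op (x.chain.obj (Fin.last _)).unop))).obj
      (D.obj (x.chain.obj (Fin.last _)).unop)).obj X).obj m :=
  tensorMk x.simplex (weightOfLast x.chain (𝟙 _))

/-- The map from the explicit model to the homotopy colimit. -/
def hocolimOfModel : hocolimModel D ⟶ hocolim D where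
  app X :=
    { app m := ↾fun (x : HocolimSimplex D X m) ↦ ((hocolim.ι D _).app X).app m x.pair
      naturality m m' φ := ConcreteCategory.hom_ext _ _ fun (x : HocolimSimplex D X m) ↦ by
        refine Eq.trans ?_ (NatTrans.naturality_apply ((hocolim.ι D _).app X) φ x.pair)
        refine (hocolim_condition_apply D _ _ _).symm.trans ?_
        refine congrArg (fun w ↦ ((hocolim.ι D _).app X).app m'
          (tensorMk (((D.obj _).obj X).map φ x.simplex) w)) ?_
        refine (hocolimWeight_map_weightOfLast _ _ _).trans (Eq.trans ?_
          (map_weightOfLast φ x.chain (𝟙 _)).symm)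
        exact congrArg (weightOfLast (restrictChain φ x.chain))
          ((Category.comp_id _).trans (Category.id_comp _).symm) }
  naturality X X' f := by
    ext m x
    exact ConcreteCategory.congr_hom (NatTrans.congr_app ((hocolim.ι D _).naturality f) m)
      (HocolimSimplex.pair x)

/-- The coend relation moves the structure map to the last vertex of the chain from the weight to
the diagram, so every simplex has a normal form in which that map is the identity. -/
instance : IsIso (hocolimOfModel D) := by
  refine ⟨hocolimToModel D, ?_, hocolim.hom_ext fun i ↦ ?_⟩
  · ext X m x
    obtain ⟨c, d⟩ : HocolimSimplex D X m := x
    refine (ι_hocolimToModel_app D _ d (weightOfLast c (𝟙 _))).trans ?_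
    refine congrArg (HocolimSimplex.mk c) ?_
    refine (congrArg (fun g ↦ ((D.map g).app X).app m d) ?_).trans
      (ConcreteCategory.congr_hom (NatTrans.congr_app (NatTrans.congr_app (D.map_id _) X) m) d)
    exact (Category.id_comp _).trans (congrArg Quiver.Hom.unop (c.map_id _))
  · ext X m x
    obtain ⟨d, w⟩ : ((D.obj i).obj X).obj m × ((hocolimWeight K).obj (op i)).obj m := x
    refine (congrArg (((hocolimOfModel D).app X).app m) (ι_hocolimToModel_app D i d w)).trans ?_
    refine (hocolim_condition_apply D _ _ _).symm.trans ?_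
    refine congrArg (fun w ↦ ((hocolim.ι D i).app X).app m (tensorMk d w)) ?_
    refine (hocolimWeight_map_weightOfLast _ _ _).trans ?_
    rw [Category.comp_id]
    exact weightOfLast_eq w

end hocolimModel

/-! ### The values of the canonical homotopy colimit as simplicial replacements. -/

noncomputable section canonicalDiagram

variable {C : Type u} [SmallCategory C]

/-- A simplex of `rA ⊗ Δ[n]`. -/
def repMk {x : C × SimplexCategory} {X : Cᵒᵖ} {m : SimplexCategoryᵒᵖ} (f : X.unop ⟶ x.1)
    (s : op x.2 ⟶ m) : ((repTensorSimplex.obj x).obj X).obj m :=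
  id (α := (X.unop ⟶ x.1) × (SSet.stdSimplex.{u}.obj x.2).obj m)
    (f, SSet.stdSimplex.objEquiv.symm s.unop)

lemma repMk_surjective {x : C × SimplexCategory} {X : Cᵒᵖ} {m : SimplexCategoryᵒᵖ}
    (d : ((repTensorSimplex.obj x).obj X).obj m) :
    ∃ (f : X.unop ⟶ x.1) (s : op x.2 ⟶ m), repMk f s = d := by
  obtain ⟨f, t⟩ : (X.unop ⟶ x.1) × (SSet.stdSimplex.{u}.obj x.2).obj m := d
  exact ⟨f, (SSet.stdSimplex.objEquiv t).op, rfl⟩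

lemma repMk_inj {x : C × SimplexCategory} {X : Cᵒᵖ} {m : SimplexCategoryᵒᵖ} {f f' : X.unop ⟶ x.1}
    {s s' : op x.2 ⟶ m} (h : repMk f s = repMk f' s') : f = f' ∧ s = s' := by
  have h₁ : f = f' := congrArg Prod.fst h
  have h₂ : SSet.stdSimplex.objEquiv.{u}.symm s.unop = SSet.stdSimplex.objEquiv.symm s'.unop :=
    congrArg Prod.snd h
  exact ⟨h₁, Quiver.Hom.unop_inj (SSet.stdSimplex.objEquiv.symm.injective h₂)⟩

lemma repTensorSimplex_obj_map_repMk {x : C × SimplexCategory} {X : Cᵒᵖ}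
    {m m' : SimplexCategoryᵒᵖ} (φ : m ⟶ m') (f : X.unop ⟶ x.1) (s : op x.2 ⟶ m) :
    ((repTensorSimplex.obj x).obj X).map φ (repMk f s) = repMk f (s ≫ φ) :=
  rfl

variable {F : U C}

lemma app_repMk {x : C × SimplexCategory} (b : repTensorSimplex.obj x ⟶ F) {X : Cᵒᵖ}
    {m : SimplexCategoryᵒᵖ} (f : X.unop ⟶ x.1) (s : op x.2 ⟶ m) :
    (b.app X).app m (repMk f s) = (F.obj X).map s ((b.app X).app _ (repMk f (𝟙 _))) := by
  rw [← NatTrans.naturality_apply, repTensorSimplex_obj_map_repMk, Category.id_comp]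

lemma app_repMk_eq_map {x : C × SimplexCategory} (b : repTensorSimplex.obj x ⟶ F) {X : Cᵒᵖ}
    {m : SimplexCategoryᵒᵖ} (f : X.unop ⟶ x.1) (s : op x.2 ⟶ m) :
    (b.app X).app m (repMk f s) =
      (F.map f.op).app m ((b.app (op x.1)).app m (repMk (X := op x.1) (𝟙 x.1) s)) := by
  refine Eq.trans (congrArg (fun f ↦ (b.app X).app m (repMk f s)) (Category.comp_id f).symm) ?_
  exact ConcreteCategory.congr_hom (NatTrans.congr_app (b.naturality f.op) m)
    (repMk (X := op x.1) (𝟙 x.1) s)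

lemma hom_ext_repMk {x : C × SimplexCategory} {b c : repTensorSimplex.obj x ⟶ F}
    (h : (b.app (op x.1)).app (op x.2) (repMk (X := op x.1) (𝟙 x.1) (𝟙 _)) =
      (c.app (op x.1)).app (op x.2) (repMk (X := op x.1) (𝟙 x.1) (𝟙 _))) : b = c := by
  ext X m d
  obtain ⟨f, s, rfl⟩ := repMk_surjective d
  refine (app_repMk_eq_map b f s).trans (Eq.trans ?_ (app_repMk_eq_map c f s).symm)
  rw [app_repMk b, app_repMk c, h]

/-- The map `rA ⊗ Δ[n] ⟶ F` given by a simplex of `F A`. -/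
def ofSimplex (x : C × SimplexCategory) (y : (F.obj (op x.1)).obj (op x.2)) :
    repTensorSimplex.obj x ⟶ F where
  app X :=
    { app m := ↾fun d ↦ (F.map (show X.unop ⟶ x.1 from d.1).op).app m
        ((F.obj (op x.1)).map (SSet.stdSimplex.objEquiv d.2).op y)
      naturality m m' φ := ConcreteCategory.hom_ext _ _ fun d ↦ by
        refine Eq.trans ?_ (NatTrans.naturality_apply (F.map (show X.unop ⟶ x.1 from d.1).op) φ _)
        exact congrArg ((F.map (show X.unop ⟶ x.1 from d.1).op).app m')
          (Functor.map_comp_apply (F.obj (op x.1)) (SSet.stdSimplex.objEquiv d.2).op φ y) }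
  naturality X X' g := by
    ext m d
    exact ConcreteCategory.congr_hom (NatTrans.congr_app
      (F.map_comp (show X.unop ⟶ x.1 from d.1).op g) m) _

lemma ofSimplex_app (x : C × SimplexCategory) (y : (F.obj (op x.1)).obj (op x.2)) {X : Cᵒᵖ}
    {m : SimplexCategoryᵒᵖ} (f : X.unop ⟶ x.1) (s : op x.2 ⟶ m) :
    ((ofSimplex x y).app X).app m (repMk f s) =
      (F.map f.op).app m ((F.obj (op x.1)).map s y) :=
  rfl

lemma ofSimplex_app_id (x : C × SimplexCategory) (y : (F.obj (op x.1)).obj (op x.2))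
    {m : SimplexCategoryᵒᵖ} (s : op x.2 ⟶ m) :
    ((ofSimplex x y).app (op x.1)).app m (repMk (X := op x.1) (𝟙 x.1) s) =
      (F.obj (op x.1)).map s y := by
  refine (ofSimplex_app x y (X := op x.1) (𝟙 x.1) s).trans ?_
  rw [op_id, F.map_id]
  rfl

variable (F) (X : C)

/-- The functor `[(A, [n]), rA ⊗ Δ[n] ⟶ F] ↦ A`. -/
abbrev canonicalBase : CostructuredArrow (repTensorSimplex (C := C)) F ⥤ C :=
  CostructuredArrow.proj repTensorSimplex F ⋙ CategoryTheory.Prod.fst C SimplexCategory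

/-- The dimension functor on the category of objects of `(C × Δ ↓ F)` under `X`. -/
def underDim : (StructuredArrow X (canonicalBase F))ᵒᵖ ⥤ SimplexCategoryᵒᵖ :=
  (StructuredArrow.proj X (canonicalBase F) ⋙ CostructuredArrow.proj repTensorSimplex F ⋙
    CategoryTheory.Prod.snd C SimplexCategory).op

variable {F X}

/-- A chain of objects under `X`, given by a compatible family. -/
def underChain {m : SimplexCategoryᵒᵖ}
    (c : Fin (m.unop.len + 1) ⥤ (CostructuredArrow (repTensorSimplex (C := C)) F)ᵒᵖ)
    (a : ∀ k, X ⟶ (canonicalBase F).obj (c.obj k).unop)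
    (ha : ∀ ⦃k l⦄ (h : k ⟶ l), a l ≫ (canonicalBase F).map (c.map h).unop = a k) :
    Fin (m.unop.len + 1) ⥤ (StructuredArrow X (canonicalBase F))ᵒᵖ where
  obj k := op (StructuredArrow.mk (a k))
  map h := (StructuredArrow.homMk (c.map h).unop (ha h)).op

/-- The chain of objects under `X` given by a map to the last object. -/
def underChainOfLast {m : SimplexCategoryᵒᵖ}
    (c : Fin (m.unop.len + 1) ⥤ (CostructuredArrow (repTensorSimplex (C := C)) F)ᵒᵖ)
    (f : X ⟶ (canonicalBase F).obj (c.obj (Fin.last _)).unop) :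
    Fin (m.unop.len + 1) ⥤ (StructuredArrow X (canonicalBase F))ᵒᵖ :=
  underChain c (fun k ↦ f ≫ (canonicalBase F).map (c.map (homOfLE (Fin.le_last k))).unop)
    (fun k l h ↦ by
      rw [Category.assoc, ← Functor.map_comp, ← unop_comp, ← Functor.map_comp]
      rfl)

lemma underChainOfLast_eq {m : SimplexCategoryᵒᵖ}
    (c : Fin (m.unop.len + 1) ⥤ (StructuredArrow X (canonicalBase F))ᵒᵖ) :
    underChainOfLast (c ⋙ (StructuredArrow.proj X (canonicalBase F)).op)
      (c.obj (Fin.last _)).unop.hom = c := by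
  have h : (fun k ↦ (c.obj (Fin.last _)).unop.hom ≫ (canonicalBase F).map
      ((c ⋙ (StructuredArrow.proj X (canonicalBase F)).op).map
        (homOfLE (Fin.le_last k))).unop) = fun k ↦ (c.obj k).unop.hom :=
    funext fun k ↦ StructuredArrow.w (c.map (homOfLE (Fin.le_last k))).unop
  have h' (a : ∀ k, X ⟶ (canonicalBase F).obj
      ((c ⋙ (StructuredArrow.proj X (canonicalBase F)).op).obj k).unop) (ha)
      (h : a = fun k ↦ (c.obj k).unop.hom) :
      underChain (c ⋙ (StructuredArrow.proj X (canonicalBase F)).op) a ha = c := by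
    subst h
    rfl
  exact h' _ _ h

variable (F X)

/-- The comparison of the two models of the values of the homotopy colimit. -/
def modelOfBar : bar (underDim F X) ⟶ (hocolimModel (canonicalDiagram F)).obj (op X) where
  app m := ↾fun (x : BarSimplex (underDim F X) m) ↦
    HocolimSimplex.mk (x.chain ⋙ (StructuredArrow.proj X (canonicalBase F)).op)
      (repMk (X := op X) (x.chain.obj (Fin.last _)).unop.hom x.hom)
  naturality m m' φ := ConcreteCategory.hom_ext _ _ fun (x : BarSimplex (underDim F X) m) ↦ by
    refine congrArg (HocolimSimplex.mk
      (restrictChain φ x.chain ⋙ (StructuredArrow.proj X (canonicalBase F)).op)) ?_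
    refine (congrArg (fun f ↦ repMk (X := op X) f
      ((underDim F X).map (restrictChainLast φ x.chain) ≫ x.hom ≫ φ)) ?_)
    exact (StructuredArrow.w (restrictChainLast φ x.chain).unop).symm

/-- A simplex of `rA ⊗ Δ[n]` at `X` is a map to `A` and a map of simplices. The first, taken at the
last vertex, lifts the whole chain uniquely to objects under `X`; the second is the remaining datum
of the replacement. -/
instance : IsIso (modelOfBar F X) := by
  have (m : SimplexCategoryᵒᵖ) : IsIso ((modelOfBar F X).app m) := by
    rw [isIso_iff_bijective]
    constructor
    · intro x x' h
      obtain ⟨c, s⟩ : BarSimplex (underDim F X) m := x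
      obtain ⟨c', s'⟩ : BarSimplex (underDim F X) m := x'
      obtain rfl : c = c' := by
        rw [← underChainOfLast_eq c, ← underChainOfLast_eq c']
        exact congrArg (fun (x : HocolimSimplex (canonicalDiagram F) (op X) m) ↦
          underChainOfLast x.chain (show X ⟶ _ from x.simplex.1)) h
      exact congrArg (BarSimplex.mk c) (repMk_inj (eq_of_heq (HocolimSimplex.mk.inj h).2)).2
    · intro x
      obtain ⟨c, d⟩ : HocolimSimplex (canonicalDiagram F) (op X) m := x
      obtain ⟨f, s, rfl⟩ := repMk_surjective d
      refine ⟨BarSimplex.mk (underChainOfLast c f) s, ?_⟩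
      refine congrArg (HocolimSimplex.mk c) (congrArg (fun f ↦ repMk (X := op X) f s) ?_)
      change f ≫ (canonicalBase F).map (c.map (𝟙 _)).unop = f
      rw [c.map_id, unop_id, CategoryTheory.Functor.map_id]
      exact Category.comp_id f
  exact NatIso.isIso_of_isIso_app _

end canonicalDiagram

/-! ### Comparison with the simplices of F(X), and conclusion. -/

noncomputable section weakEquivalence

section

variable {E E' E'' : Type u} [SmallCategory E] [SmallCategory E'] [SmallCategory E'']
  {p : E ⥤ SimplexCategoryᵒᵖ} {p' : E' ⥤ SimplexCategoryᵒᵖ} {p'' : E'' ⥤ SimplexCategoryᵒᵖ}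

lemma barMap_comp (G : E ⥤ E') (γ : G ⋙ p' ⟶ p) (G' : E' ⥤ E'') (γ' : G' ⋙ p'' ⟶ p') :
    barMap G γ ≫ barMap G' γ' =
      barMap (p' := p'') (G ⋙ G') (show G ⋙ G' ⋙ p'' ⟶ p from Functor.whiskerLeft G γ' ≫ γ) := by
  ext m x
  obtain ⟨c, s⟩ : BarSimplex p m := x
  exact congrArg (BarSimplex.mk (c ⋙ G ⋙ G')) (Category.assoc _ _ _).symm

lemma barMap_id : barMap (p := p) (p' := p) (𝟭 E) (𝟙 p) = 𝟙 _ := by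
  ext m x
  obtain ⟨c, s⟩ : BarSimplex p m := x
  exact congrArg (BarSimplex.mk c) (Category.id_comp s)

/-- Functors over `Δᵒᵖ` which are inverse to each other up to natural transformations induce weak
equivalences of simplicial replacements. -/
lemma weakEquivalence_barMap (G : E ⥤ E') (γ : G ⋙ p' ⟶ p) (G' : E' ⥤ E) (γ' : G' ⋙ p ⟶ p')
    (θ : 𝟭 E ⟶ G ⋙ G')
    (hθ : ∀ e, p.map (θ.app e) ≫ γ'.app (G.obj e) ≫ γ.app e = 𝟙 _)
    (θ' : 𝟭 E' ⟶ G' ⋙ G)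
    (hθ' : ∀ e, p'.map (θ'.app e) ≫ γ.app (G'.obj e) ≫ γ'.app e = 𝟙 _) :
    sSetWeakEquivalences (barMap G γ) := by
  refine sSetWeakEquivalences_of_homotopyEquiv _ (barMap G' γ') (Or.inr ?_) (Or.inr ?_)
  · rw [barMap_comp, ← barMap_id]
    exact htpy_barMap θ _ _ hθ
  · rw [barMap_comp, ← barMap_id]
    exact htpy_barMap θ' _ _ hθ'

end

variable {C : Type u} [SmallCategory C] (F : U C) (X : C)

/-- The functor sending an object of `(C × Δ ↓ F)` under `X` to the corresponding simplex of
`F X`. -/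
def underToSimplices : (StructuredArrow X (canonicalBase F))ᵒᵖ ⥤ Simplices (F.obj (op X)) where
  obj j := ⟨(underDim F X).obj j,
    (j.unop.right.hom.app (op X)).app _ (repMk (X := op X) j.unop.hom (𝟙 _))⟩
  map {j j'} g := ⟨(underDim F X).map g, by
    have h : repTensorSimplex.map g.unop.right.left ≫ j.unop.right.hom = j'.unop.right.hom :=
      CostructuredArrow.w g.unop.right
    refine (app_repMk j.unop.right.hom (X := op X) j.unop.hom ((underDim F X).map g)).symm.trans ?_
    refine Eq.trans ?_ (ConcreteCategory.congr_hom (NatTrans.congr_app (NatTrans.congr_app h (op X))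
      _) (repMk (X := op X) j'.unop.hom (𝟙 _)))
    refine congrArg ((j.unop.right.hom.app (op X)).app _) ?_
    exact congrArg₂ (repMk (X := op X)) (StructuredArrow.w g.unop).symm (Category.comp_id _).symm⟩
  map_id j := Simplices.Hom.ext ((underDim F X).map_id j)
  map_comp f g := Simplices.Hom.ext ((underDim F X).map_comp f g)

variable {F X} in
lemma map_comp_ofSimplex {y y' : Simplices (F.obj (op X))} (g : y ⟶ y') :
    repTensorSimplex.map (Prod.mkHom (𝟙 X) g.hom.unop : (X, y'.dim.unop) ⟶ (X, y.dim.unop)) ≫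
      ofSimplex (X, y.dim.unop) y.simplex = ofSimplex (X, y'.dim.unop) y'.simplex := by
  refine hom_ext_repMk (Eq.trans ?_ (ofSimplex_app_id (X, y'.dim.unop) y'.simplex (𝟙 _)).symm)
  refine Eq.trans (congrArg₂ (fun f s ↦ ((ofSimplex (X, y.dim.unop) y.simplex).app (op X)).app
    y'.dim (repMk (X := op X) f s)) (Category.comp_id (𝟙 X)) (Category.comp_id g.hom)) ?_
  refine (ofSimplex_app_id (X, y.dim.unop) y.simplex g.hom).trans (g.w.trans ?_)
  exact (ConcreteCategory.congr_hom ((F.obj (op X)).map_id _) y'.simplex).symm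

/-- The functor sending a simplex of `F X` to the corresponding map `rX ⊗ Δ[n] ⟶ F`. -/
def simplicesToUnder : Simplices (F.obj (op X)) ⥤ (StructuredArrow X (canonicalBase F))ᵒᵖ where
  obj y := op (StructuredArrow.mk (S := X) (T := canonicalBase F)
    (Y := CostructuredArrow.mk (Y := (X, y.dim.unop)) (ofSimplex (X, y.dim.unop) y.simplex)) (𝟙 X))
  map {y y'} g := (StructuredArrow.homMk (CostructuredArrow.homMk (Prod.mkHom (𝟙 X) g.hom.unop)
    (map_comp_ofSimplex g)) (Category.comp_id _)).op
  map_id y := rfl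
  map_comp f g := by
    refine Quiver.Hom.unop_inj (StructuredArrow.hom_ext _ _ (CostructuredArrow.hom_ext _ _ ?_))
    exact Prod.ext (Category.comp_id (𝟙 X)).symm rfl

/-- The comparison of an object under `X` with the one given by its simplex. -/
def underToSimplicesUnit : 𝟭 _ ⟶ underToSimplices F X ⋙ simplicesToUnder F X where
  app j := (StructuredArrow.homMk (CostructuredArrow.homMk (Prod.mkHom j.unop.hom (𝟙 _)) (by
    refine hom_ext_repMk (Eq.trans ?_ (ofSimplex_app_id _ _ (𝟙 _)).symm)
    exact (congrArg₂ (fun f s ↦ (j.unop.right.hom.app (op X)).app _ (repMk (X := op X) f s))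
      (Category.id_comp j.unop.hom) (Category.comp_id (𝟙 _))).trans
        (ConcreteCategory.congr_hom ((F.obj (op X)).map_id _) _).symm)) (Category.id_comp _)).op
  naturality j j' g := by
    refine Quiver.Hom.unop_inj (StructuredArrow.hom_ext _ _ (CostructuredArrow.hom_ext _ _ ?_))
    exact Prod.ext ((StructuredArrow.w g.unop).trans (Category.id_comp j.unop.hom).symm)
      ((Category.id_comp _).trans (Category.comp_id _).symm)

/-- The comparison of a simplex with the one given by the corresponding map. -/
def simplicesToUnderUnit : 𝟭 _ ⟶ simplicesToUnder F X ⋙ underToSimplices F X where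
  app y := ⟨𝟙 _, (ofSimplex_app_id (X, y.dim.unop) y.simplex (𝟙 _)).symm⟩
  naturality _ _ _ := Simplices.Hom.ext ((Category.comp_id _).trans (Category.id_comp _).symm)

/-- The map of simplicial replacements induced by `underToSimplices`. -/
def barUnderToSimplices : bar (underDim F X) ⟶ bar (simplicesDim (F.obj (op X))) :=
  barMap (underToSimplices F X) (𝟙 (underDim F X))

/-- The functors in both directions commute with dimension, and the two units are identities in the
simplicial direction; all the required compatibilities are therefore identities. -/
lemma weakEquivalence_barUnderToSimplices : sSetWeakEquivalences (barUnderToSimplices F X) := by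
  refine weakEquivalence_barMap _ _ (simplicesToUnder F X) (𝟙 (simplicesDim (F.obj (op X))))
    (underToSimplicesUnit F X) (fun j ↦ ?_) (simplicesToUnderUnit F X) (fun y ↦ ?_)
  · exact (Category.id_comp _).trans (Category.id_comp (𝟙 ((underDim F X).obj j)))
  · exact (Category.id_comp _).trans (Category.id_comp (𝟙 y.dim))

lemma ι_comp_Qε (i : CostructuredArrow (repTensorSimplex (C := C)) F) :
    hocolim.ι (canonicalDiagram F) i ≫ Qε.app F = tensorFst _ _ ≫ i.hom := by
  refine (Category.assoc _ _ _).symm.trans ((congrArg (· ≫ colimit.desc (canonicalDiagram F)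
    (canonicalCocone F)) (ι_hocolimToColimit (canonicalDiagram F) i)).trans ?_)
  refine (Category.assoc _ _ _).trans (congrArg (tensorFst _ _ ≫ ·) ?_)
  exact colimit.ι_desc (canonicalCocone F) i

/-- Both composites send a chain with its last simplex to the image of that simplex under the
structure map to `F` at the last vertex. -/
lemma modelOfBar_comp_Qε :
    (modelOfBar F X ≫ (hocolimOfModel (canonicalDiagram F)).app (op X)) ≫ (Qε.app F).app (op X) =
      barUnderToSimplices F X ≫ barπ (F.obj (op X)) := by
  ext m x
  obtain ⟨c, s⟩ : BarSimplex (underDim F X) m := x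
  refine (ConcreteCategory.congr_hom (NatTrans.congr_app (NatTrans.congr_app (ι_comp_Qε F
    (c.obj (Fin.last _)).unop.right) (op X)) m) (HocolimSimplex.pair (D := canonicalDiagram F)
      (X := op X) (m := m) ⟨c ⋙ (StructuredArrow.proj X (canonicalBase F)).op, _⟩)).trans ?_
  refine (app_repMk (c.obj (Fin.last _)).unop.right.hom (X := op X)
    (c.obj (Fin.last _)).unop.hom s).trans ?_
  exact congrArg (fun s ↦ (F.obj (op X)).map s _) (Category.id_comp s).symm

lemma weakEquivalence_Qε : WeakEquivalence (Qε.app F) := by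
  refine ⟨fun X ↦ ?_⟩
  have h := MorphismProperty.comp_mem _ _ _ (weakEquivalence_barUnderToSimplices F X.unop)
    (weakEquivalence_barπ (F.obj X))
  refine MorphismProperty.of_precomp sSetWeakEquivalences (modelOfBar F X.unop ≫
    (hocolimOfModel (canonicalDiagram F)).app X) _ (sSetWeakEquivalences_of_isIso _) ?_
  exact (modelOfBar_comp_Qε F X.unop).symm ▸ h

end weakEquivalence

end UniversalHomotopy

theorem proposition2p7 {C : Type u} [SmallCategory C] (F : UniversalHomotopy.U C) :
    IsCofibrant (UniversalHomotopy.Q.obj F) ∧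
      WeakEquivalence (UniversalHomotopy.Qε.app F) := by
  exact ⟨UniversalHomotopy.isCofibrant_Q F, UniversalHomotopy.weakEquivalence_Qε F⟩
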